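/- **Notation.** Let $d\ge 2$ and let $\widehat g(\xi)=\int e^{-ix\cdot\xi}g(x)\,dx$ be the Fourier transform on $\mathcal S'(\mathbb R^d)$. For $r\ge 0$, $$PM^r=\{g\in\mathcal S'(\mathbb R^d):\ \widehat g\in L^1_{loc},\ \|g\|_{PM^r}:=\operatorname{ess\,sup}_{\xi}|\xi|^r|\widehat g(\xi)|<\infty\},$$ with $|\cdot|$ the Euclidean norm for vector-valued $g$. For $p,r>0$, $K^{p,r}_\infty$ is the space of continuous $g:\,]0,\infty[\,\to PM^{r+2/p}$ with $\|g\|_{K^{p,r}_\infty}:=\sup_{t>0}t^{1/p}\|g(t)\|_{PM^{r+2/p}}<\infty$, and $X_\infty:=(K^{p,d-1}_\infty\cap K^{p,d}_\infty)\times K^{p,d-1}_\infty$ has the norm $$\|(a,u)\|_{X_\infty}:=\max\{\|a\|_{K^{p,d-1}_\infty},\|a\|_{K^{p,d}_\infty}\}+\|u\|_{K^{p,d-1}_\infty}.$$ Let $\mu>0$, $\mu+\nu>0$, $\kappa>0$, $\alpha>0$ be constants, and consider, for a scalar $a$ and a vector field $u=(u_1,\dots,u_d)$, the Navier–Stokes–Korteweg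 system with quantum pressure $$\begin{cases}\partial_t a+\operatorname{div}u=f(u,a),\\ \partial_t u-\mu\Delta u-(\mu+\nu)\nabla\operatorname{div}u+\alpha\nabla a-\kappa\nabla\Delta a=g_1(u,u)+g_2(u,a)+g_3(a,a),\end{cases}\qquad (a,u)|_{t=0}=(a_0,u_0),$$ where $$f=-\sum_k u_k\partial_k a,\quad (g_1)_j=-\sum_k u_k\partial_k u_j,\quad (g_2)_j=\mu\sum_k\partial_k a\,\partial_k u_j+(\mu+\nu)\sum_k\partial_k a\,\partial_j u_k,\quad (g_3)_j=\tfrac{\kappa}{2}\partial_j\sum_k(\partial_k a)^2 .$$ Products are defined on the Fourier side by $\widehat{vw}=(2\pi)^{-d}\,\widehat v*\widehat w$. Let $A(\xi)$ be the matrix symbol of the linear operator $(a,u)\mapsto(\operatorname{div}u,\,-\mu\Delta u-(\mu+\nu)\nabla\operatorname{div}u+\alpha\nabla a-\kappa\nabla\Delta a)$ and let $W(t)$ be the Fourier multiplier with symbol $e^{-tA(\xi)}$. A pair $(a,u)$ is a global mild solution if the convolutions defining the products in $f,g_1,g_2,g_3$ converge absolutely for almost every $\xi$ at each time and, for every $t>0$,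 $$(a,u)(t)=W(t)(a_0,u_0)+\int_0^t W(t-s)\,(f,\,g_1+g_2+g_3)(s)\,ds,$$ that is, this identity holds between the Fourier transforms for almost every $\xi$, with an absolutely convergent time integral. **Theorem.** Let $d\ge2$ and $p>2$ satisfy $d-3+\frac4p>0$. There are $\rho>0$ and $R>0$, depending only on $d,p,\mu,\nu,\kappa,\alpha$, such that for every $(a_0,u_0)\in(PM^{d-1}\cap PM^d)\times PM^{d-1}$ with $$\|(a_0,|D|a_0,u_0)\|_{PM^{d-1}}\le\rho$$ there is a unique global mild solution $(a,u)\in X_\infty$ of the above system with $\|(a,u)\|_{X_\infty}\le R$. -/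

import Mathlib

open MeasureTheory Filter Topology
open scoped SchwartzMap FourierTransform ENNReal Convolution Matrix

noncomputable section

namespace QuantumNSK

/-- Physical space, and frequency space, `ℝᵈ` with its Euclidean norm. -/
abbrev Space (d : ℕ) : Type := EuclideanSpace ℝ (Fin d)

/-- Tempered distributions on `ℝᵈ`. -/
abbrev Distr (d : ℕ) : Type := 𝓢'(Space d, ℂ)

variable {d : ℕ} {ι : Type} [Fintype ι]

/-- The Fourier transform of `g`, in the angular normalization
`ĝ(ξ) = ∫ exp (-i x·ξ) g(x) dx`, is the locally integrable function `h`.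
Mathlib's transform `𝓕` has kernel `exp (-2πi x·ζ)`, so that `𝓕 g (ζ) = ĝ (2πζ)`.
Testing against all Schwartz functions (rather than those with compact support) makes no
difference for the functions `h` used below, which satisfy `|h ξ| ≤ C |ξ|⁻ʳ` with `r ≥ 0`. -/
def IsFourierFunction (g : Distr d) (h : Space d → ℂ) : Prop :=
  LocallyIntegrable h volume ∧
    ∀ φ : 𝓢(Space d, ℂ),
      Integrable (fun ζ : Space d => φ ζ * h ((2 * Real.pi) • ζ)) volume ∧
        (𝓕 g) φ = ∫ ζ : Space d, φ ζ * h ((2 * Real.pi) • ζ)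

/-- `ĝ` is a locally integrable function. -/
def HasFourierFunction (g : Distr d) : Prop := ∃ h, IsFourierFunction g h

open Classical in
/-- `ĝ` as a function (unique up to null sets), when it is one. -/
def hat (g : Distr d) : Space d → ℂ :=
  if h : HasFourierFunction g then h.choose else 0

/-- `ĝ` for a tuple `g` of distributions. -/
def hatVec (g : ι → Distr d) (ξ : Space d) : EuclideanSpace ℂ ι :=
  WithLp.toLp 2 fun j => hat (g j) ξ

/-- The (essential) supremum of `|ξ|ʳ |h ξ|`. -/
def weightedSup {F : Type} [NormedAddCommGroup F] [NormedSpace ℝ F] (r : ℝ)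
    (h : Space d → F) : ℝ≥0∞ :=
  eLpNorm (fun ξ => ‖ξ‖ ^ r • h ξ) ⊤ volume

/-- The norm of `PMʳ`, for tuples. -/
def pmNorm (r : ℝ) (g : ι → Distr d) : ℝ≥0∞ := weightedSup r (hatVec g)

/-- Membership in `PMʳ`, for tuples. -/
def MemPM (r : ℝ) (g : ι → Distr d) : Prop :=
  (∀ j, HasFourierFunction (g j)) ∧ pmNorm r g < ⊤

/-- A scalar distribution as a tuple of length one. -/
abbrev scalar (g : Distr d) : Unit → Distr d := fun _ => g

/-- The norm `sup_{t > 0} t^{1/p} ‖g(t)‖_{PM^{r+2/p}}`. -/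
def katoNorm (p r : ℝ) (g : ℝ → ι → Distr d) : ℝ≥0∞ :=
  ⨆ t : Set.Ioi (0 : ℝ), ENNReal.ofReal ((t : ℝ) ^ (1 / p)) * pmNorm (r + 2 / p) (g t)

/-- Membership in the Kato space `K^{p,r}_∞`. Only the values `g t` with `t > 0` matter. -/
def MemKato (p r : ℝ) (g : ℝ → ι → Distr d) : Prop :=
  (∀ t > 0, MemPM (r + 2 / p) (g t)) ∧
    (∀ t > 0, Tendsto (fun s => pmNorm (r + 2 / p) (g s - g t)) (𝓝 t) (𝓝 0)) ∧
      katoNorm p r g < ⊤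

/-- `(a, u) ∈ X_∞ = (K^{p,d-1}_∞ ∩ K^{p,d}_∞) × K^{p,d-1}_∞`. -/
def MemX (p : ℝ) (a : ℝ → Distr d) (u : ℝ → Fin d → Distr d) : Prop :=
  MemKato p ((d : ℝ) - 1) (fun t => scalar (a t)) ∧
    MemKato p (d : ℝ) (fun t => scalar (a t)) ∧ MemKato p ((d : ℝ) - 1) u

/-- The norm of `X_∞`. -/
def xNorm (p : ℝ) (a : ℝ → Distr d) (u : ℝ → Fin d → Distr d) : ℝ≥0∞ :=
  max (katoNorm p ((d : ℝ) - 1) fun t => scalar (a t))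
      (katoNorm p (d : ℝ) fun t => scalar (a t)) +
    katoNorm p ((d : ℝ) - 1) u

/-- `‖(a₀, |D|a₀, u₀)‖_{PMʳ} = sup_ξ |ξ|ʳ |(â₀, |ξ|â₀, û₀)(ξ)|`. -/
def dataNorm (r : ℝ) (a₀ : Distr d) (u₀ : Fin d → Distr d) : ℝ≥0∞ :=
  weightedSup r fun ξ : Space d =>
    √(‖hat a₀ ξ‖ ^ 2 + (‖ξ‖ * ‖hat a₀ ξ‖) ^ 2 + ‖hatVec u₀ ξ‖ ^ 2)

/-- The symbol `A(ξ)` of the linear operator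
`(a, u) ↦ (div u, -μ Δu - (μ+ν) ∇ div u + α ∇a - κ ∇Δa)`. -/
def linSymbol (μ ν κ α : ℝ) (ξ : Space d) : Matrix (Unit ⊕ Fin d) (Unit ⊕ Fin d) ℂ :=
  Matrix.fromBlocks
    0
    (Matrix.of fun _ k => Complex.I * (ξ k : ℂ))
    (Matrix.of fun j _ => Complex.I * ((α * ξ j + κ * ξ j * ‖ξ‖ ^ 2 : ℝ) : ℂ))
    (Matrix.of fun j k =>
      (((if j = k then μ * ‖ξ‖ ^ 2 else 0) + (μ + ν) * ξ j * ξ k : ℝ) : ℂ))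

/-- The symbol `exp (-t A(ξ))` of the linear semigroup `W(t)`. -/
def semigroupSymbol (μ ν κ α t : ℝ) (ξ : Space d) :
    Matrix (Unit ⊕ Fin d) (Unit ⊕ Fin d) ℂ :=
  NormedSpace.exp (-(t : ℂ) • linSymbol μ ν κ α ξ)

/-- `∂_k` on the Fourier side. -/
def dHat (k : Fin d) (h : Space d → ℂ) : Space d → ℂ := fun ξ => Complex.I * (ξ k : ℂ) * h ξ

/-- The product on the Fourier side: `(vw)^ = (2π)⁻ᵈ v̂ ⋆ ŵ`. -/
def prodHat (h k : Space d → ℂ) : Space d → ℂ := fun ξ =>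
  ((2 * Real.pi : ℝ) : ℂ)⁻¹ ^ d * (h ⋆[ContinuousLinearMap.mul ℂ ℂ, volume] k) ξ

/-- The convolution integral that defines the product converges absolutely almost everywhere. -/
def ProdConverges (h k : Space d → ℂ) : Prop :=
  ∀ᵐ ξ : Space d, ConvolutionExistsAt h k ξ (ContinuousLinearMap.mul ℂ ℂ) volume

/-- The Fourier transform of `f(u,a) = -u·∇a`. -/
def fHat (u : Fin d → Space d → ℂ) (a : Space d → ℂ) (ξ : Space d) : ℂ :=
  -∑ k, prodHat (u k) (dHat k a) ξ

/-- The Fourier transform of the `j`-th component of `g₁(u,u) = -u·∇u`. -/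
def g₁Hat (u : Fin d → Space d → ℂ) (j : Fin d) (ξ : Space d) : ℂ :=
  -∑ k, prodHat (u k) (dHat k (u j)) ξ

/-- The Fourier transform of the `j`-th component of `g₂(u,a) = μ ∇a·∇u + (μ+ν) ∇a·Du`, where
`(∇a·∇u)_j = ∑_k ∂_k a ∂_k u_j` and `(∇a·Du)_j = ∑_k ∂_k a ∂_j u_k`. -/
def g₂Hat (μ ν : ℝ) (u : Fin d → Space d → ℂ) (a : Space d → ℂ) (j : Fin d) (ξ : Space d) : ℂ :=
  (μ : ℂ) * ∑ k, prodHat (dHat k a) (dHat k (u j)) ξ +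
    ((μ + ν : ℝ) : ℂ) * ∑ k, prodHat (dHat k a) (dHat j (u k)) ξ

/-- The Fourier transform of the `j`-th component of `g₃(a,a) = (κ/2) ∇(∇a·∇a)`. -/
def g₃Hat (κ : ℝ) (a : Space d → ℂ) (j : Fin d) (ξ : Space d) : ℂ :=
  ((κ / 2 : ℝ) : ℂ) * dHat j (fun η => ∑ k, prodHat (dHat k a) (dHat k a) η) ξ

/-- The Fourier transform of the nonlinear term `(f, g₁ + g₂ + g₃)`. -/
def nonlinHat (μ ν κ : ℝ) (a : Distr d) (u : Fin d → Distr d) (ξ : Space d) :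
    Unit ⊕ Fin d → ℂ :=
  Sum.elim (fun _ => fHat (fun k => hat (u k)) (hat a) ξ)
    (fun j => g₁Hat (fun k => hat (u k)) j ξ + g₂Hat μ ν (fun k => hat (u k)) (hat a) j ξ +
      g₃Hat κ (hat a) j ξ)

/-- All products in the nonlinear terms are well defined. -/
def NonlinWellDefined (a : Distr d) (u : Fin d → Distr d) : Prop :=
  ∀ j k : Fin d,
    ProdConverges (hat (u k)) (dHat k (hat a)) ∧
    ProdConverges (hat (u k)) (dHat k (hat (u j))) ∧
    ProdConverges (dHat k (hat a)) (dHat k (hat (u j))) ∧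
    ProdConverges (dHat k (hat a)) (dHat j (hat (u k))) ∧
    ProdConverges (dHat k (hat a)) (dHat k (hat a))

/-- `(â, û)(ξ)` as one column. -/
def stateHat (a : Distr d) (u : Fin d → Distr d) (ξ : Space d) : Unit ⊕ Fin d → ℂ :=
  Sum.elim (fun _ => hat a ξ) (fun j => hat (u j) ξ)

/-- `(a, u)` is a global mild solution with data `(a₀, u₀)`: the nonlinear terms are well defined
and, for every `t > 0`, on the Fourier side,
`(a,u)(t) = W(t)(a₀,u₀) + ∫₀ᵗ W(t-s) (f,g)(s) ds`, with an absolutely convergent integral. -/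
def IsMildSolution (μ ν κ α : ℝ) (a₀ : Distr d) (u₀ : Fin d → Distr d)
    (a : ℝ → Distr d) (u : ℝ → Fin d → Distr d) : Prop :=
  (∀ s > 0, NonlinWellDefined (a s) (u s)) ∧
    ∀ t > 0, ∀ᵐ ξ : Space d,
      IntervalIntegrable
          (fun s => semigroupSymbol μ ν κ α (t - s) ξ *ᵥ nonlinHat μ ν κ (a s) (u s) ξ)
          volume 0 t ∧
        stateHat (a t) (u t) ξ = semigroupSymbol μ ν κ α t ξ *ᵥ stateHat a₀ u₀ ξ +
          ∫ s in (0 : ℝ)..t,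
            semigroupSymbol μ ν κ α (t - s) ξ *ᵥ nonlinHat μ ν κ (a s) (u s) ξ

end QuantumNSK

end

/-!
On the Fourier side the system is a Duhamel equation for the state `x = (â, û)`. At the frequency
`ξ` the state is measured by the norm `max ((1 + |ξ|) |a|, |u₁|, …, |u_d|)` (`stateNorm`), and
the space `X_∞` is, up to constants, the space of trajectories for which this norm is
`O(t^{-1/p} |ξ|^{-θ})` with `θ = d - 1 + 2/p`. In this space the Duhamel equation is solved by
Picard iteration. Two estimates make the Duhamel map a contraction on small balls.

* The linear semigroup decays like the heat semigroup: `e^{-tA(ξ)}` is `O(e^{-ct|ξ|²})` for the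
  norm above (`exists_stateNorm_semigroup_le`). The quantity `|u|² + (α + κ|ξ|²) |a|²` is only
  dissipated through `u`; subtracting `2δ Re (ā · iξ·u)` for a small `δ` yields an energy that
  controls it and decays at the rate `|ξ|²` (`exists_energy_decay`).
* The nonlinear term maps the weight `|ξ|^{-θ}` to `|ξ|^{d+1-2θ}`, with a Lipschitz bound
  (`exists_nonlinState_sub_le`). This reduces to convolutions of powers,
  `|ξ|^{-θ} ⋆ |ξ|^{-θ} ≤ C |ξ|^{d-2θ}` and `|ξ|^{-θ} ⋆ |ξ|^{1-θ} ≤ C |ξ|^{d+1-2θ}`, which converge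
  at the origin because `θ < d`, that is `p > 2`, and at infinity because `2θ - 1 > d`, that is
  `d - 3 + 4/p > 0`.

Since `e^{-c(t-s)|ξ|²} ≤ C ((t-s)|ξ|²)^{-(1-1/p)}`, the remaining time integral is the beta
integral `∫₀ᵗ (t-s)^{-(1-1/p)} s^{-2/p} ds = C t^{-1/p}`, and the powers of `|ξ|` add up to `-θ`
(`exists_duhamelLipschitz`).

The convolutions converge at every `ξ ≠ 0` and do not depend on representatives of their factors. Hence the iteration can be carried out with genuine functions, with bounds at every `t > 0`
and `ξ ≠ 0` (`exists_duhamel_fixedPoint`). Uniqueness requires no measurability in time of the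
competing solution, as the difference of two solutions is at each time bounded by the time integral
of an explicit function (`ae_eq_of_duhamel_fixedPoint`). Continuity in time with values in `PM` follows
from the Hölder continuity of the semigroup, at the cost of a small part of its smoothing effect
(`exists_modulus_of_fixedPoint`). Finally, a function `O(|ξ|^{-θ})` with `0 ≤ θ < d` is the Fourier
transform of a unique tempered distribution (`exists_isFourierFunction`, `eq_of_hat_ae_eq`).
-/

noncomputable section

namespace QuantumNSK

variable {d : ℕ} {ι : Type} [Fintype ι]

/-! ### Tempered distributions with prescribed Fourier transform -/

lemma nontrivial_space (hd : 0 < d) : Nontrivial (Space d) := by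
  have : Nonempty (Fin d) := ⟨⟨0, hd⟩⟩
  infer_instance

lemma integrableOn_ball_norm_rpow (hd : 0 < d) {r : ℝ} (hr : r < d) (R : ℝ) :
    IntegrableOn (fun ξ : Space d => ‖ξ‖ ^ (-r)) (Metric.ball 0 R) volume := by
  have := nontrivial_space hd
  rw [integrableOn_fun_norm_addHaar (μ := volume) (f := fun y : ℝ => y ^ (-r)) (r := R)]
  rcases le_or_gt R 0 with hR | hR
  · simp [Set.Ioo_eq_empty (not_lt.mpr hR)]
  have hcd : (((d - 1 : ℕ) : ℝ)) = (d : ℝ) - 1 := by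
    rw [Nat.cast_sub hd, Nat.cast_one]
  have h1 : IntegrableOn (fun y : ℝ => y ^ ((d : ℝ) - 1 - r)) (Set.Ioo 0 R) volume :=
    ((intervalIntegral.intervalIntegrable_rpow' (a := 0) (b := R) (by linarith)).1).mono_set
      Set.Ioo_subset_Ioc_self
  refine h1.congr_fun ?_ measurableSet_Ioo
  intro y hy
  have hy0 : 0 < y := hy.1
  simp only [finrank_euclideanSpace, Fintype.card_fin, smul_eq_mul]
  rw [← Real.rpow_natCast, hcd, ← Real.rpow_add hy0]
  congr 1

lemma quasiMeasurePreserving_two_pi_smul :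
    Measure.QuasiMeasurePreserving (fun ζ : Space d => (2 * Real.pi) • ζ) volume volume :=
  Measure.quasiMeasurePreserving_smul volume (by positivity)

lemma integrableOn_ball_of_bound (hd : 0 < d) {h : Space d → ℂ} {M r : ℝ} (hr : r < d)
    (hm : AEStronglyMeasurable h volume) (hb : ∀ᵐ ξ, ‖h ξ‖ ≤ M * ‖ξ‖ ^ (-r)) (R : ℝ) :
    IntegrableOn h (Metric.ball 0 R) volume :=
  ((integrableOn_ball_norm_rpow hd hr R).const_mul M).mono' hm.restrict
    (ae_restrict_of_ae hb)

lemma locallyIntegrable_of_bound (hd : 0 < d) {h : Space d → ℂ} {M r : ℝ} (hr : r < d)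
    (hm : AEStronglyMeasurable h volume) (hb : ∀ᵐ ξ, ‖h ξ‖ ≤ M * ‖ξ‖ ^ (-r)) :
    LocallyIntegrable h volume := by
  rw [locallyIntegrable_iff]
  intro K hK
  obtain ⟨R, hR⟩ := hK.isBounded.subset_ball 0
  exact (integrableOn_ball_of_bound hd hr hm hb R).mono_set hR

/-- A function dominated by `|ξ|⁻ʳ` with `0 ≤ r < d` is the Fourier transform of a tempered
distribution: it is the sum of an integrable function, supported in a ball, and a bounded one. -/
lemma exists_isFourierFunction (hd : 0 < d) {h : Space d → ℂ} {M r : ℝ} (hr0 : 0 ≤ r) (hr : r < d)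
    (hm : AEStronglyMeasurable h volume) (hb : ∀ᵐ ξ, ‖h ξ‖ ≤ M * ‖ξ‖ ^ (-r)) :
    ∃ g : Distr d, IsFourierFunction g h := by
  set k : Space d → ℂ := fun ζ => h ((2 * Real.pi) • ζ) with hk
  have hkm : AEStronglyMeasurable k volume :=
    hm.comp_quasiMeasurePreserving quasiMeasurePreserving_two_pi_smul
  have hkb : ∀ᵐ ζ, ‖k ζ‖ ≤ M * (2 * Real.pi) ^ (-r) * ‖ζ‖ ^ (-r) := by
    have := quasiMeasurePreserving_two_pi_smul.ae hb
    filter_upwards [this] with ζ hζ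
    rw [norm_smul, Real.mul_rpow (by positivity) (by positivity), ← mul_assoc] at hζ
    simpa [abs_of_pos Real.pi_pos] using hζ
  set B : Set (Space d) := Metric.ball 0 1 with hB
  have hBm : MeasurableSet B := measurableSet_ball
  have h1 : MemLp (B.indicator k) 1 volume := by
    rw [memLp_one_iff_integrable, integrable_indicator_iff hBm]
    exact integrableOn_ball_of_bound hd hr hkm hkb 1
  have h2 : MemLp (Bᶜ.indicator k) ⊤ volume := by
    refine memLp_top_of_bound (hkm.indicator hBm.compl) (|M * (2 * Real.pi) ^ (-r)|) ?_
    filter_upwards [hkb] with ζ hζ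
    by_cases hζB : ζ ∈ B
    · simp only [Set.mem_compl_iff, hζB, not_true_eq_false, not_false_eq_true,
        Set.indicator_of_notMem, norm_zero]
      positivity
    · have h1' : 1 ≤ ‖ζ‖ := by simpa [hB] using hζB
      rw [Set.indicator_of_mem (by simpa using hζB)]
      refine hζ.trans ((le_abs_self _).trans ?_)
      rw [abs_mul]
      refine mul_le_of_le_one_right (abs_nonneg _) ?_
      rw [abs_of_nonneg (by positivity)]
      exact Real.rpow_le_one_of_one_le_of_nonpos h1' (by linarith)
  have hsum : ∀ ζ, k ζ = B.indicator k ζ + Bᶜ.indicator k ζ := fun ζ =>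
    (congrFun (Set.indicator_self_add_compl B k) ζ).symm
  have hI1 : ∀ φ : 𝓢(Space d, ℂ), Integrable (fun ζ => φ ζ * B.indicator k ζ) volume := by
    intro φ
    obtain ⟨C, hC⟩ := φ.decay 0 0
    refine (memLp_one_iff_integrable.1 h1).bdd_mul (c := C)
      φ.continuous.aestronglyMeasurable ?_
    exact Eventually.of_forall fun x => by simpa using hC.2 x
  have hI2 : ∀ φ : 𝓢(Space d, ℂ), Integrable (fun ζ => φ ζ * Bᶜ.indicator k ζ) volume := by
    intro φ
    exact φ.integrable.mul_of_top_left h2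
  set T₁ : Distr d := Lp.toTemperedDistribution (h1.toLp _) with hT₁
  set T₂ : Distr d := Lp.toTemperedDistribution (h2.toLp _) with hT₂
  refine ⟨𝓕⁻ (T₁ + T₂),
    locallyIntegrable_of_bound hd hr hm hb, fun φ => ⟨?_, ?_⟩⟩
  · refine ((hI1 φ).add (hI2 φ)).congr (Eventually.of_forall fun ζ => ?_)
    change _ = φ ζ * k ζ
    rw [hsum ζ, mul_add]; rfl
  · rw [FourierTransform.fourier_fourierInv_eq]
    change T₁ φ + T₂ φ = _
    rw [hT₁, hT₂, Lp.toTemperedDistribution_apply, Lp.toTemperedDistribution_apply]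
    have e1 : ∫ ζ, φ ζ • (h1.toLp _ : Lp ℂ 1 volume) ζ = ∫ ζ, φ ζ * B.indicator k ζ := by
      refine integral_congr_ae ?_
      filter_upwards [h1.coeFn_toLp] with ζ hζ
      rw [hζ, smul_eq_mul]
    have e2 : ∫ ζ, φ ζ • (h2.toLp _ : Lp ℂ ⊤ volume) ζ = ∫ ζ, φ ζ * Bᶜ.indicator k ζ := by
      refine integral_congr_ae ?_
      filter_upwards [h2.coeFn_toLp] with ζ hζ
      rw [hζ, smul_eq_mul]
    rw [e1, e2, ← integral_add (hI1 φ) (hI2 φ)]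
    refine integral_congr_ae (Eventually.of_forall fun ζ => ?_)
    change _ = φ ζ * k ζ
    simp only [hsum ζ, mul_add]

lemma ae_of_ae_two_pi_smul {P : Space d → Prop}
    (h : ∀ᵐ ζ : Space d, P ((2 * Real.pi) • ζ)) : ∀ᵐ ξ : Space d, P ξ := by
  have h2 : Measure.QuasiMeasurePreserving (fun ζ : Space d => (2 * Real.pi)⁻¹ • ζ) volume volume :=
    Measure.quasiMeasurePreserving_smul volume (by positivity)
  filter_upwards [h2.ae h] with ξ hξ
  rwa [smul_inv_smul₀ (by positivity)] at hξ

lemma IsFourierFunction.sub {g₁ g₂ : Distr d} {h₁ h₂ : Space d → ℂ}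
    (H₁ : IsFourierFunction g₁ h₁) (H₂ : IsFourierFunction g₂ h₂) :
    IsFourierFunction (g₁ - g₂) (h₁ - h₂) := by
  refine ⟨H₁.1.sub H₂.1, fun φ => ⟨?_, ?_⟩⟩
  · refine ((H₁.2 φ).1.sub (H₂.2 φ).1).congr (Eventually.of_forall fun ζ => ?_)
    simp [mul_sub]
  · have : 𝓕 (g₁ - g₂) = 𝓕 g₁ - 𝓕 g₂ := (FourierTransform.fourierCLM ℂ (Distr d)).map_sub g₁ g₂
    rw [this]
    change 𝓕 g₁ φ - 𝓕 g₂ φ = _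
    rw [(H₁.2 φ).2, (H₂.2 φ).2, ← integral_sub (H₁.2 φ).1 (H₂.2 φ).1]
    simp [mul_sub]

lemma IsFourierFunction.ae_eq {g : Distr d} {h₁ h₂ : Space d → ℂ}
    (H₁ : IsFourierFunction g h₁) (H₂ : IsFourierFunction g h₂) : h₁ =ᵐ[volume] h₂ := by
  refine ae_of_ae_two_pi_smul (P := fun ξ => h₁ ξ = h₂ ξ) ?_
  have hloc : ∀ {h : Space d → ℂ}, LocallyIntegrable h volume →
      LocallyIntegrable (fun ζ : Space d => h ((2 * Real.pi) • ζ)) volume := by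
    intro h hh
    rw [locallyIntegrable_iff] at hh ⊢
    intro K hK
    have hpi : (2 * Real.pi) ≠ 0 := by positivity
    have hK' : IsCompact ((fun ζ : Space d => (2 * Real.pi) • ζ) '' K) :=
      hK.image (by fun_prop)
    have h1 := (hh _ hK').integrable_indicator hK'.measurableSet
    rw [← integrable_comp_smul_iff volume _ hpi] at h1
    rw [← integrable_indicator_iff hK.measurableSet]
    refine h1.congr (Eventually.of_forall fun ζ => ?_)
    by_cases hζ : ζ ∈ K
    · simp only [hζ, Set.indicator_of_mem]
      rw [Set.indicator_of_mem (Set.mem_image_of_mem _ hζ)]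
    · beta_reduce
      rw [Set.indicator_of_notMem hζ, Set.indicator_of_notMem]
      rintro ⟨ζ', hζ', he⟩
      exact hζ ((smul_right_injective _ hpi he) ▸ hζ')
  refine ae_eq_of_integral_contDiff_smul_eq (hloc H₁.1) (hloc H₂.1) fun φ hφ hc => ?_
  have hg₁ : HasCompactSupport (Complex.ofRealCLM ∘ φ) := hc.comp_left rfl
  have hg₂ : ContDiff ℝ ((⊤ : ℕ∞) : WithTop ℕ∞) (Complex.ofRealCLM ∘ φ) := by fun_prop
  have h1 := (H₁.2 (hg₁.toSchwartzMap hg₂)).2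
  rw [(H₂.2 (hg₁.toSchwartzMap hg₂)).2] at h1
  simpa [eq_comm] using h1

lemma isFourierFunction_hat {g : Distr d} (hg : HasFourierFunction g) :
    IsFourierFunction g (hat g) := by
  unfold hat
  rw [dif_pos hg]
  exact hg.choose_spec

lemma IsFourierFunction.hat_ae_eq {g : Distr d} {h : Space d → ℂ} (H : IsFourierFunction g h) :
    hat g =ᵐ[volume] h :=
  (isFourierFunction_hat ⟨h, H⟩).ae_eq H

lemma hat_sub_ae_eq {g₁ g₂ : Distr d} (H₁ : HasFourierFunction g₁) (H₂ : HasFourierFunction g₂) :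
    hat (g₁ - g₂) =ᵐ[volume] hat g₁ - hat g₂ :=
  ((isFourierFunction_hat H₁).sub (isFourierFunction_hat H₂)).hat_ae_eq

/-- A distribution is determined by its Fourier transform. -/
lemma eq_of_hat_ae_eq {g₁ g₂ : Distr d} (H₁ : HasFourierFunction g₁) (H₂ : HasFourierFunction g₂)
    (h : hat g₁ =ᵐ[volume] hat g₂) : g₁ = g₂ := by
  have hF : 𝓕 g₁ = 𝓕 g₂ := by
    ext φ
    rw [((isFourierFunction_hat H₁).2 φ).2, ((isFourierFunction_hat H₂).2 φ).2]
    refine integral_congr_ae ?_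
    filter_upwards [quasiMeasurePreserving_two_pi_smul.ae h] with ζ hζ
    rw [hζ]
  have hF' : 𝓕⁻ (𝓕 g₁) = 𝓕⁻ (𝓕 g₂) := congrArg _ hF
  rwa [FourierTransform.fourierInv_fourier_eq, FourierTransform.fourierInv_fourier_eq] at hF'

lemma aestronglyMeasurable_hat {g : Distr d} (hg : HasFourierFunction g) :
    AEStronglyMeasurable (hat g) volume :=
  (isFourierFunction_hat hg).1.aestronglyMeasurable

/-! ### The weighted norm of a state at one frequency -/

/-- The linear map `(a, u) ↦ ((1 + |ξ|) a, u)` on states at the frequency `ξ`. -/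
def stateScale (ξ : Space d) : (Unit ⊕ Fin d → ℂ) →L[ℂ] (Unit ⊕ Fin d → ℂ) :=
  ContinuousLinearMap.pi fun i =>
    (Sum.elim (fun _ => ((1 + ‖ξ‖ : ℝ) : ℂ)) (fun _ => 1) i : ℂ) • ContinuousLinearMap.proj i

/-- The norm `max ((1 + |ξ|) |a|, |u₁|, …, |u_d|)` of a state at the frequency `ξ`. The two norms
of `a` in `X_∞` and the norm of `u` together say that this quantity is `O(t^{-1/p} |ξ|^{-θ})`
with `θ = d - 1 + 2/p`. -/
def stateNorm (ξ : Space d) (x : Unit ⊕ Fin d → ℂ) : ℝ := ‖stateScale ξ x‖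

lemma stateNorm_nonneg (ξ : Space d) (x : Unit ⊕ Fin d → ℂ) : 0 ≤ stateNorm ξ x := norm_nonneg _

lemma stateNorm_le_iff {ξ : Space d} {x : Unit ⊕ Fin d → ℂ} {M : ℝ} (hM : 0 ≤ M) :
    stateNorm ξ x ≤ M ↔ (1 + ‖ξ‖) * ‖x (Sum.inl ())‖ ≤ M ∧ ∀ j, ‖x (Sum.inr j)‖ ≤ M := by
  have h0 : ‖((1 + ‖ξ‖ : ℝ) : ℂ)‖ = 1 + ‖ξ‖ := by
    rw [Complex.norm_real, Real.norm_of_nonneg (by positivity)]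
  rw [stateNorm, pi_norm_le_iff_of_nonneg hM]
  constructor
  · intro h
    refine ⟨?_, fun j => ?_⟩
    · have := h (Sum.inl ())
      simpa only [stateScale, ContinuousLinearMap.pi_apply, Sum.elim_inl,
        smul_apply, ContinuousLinearMap.proj_apply, smul_eq_mul, norm_mul,
        h0] using this
    · simpa [stateScale] using h (Sum.inr j)
  · rintro ⟨h1, h2⟩ (i | j)
    · simpa only [stateScale, ContinuousLinearMap.pi_apply, Sum.elim_inl,
        smul_apply, ContinuousLinearMap.proj_apply, smul_eq_mul, norm_mul,
        h0] using h1
    · simpa [stateScale] using h2 j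

lemma stateNorm_add_le (ξ : Space d) (x y : Unit ⊕ Fin d → ℂ) :
    stateNorm ξ (x + y) ≤ stateNorm ξ x + stateNorm ξ y := by
  simpa [stateNorm] using norm_add_le (stateScale ξ x) (stateScale ξ y)

lemma stateNorm_sub_le (ξ : Space d) (x y : Unit ⊕ Fin d → ℂ) :
    stateNorm ξ (x - y) ≤ stateNorm ξ x + stateNorm ξ y := by
  simpa [stateNorm] using norm_sub_le (stateScale ξ x) (stateScale ξ y)

lemma stateNorm_sub_le_sub_add_sub (ξ : Space d) (x y z : Unit ⊕ Fin d → ℂ) :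
    stateNorm ξ (x - z) ≤ stateNorm ξ (x - y) + stateNorm ξ (y - z) := by
  simpa using stateNorm_add_le ξ (x - y) (y - z)

lemma stateNorm_zero (ξ : Space d) : stateNorm ξ 0 = 0 := by simp [stateNorm]

lemma stateNorm_sub_comm (ξ : Space d) (x y : Unit ⊕ Fin d → ℂ) :
    stateNorm ξ (x - y) = stateNorm ξ (y - x) := by
  simp [stateNorm, norm_sub_rev]

lemma norm_le_stateNorm (ξ : Space d) (x : Unit ⊕ Fin d → ℂ) : ‖x‖ ≤ stateNorm ξ x := by
  obtain ⟨h1, h2⟩ := (stateNorm_le_iff (stateNorm_nonneg ξ x)).1 le_rfl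
  rw [pi_norm_le_iff_of_nonneg (stateNorm_nonneg ξ x)]
  rintro (i | j)
  · refine le_trans ?_ h1
    nlinarith [norm_nonneg (x (Sum.inl ())), norm_nonneg ξ, mul_nonneg (norm_nonneg ξ)
      (norm_nonneg (x (Sum.inl ())))]
  · exact h2 j

lemma continuous_stateNorm :
    Continuous fun q : Space d × (Unit ⊕ Fin d → ℂ) => stateNorm q.1 q.2 := by
  have : Continuous fun q : Space d × (Unit ⊕ Fin d → ℂ) => stateScale q.1 q.2 := by
    refine continuous_pi ?_
    rintro (i | j)
    · simp only [stateScale, ContinuousLinearMap.pi_apply, Sum.elim_inl,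
        smul_apply, ContinuousLinearMap.proj_apply, smul_eq_mul]
      fun_prop
    · simp only [stateScale, ContinuousLinearMap.pi_apply, Sum.elim_inr,
        smul_apply, ContinuousLinearMap.proj_apply, smul_eq_mul]
      fun_prop
  exact this.norm

lemma stateNorm_integral_le {ξ : Space d} {τ : Measure ℝ} {F : ℝ → Unit ⊕ Fin d → ℂ} {G : ℝ → ℝ}
    (hG : Integrable G τ) (h : ∀ᵐ s ∂τ, stateNorm ξ (F s) ≤ G s) :
    stateNorm ξ (∫ s, F s ∂τ) ≤ ∫ s, G s ∂τ := by
  by_cases hF : Integrable F τ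
  · rw [stateNorm, ← ContinuousLinearMap.integral_comp_comm _ hF]
    exact norm_integral_le_of_norm_le hG h
  · rw [integral_undef hF, stateNorm_zero]
    exact integral_nonneg_of_ae (h.mono fun s hs => (stateNorm_nonneg _ _).trans hs)

/-! ### The norms of the solution space in terms of the state norm -/

lemma ae_ne_zero (hd : 0 < d) : ∀ᵐ ξ : Space d, ξ ≠ 0 := by
  have := nontrivial_space hd
  rw [ae_iff]
  simp

section
variable {F : Type} [NormedAddCommGroup F] [NormedSpace ℝ F]

lemma weightedSup_le (hd : 0 < d) {h : Space d → F} {M r : ℝ}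
    (hb : ∀ᵐ ξ, ‖h ξ‖ ≤ M * ‖ξ‖ ^ (-r)) : weightedSup r h ≤ ENNReal.ofReal M := by
  rw [weightedSup, eLpNorm_exponent_top]
  refine eLpNormEssSup_le_of_ae_bound ?_
  filter_upwards [hb, ae_ne_zero hd] with ξ hξ h0
  have h0' : 0 < ‖ξ‖ := norm_pos_iff.2 h0
  rw [norm_smul, Real.norm_of_nonneg (by positivity)]
  calc ‖ξ‖ ^ r * ‖h ξ‖ ≤ ‖ξ‖ ^ r * (M * ‖ξ‖ ^ (-r)) := by gcongr
    _ = M * (‖ξ‖ ^ r * ‖ξ‖ ^ (-r)) := by ring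
    _ = M := by rw [← Real.rpow_add h0']; simp

lemma ae_bound_of_weightedSup_le (hd : 0 < d) {h : Space d → F} {M r : ℝ} (hM : 0 ≤ M)
    (hb : weightedSup r h ≤ ENNReal.ofReal M) : ∀ᵐ ξ, ‖h ξ‖ ≤ M * ‖ξ‖ ^ (-r) := by
  rw [weightedSup, eLpNorm_exponent_top] at hb
  filter_upwards [enorm_ae_le_eLpNormEssSup (fun ξ => ‖ξ‖ ^ r • h ξ) volume, ae_ne_zero hd]
    with ξ hξ h0
  have h0' : 0 < ‖ξ‖ := norm_pos_iff.2 h0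
  have h1 := hξ.trans hb
  rw [← ofReal_norm, ENNReal.ofReal_le_ofReal_iff hM, norm_smul,
    Real.norm_of_nonneg (by positivity)] at h1
  rw [Real.rpow_neg h0'.le, ← div_eq_mul_inv, le_div_iff₀ (by positivity), mul_comm]
  exact h1

end

lemma pmNorm_le_of_stateNorm_le (hd : 0 < d) {a : Distr d} {u : Fin d → Distr d} {M r : ℝ}
    (hM : 0 ≤ M) (h : ∀ᵐ ξ, stateNorm ξ (stateHat a u ξ) ≤ M * ‖ξ‖ ^ (-r)) :
    pmNorm r (scalar a) ≤ ENNReal.ofReal M ∧ pmNorm (r + 1) (scalar a) ≤ ENNReal.ofReal M ∧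
      pmNorm r u ≤ ENNReal.ofReal (d * M) := by
  have hs : ∀ ξ, ‖hatVec (scalar a) ξ‖ = ‖hat a ξ‖ := by
    intro ξ
    rw [EuclideanSpace.norm_eq]
    simp [hatVec]
  refine ⟨weightedSup_le hd ?_, weightedSup_le hd ?_, weightedSup_le hd ?_⟩
  · filter_upwards [h] with ξ hξ
    have h1 := ((stateNorm_le_iff (by positivity)).1 hξ).1
    rw [hs]
    refine le_trans ?_ h1
    change _ ≤ (1 + ‖ξ‖) * ‖hat a ξ‖
    nlinarith [mul_nonneg (norm_nonneg ξ) (norm_nonneg (hat a ξ))]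
  · filter_upwards [h, ae_ne_zero hd] with ξ hξ h0
    have h0' : 0 < ‖ξ‖ := norm_pos_iff.2 h0
    have h1 := ((stateNorm_le_iff (by positivity)).1 hξ).1
    change (1 + ‖ξ‖) * ‖hat a ξ‖ ≤ _ at h1
    have h2 : ‖ξ‖ * ‖hat a ξ‖ ≤ M * ‖ξ‖ ^ (-r) := by nlinarith [norm_nonneg (hat a ξ)]
    rw [hs, neg_add, Real.rpow_add h0', Real.rpow_neg_one, ← mul_assoc, ← div_eq_mul_inv,
      le_div_iff₀ h0', mul_comm]
    exact h2
  · filter_upwards [h] with ξ hξ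
    have h1 := ((stateNorm_le_iff (by positivity)).1 hξ).2
    have h2 : ‖hatVec u ξ‖ ≤ ∑ j, ‖hat (u j) ξ‖ := by
      rw [EuclideanSpace.norm_eq, Real.sqrt_le_left (Finset.sum_nonneg fun _ _ => norm_nonneg _)]
      exact Finset.sum_sq_le_sq_sum_of_nonneg fun _ _ => norm_nonneg _
    refine h2.trans ((Finset.sum_le_card_nsmul _ _ _ fun j _ => h1 j).trans ?_)
    simp [mul_assoc]

lemma norm_hat_le_norm_hatVec (g : ι → Distr d) (j : ι) (ξ : Space d) :
    ‖hat (g j) ξ‖ ≤ ‖hatVec g ξ‖ := by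
  simpa [hatVec] using PiLp.norm_apply_le (hatVec g ξ) j

lemma stateNorm_le_of_pmNorm_le (hd : 0 < d) {a : Distr d} {u : Fin d → Distr d} {M r : ℝ}
    (hM : 0 ≤ M) (h1 : pmNorm r (scalar a) ≤ ENNReal.ofReal M)
    (h2 : pmNorm (r + 1) (scalar a) ≤ ENNReal.ofReal M) (h3 : pmNorm r u ≤ ENNReal.ofReal M) :
    ∀ᵐ ξ, stateNorm ξ (stateHat a u ξ) ≤ 2 * M * ‖ξ‖ ^ (-r) := by
  filter_upwards [ae_bound_of_weightedSup_le hd hM h1, ae_bound_of_weightedSup_le hd hM h2,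
    ae_bound_of_weightedSup_le hd hM h3, ae_ne_zero hd] with ξ e1 e2 e3 h0
  have h0' : 0 < ‖ξ‖ := norm_pos_iff.2 h0
  replace e1 := (norm_hat_le_norm_hatVec (scalar a) () ξ).trans e1
  replace e2 := (norm_hat_le_norm_hatVec (scalar a) () ξ).trans e2
  rw [neg_add, Real.rpow_add h0', Real.rpow_neg_one, ← mul_assoc, ← div_eq_mul_inv,
      le_div_iff₀ h0'] at e2
  rw [stateNorm_le_iff (by positivity)]
  refine ⟨?_, fun j => ?_⟩
  · change (1 + ‖ξ‖) * ‖hat a ξ‖ ≤ _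
    nlinarith
  · have := (norm_hat_le_norm_hatVec u j ξ).trans e3
    have h5 : 0 ≤ M * ‖ξ‖ ^ (-r) := by positivity
    change ‖hat (u j) ξ‖ ≤ _
    linarith

lemma stateNorm_le_of_dataNorm_le (hd : 0 < d) {a : Distr d} {u : Fin d → Distr d} {M r : ℝ}
    (hM : 0 ≤ M) (h : dataNorm r a u ≤ ENNReal.ofReal M) :
    ∀ᵐ ξ, stateNorm ξ (stateHat a u ξ) ≤ 2 * M * ‖ξ‖ ^ (-r) := by
  filter_upwards [ae_bound_of_weightedSup_le hd hM h] with ξ hξ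
  rw [Real.norm_of_nonneg (Real.sqrt_nonneg _)] at hξ
  have hsq : ∀ {y : ℝ}, y ^ 2 ≤ ‖hat a ξ‖ ^ 2 + (‖ξ‖ * ‖hat a ξ‖) ^ 2 + ‖hatVec u ξ‖ ^ 2 →
      y ≤ M * ‖ξ‖ ^ (-r) := fun hy => (Real.le_sqrt_of_sq_le hy).trans hξ
  rw [stateNorm_le_iff (by positivity)]
  refine ⟨?_, fun j => ?_⟩
  · have e1 : ‖hat a ξ‖ ≤ M * ‖ξ‖ ^ (-r) := hsq (by nlinarith [sq_nonneg (‖ξ‖ * ‖hat a ξ‖)])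
    have e2 : ‖ξ‖ * ‖hat a ξ‖ ≤ M * ‖ξ‖ ^ (-r) := hsq (by nlinarith [sq_nonneg ‖hat a ξ‖])
    change (1 + ‖ξ‖) * ‖hat a ξ‖ ≤ _
    nlinarith
  · have e3 : ‖hatVec u ξ‖ ≤ M * ‖ξ‖ ^ (-r) := hsq (by nlinarith [sq_nonneg (‖ξ‖ * ‖hat a ξ‖)])
    have := (norm_hat_le_norm_hatVec u j ξ).trans e3
    have h5 : 0 ≤ M * ‖ξ‖ ^ (-r) := by positivity
    change ‖hat (u j) ξ‖ ≤ _
    linarith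

lemma stateHat_sub_ae_eq {a b : Distr d} {u v : Fin d → Distr d} (ha : HasFourierFunction a)
    (hb : HasFourierFunction b) (hu : ∀ j, HasFourierFunction (u j))
    (hv : ∀ j, HasFourierFunction (v j)) :
    ∀ᵐ ξ, stateHat (a - b) (u - v) ξ = stateHat a u ξ - stateHat b v ξ := by
  have h2 : ∀ᵐ ξ, ∀ j, hat (u j - v j) ξ = (hat (u j) - hat (v j)) ξ :=
    ae_all_iff.2 fun j => hat_sub_ae_eq (hu j) (hv j)
  filter_upwards [hat_sub_ae_eq ha hb, h2] with ξ h1 h2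
  funext i
  rcases i with i | j
  · simpa [stateHat] using h1
  · simpa [stateHat] using h2 j

lemma aestronglyMeasurable_stateHat {a : Distr d} {u : Fin d → Distr d}
    (ha : HasFourierFunction a) (hu : ∀ j, HasFourierFunction (u j)) :
    AEStronglyMeasurable (stateHat a u) volume := by
  refine (aemeasurable_pi_lambda _ ?_).aestronglyMeasurable
  rintro (i | j)
  · exact (aestronglyMeasurable_hat ha).aemeasurable
  · exact (aestronglyMeasurable_hat (hu j)).aemeasurable

/-! ### Decay of the linear semigroup -/

section
attribute [local instance] Matrix.linftyOpNormedRing Matrix.linftyOpNormedAlgebra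

lemma hasDerivAt_semigroupSymbol_mulVec (μ ν κ α t : ℝ) (ξ : Space d) (x : Unit ⊕ Fin d → ℂ) :
    HasDerivAt (fun s : ℝ => semigroupSymbol μ ν κ α s ξ *ᵥ x)
      (-(linSymbol μ ν κ α ξ *ᵥ (semigroupSymbol μ ν κ α t ξ *ᵥ x))) t := by
  have hs : ∀ s : ℝ, semigroupSymbol μ ν κ α s ξ =
      NormedSpace.exp (s • (-linSymbol μ ν κ α ξ)) := by
    intro s
    rw [semigroupSymbol, neg_smul, smul_neg, Complex.coe_smul]
  have h1 := hasDerivAt_exp_smul_const' (𝕂 := ℝ) (-linSymbol μ ν κ α ξ) t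
  let L : Matrix (Unit ⊕ Fin d) (Unit ⊕ Fin d) ℂ →ₗ[ℝ] (Unit ⊕ Fin d → ℂ) :=
    { toFun := fun M => M *ᵥ x
      map_add' := fun M M' => Matrix.add_mulVec M M' x
      map_smul' := fun c M => Matrix.smul_mulVec c M x }
  have h2 := (LinearMap.toContinuousLinearMap L).hasFDerivAt.comp_hasDerivAt t h1
  simp only [hs]
  refine HasDerivAt.congr_deriv h2 ?_
  change (-linSymbol μ ν κ α ξ * NormedSpace.exp (t • -linSymbol μ ν κ α ξ)) *ᵥ x = _
  rw [← Matrix.mulVec_mulVec, Matrix.neg_mulVec]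

lemma continuous_semigroupSymbol (μ ν κ α : ℝ) :
    Continuous fun q : ℝ × Space d => semigroupSymbol μ ν κ α q.1 q.2 := by
  have hlin : Continuous fun q : ℝ × Space d => linSymbol μ ν κ α q.2 := by
    refine continuous_matrix ?_
    rintro (i | i) (j | j) <;> simp only [linSymbol, Matrix.fromBlocks_apply₁₁,
      Matrix.fromBlocks_apply₁₂, Matrix.fromBlocks_apply₂₁, Matrix.fromBlocks_apply₂₂,
      Matrix.of_apply, Matrix.zero_apply]
    · fun_prop
    · fun_prop
    · fun_prop
    · split_ifs <;> fun_prop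
  have : Continuous (NormedSpace.exp : Matrix (Unit ⊕ Fin d) (Unit ⊕ Fin d) ℂ → _) :=
    NormedSpace.exp_continuous
  exact this.comp ((by fun_prop : Continuous fun q : ℝ × Space d => -(q.1 : ℂ)).smul hlin)

end

lemma semigroupSymbol_zero (μ ν κ α : ℝ) (ξ : Space d) : semigroupSymbol μ ν κ α 0 ξ = 1 := by
  simp [semigroupSymbol]

lemma semigroupSymbol_add_mulVec (μ ν κ α s t : ℝ) (ξ : Space d) (x : Unit ⊕ Fin d → ℂ) :
    semigroupSymbol μ ν κ α (s + t) ξ *ᵥ x =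
      semigroupSymbol μ ν κ α s ξ *ᵥ (semigroupSymbol μ ν κ α t ξ *ᵥ x) := by
  rw [Matrix.mulVec_mulVec]
  congr 1
  rw [semigroupSymbol, semigroupSymbol, semigroupSymbol, ← Matrix.exp_add_of_commute]
  · congr 1
    push_cast
    rw [← add_smul]
    ring_nf
  · exact ((Commute.refl _).smul_left _).smul_right _

/-- The divergence symbol `∑ ξ_k u_k`, without the factor `i`. -/
def divSum (ξ : Space d) (u : Fin d → ℂ) : ℂ := ∑ k, (ξ k : ℂ) * u k

lemma linSymbol_mulVec_inl (μ ν κ α : ℝ) (ξ : Space d) (x : Unit ⊕ Fin d → ℂ) :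
    (linSymbol μ ν κ α ξ *ᵥ x) (Sum.inl ()) =
      Complex.I * divSum ξ (fun k => x (Sum.inr k)) := by
  simp [linSymbol, Matrix.mulVec, dotProduct, divSum, Finset.mul_sum, mul_assoc]

lemma linSymbol_mulVec_inr (μ ν κ α : ℝ) (ξ : Space d) (x : Unit ⊕ Fin d → ℂ) (j : Fin d) :
    (linSymbol μ ν κ α ξ *ᵥ x) (Sum.inr j) =
      Complex.I * ((α + κ * ‖ξ‖ ^ 2 : ℝ) : ℂ) * (ξ j : ℂ) * x (Sum.inl ()) +
        ((μ * ‖ξ‖ ^ 2 : ℝ) : ℂ) * x (Sum.inr j) +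
        ((μ + ν : ℝ) : ℂ) * (ξ j : ℂ) * divSum ξ (fun k => x (Sum.inr k)) := by
  have h : ∀ k, (((if j = k then μ * ‖ξ‖ ^ 2 else 0) + (μ + ν) * ξ j * ξ k : ℝ) : ℂ)
      * x (Sum.inr k) = (if j = k then ((μ * ‖ξ‖ ^ 2 : ℝ) : ℂ) * x (Sum.inr k) else 0) +
        ((μ + ν : ℝ) : ℂ) * (ξ j : ℂ) * ((ξ k : ℂ) * x (Sum.inr k)) := by
    intro k
    split_ifs <;> push_cast <;> ring
  simp only [linSymbol, Matrix.mulVec, dotProduct, Fintype.sum_sum_type, Matrix.fromBlocks_apply₂₁,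
    Matrix.fromBlocks_apply₂₂, Matrix.of_apply, h, Finset.sum_add_distrib, Finset.sum_ite_eq,
    Finset.mem_univ, if_true, ← Finset.mul_sum, divSum, Finset.univ_unique, Finset.sum_singleton]
  push_cast
  ring

lemma sum_sq_space (ξ : Space d) : ∑ k, (ξ k) ^ 2 = ‖ξ‖ ^ 2 := by
  rw [EuclideanSpace.norm_eq, Real.sq_sqrt (Finset.sum_nonneg fun _ _ => by positivity)]
  simp

lemma norm_divSum_sq_le (ξ : Space d) (u : Fin d → ℂ) :
    ‖divSum ξ u‖ ^ 2 ≤ ‖ξ‖ ^ 2 * ∑ j, ‖u j‖ ^ 2 := by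
  have h1 : ‖divSum ξ u‖ ≤ ∑ k, |ξ k| * ‖u k‖ := by
    refine (norm_sum_le _ _).trans (le_of_eq ?_)
    simp
  have h2 := Finset.sum_mul_sq_le_sq_mul_sq Finset.univ (fun k => |ξ k|) (fun k => ‖u k‖)
  simp only [sq_abs, sum_sq_space] at h2
  exact (pow_le_pow_left₀ (norm_nonneg _) h1 2).trans h2

/-- The principal part `|u|² + (α + κ|ξ|²) |a|²` of the energy of a state. -/
def mainEnergy (κ α : ℝ) (ξ : Space d) (x : Unit ⊕ Fin d → ℂ) : ℝ :=
  ∑ j, ‖x (Sum.inr j)‖ ^ 2 + (α + κ * ‖ξ‖ ^ 2) * ‖x (Sum.inl ())‖ ^ 2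

/-- The energy `|u|² + (α + κ|ξ|²) |a|² - 2δ Re (ā · iξ·u)` of a state. The cross term produces
the damping of the density `a`, which the principal part does not see. -/
def energy (δ κ α : ℝ) (ξ : Space d) (x : Unit ⊕ Fin d → ℂ) : ℝ :=
  mainEnergy κ α ξ x -
    2 * δ * inner ℝ (x (Sum.inl ())) (Complex.I * divSum ξ (fun k => x (Sum.inr k)))

/-- The derivative of the energy along the linear flow. -/
lemma hasDerivAt_energy (μ ν κ α δ t : ℝ) (ξ : Space d) (x : Unit ⊕ Fin d → ℂ) :
    let y := semigroupSymbol μ ν κ α t ξ *ᵥ x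
    let w := divSum ξ (fun k => y (Sum.inr k))
    HasDerivAt (fun s : ℝ => energy δ κ α ξ (semigroupSymbol μ ν κ α s ξ *ᵥ x))
      (-2 * μ * ‖ξ‖ ^ 2 * ∑ j, ‖y (Sum.inr j)‖ ^ 2 - 2 * (μ + ν) * ‖w‖ ^ 2 + 2 * δ * ‖w‖ ^ 2
        - 2 * δ * (α + κ * ‖ξ‖ ^ 2) * ‖ξ‖ ^ 2 * ‖y (Sum.inl ())‖ ^ 2
        + 2 * δ * (2 * μ + ν) * ‖ξ‖ ^ 2 * inner ℝ (y (Sum.inl ())) (Complex.I * w)) t := by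
  intro y w
  have hy := hasDerivAt_semigroupSymbol_mulVec μ ν κ α t ξ x
  rw [hasDerivAt_pi] at hy
  have ha : HasDerivAt (fun s : ℝ => (semigroupSymbol μ ν κ α s ξ *ᵥ x) (Sum.inl ()))
      (-(Complex.I * w)) t := by
    have := hy (Sum.inl ())
    rwa [Pi.neg_apply, linSymbol_mulVec_inl] at this
  set A : ℝ := α + κ * ‖ξ‖ ^ 2 with hA
  have hu : ∀ j, HasDerivAt (fun s : ℝ => (semigroupSymbol μ ν κ α s ξ *ᵥ x) (Sum.inr j))
      (-(Complex.I * (A : ℂ) * (ξ j : ℂ) * y (Sum.inl ()) +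
        ((μ * ‖ξ‖ ^ 2 : ℝ) : ℂ) * y (Sum.inr j) + ((μ + ν : ℝ) : ℂ) * (ξ j : ℂ) * w)) t := by
    intro j
    have := hy (Sum.inr j)
    rwa [Pi.neg_apply, linSymbol_mulVec_inr] at this
  have hξ : ∑ k, (ξ k : ℂ) * (ξ k : ℂ) = ((‖ξ‖ ^ 2 : ℝ) : ℂ) := by
    rw [← sum_sq_space]
    push_cast
    simp [sq]
  have hw : HasDerivAt (fun s : ℝ => Complex.I * divSum ξ
      (fun k => (semigroupSymbol μ ν κ α s ξ *ᵥ x) (Sum.inr k)))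
      (((A * ‖ξ‖ ^ 2 : ℝ) : ℂ) * y (Sum.inl ()) -
        (((2 * μ + ν) * ‖ξ‖ ^ 2 : ℝ) : ℂ) * (Complex.I * w)) t := by
    have h1 := (HasDerivAt.fun_sum fun k (_ : k ∈ Finset.univ) =>
      (hu k).const_mul (ξ k : ℂ)).const_mul Complex.I
    refine h1.congr_deriv ?_
    have e : ∀ k, (ξ k : ℂ) * -(Complex.I * (A : ℂ) * (ξ k : ℂ) * y (Sum.inl ()) +
        ((μ * ‖ξ‖ ^ 2 : ℝ) : ℂ) * y (Sum.inr k) + ((μ + ν : ℝ) : ℂ) * (ξ k : ℂ) * w) =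
        -(Complex.I * (A : ℂ) * y (Sum.inl ())) * ((ξ k : ℂ) * (ξ k : ℂ)) +
        -((μ * ‖ξ‖ ^ 2 : ℝ) : ℂ) * ((ξ k : ℂ) * y (Sum.inr k)) +
        -(((μ + ν : ℝ) : ℂ) * w) * ((ξ k : ℂ) * (ξ k : ℂ)) := fun k => by ring
    simp only [e, Finset.sum_add_distrib, ← Finset.mul_sum, hξ]
    change Complex.I * (_ + -((μ * ‖ξ‖ ^ 2 : ℝ) : ℂ) * w + _) = _
    push_cast
    linear_combination (-(A : ℂ) * (‖ξ‖ : ℂ) ^ 2 * y (Sum.inl ())) * Complex.I_sq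
  have hU := HasDerivAt.fun_sum fun j (_ : j ∈ Finset.univ) => (hu j).norm_sq
  have hE := (hU.add (ha.norm_sq.const_mul A)).sub ((ha.inner ℝ hw).const_mul (2 * δ))
  refine hE.congr_deriv ?_
  have key : ∑ j, 2 * inner ℝ (y (Sum.inr j)) (-(Complex.I * (A : ℂ) * (ξ j : ℂ) * y (Sum.inl ()) +
        ((μ * ‖ξ‖ ^ 2 : ℝ) : ℂ) * y (Sum.inr j) + ((μ + ν : ℝ) : ℂ) * (ξ j : ℂ) * w)) =
      -2 * A * inner ℝ w (Complex.I * y (Sum.inl ())) - 2 * (μ * ‖ξ‖ ^ 2) * ∑ j, ‖y (Sum.inr j)‖ ^ 2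
        - 2 * (μ + ν) * ‖w‖ ^ 2 := by
    have e : ∀ j, 2 * inner ℝ (y (Sum.inr j)) (-(Complex.I * (A : ℂ) * (ξ j : ℂ) * y (Sum.inl ()) +
        ((μ * ‖ξ‖ ^ 2 : ℝ) : ℂ) * y (Sum.inr j) + ((μ + ν : ℝ) : ℂ) * (ξ j : ℂ) * w)) =
        -2 * A * inner ℝ ((ξ j : ℂ) * y (Sum.inr j)) (Complex.I * y (Sum.inl ())) +
        -2 * (μ * ‖ξ‖ ^ 2) * ‖y (Sum.inr j)‖ ^ 2 +
        -2 * (μ + ν) * inner ℝ ((ξ j : ℂ) * y (Sum.inr j)) w := by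
      intro j
      simp only [Complex.inner, ← Complex.normSq_eq_norm_sq, Complex.normSq_apply]
      simp [-Complex.ofReal_pow]
      ring
    have hw' : w = ∑ j, (ξ j : ℂ) * y (Sum.inr j) := rfl
    simp only [e, Finset.sum_add_distrib, ← Finset.mul_sum, ← sum_inner, ← hw']
    rw [real_inner_self_eq_norm_sq]
    ring
  rw [key]
  change _ + A * (2 * inner ℝ (y (Sum.inl ())) _) - 2 * δ * (inner ℝ (y (Sum.inl ())) _ + inner ℝ _ (Complex.I * w)) = _
  generalize ∑ j, ‖y (Sum.inr j)‖ ^ 2 = U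
  generalize y (Sum.inl ()) = a
  simp only [Complex.inner, ← Complex.normSq_eq_norm_sq, Complex.normSq_apply]
  simp [-Complex.ofReal_pow]
  ring

lemma mainEnergy_nonneg {κ α : ℝ} (hκ : 0 < κ) (hα : 0 < α) (ξ : Space d)
    (x : Unit ⊕ Fin d → ℂ) : 0 ≤ mainEnergy κ α ξ x := by
  unfold mainEnergy
  positivity

/-- The cross term is controlled by the principal part of the energy, uniformly in `ξ`: the weight
`κ|ξ|²` in front of `|a|²` absorbs the factor `|ξ|`. -/
lemma abs_crossTerm_le {κ : ℝ} (hκ : 0 < κ) (l : ℝ) (hl : 0 ≤ l) (ξ : Space d)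
    (x : Unit ⊕ Fin d → ℂ) :
    2 * l * |inner ℝ (x (Sum.inl ())) (Complex.I * divSum ξ (fun k => x (Sum.inr k)))| ≤
      κ * ‖ξ‖ ^ 2 * ‖x (Sum.inl ())‖ ^ 2 + l ^ 2 / κ * ∑ j, ‖x (Sum.inr j)‖ ^ 2 := by
  set U := ∑ j, ‖x (Sum.inr j)‖ ^ 2 with hU
  have hU0 : 0 ≤ U := Finset.sum_nonneg fun _ _ => by positivity
  have h1 := abs_real_inner_le_norm (x (Sum.inl ()))
    (Complex.I * divSum ξ (fun k => x (Sum.inr k)))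
  rw [norm_mul, Complex.norm_I, one_mul] at h1
  have h2 : ‖divSum ξ (fun k => x (Sum.inr k))‖ ≤ ‖ξ‖ * √U := by
    refine abs_le_of_sq_le_sq' ?_ (by positivity) |>.2
    rw [mul_pow, Real.sq_sqrt hU0]
    exact norm_divSum_sq_le ξ _
  have h3 := h1.trans (mul_le_mul_of_nonneg_left h2 (norm_nonneg (x (Sum.inl ()))))
  calc _ ≤ 2 * l * (‖x (Sum.inl ())‖ * (‖ξ‖ * √U)) := by gcongr
    _ ≤ κ * ‖ξ‖ ^ 2 * ‖x (Sum.inl ())‖ ^ 2 + l ^ 2 / κ * (√U) ^ 2 := by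
      have h4 : 0 ≤ (κ * (‖ξ‖ * ‖x (Sum.inl ())‖) - l * √U) ^ 2 / κ := by positivity
      have h5 : (κ * (‖ξ‖ * ‖x (Sum.inl ())‖) - l * √U) ^ 2 / κ =
          κ * ‖ξ‖ ^ 2 * ‖x (Sum.inl ())‖ ^ 2 + l ^ 2 / κ * (√U) ^ 2 -
            2 * l * (‖x (Sum.inl ())‖ * (‖ξ‖ * √U)) := by
        field_simp
        ring
      linarith
    _ = _ := by rw [Real.sq_sqrt hU0]

lemma exists_energy_decay {μ ν κ α : ℝ} (hμ : 0 < μ) (hμν : 0 < μ + ν) (hκ : 0 < κ) (hα : 0 < α) :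
    ∃ c > 0, ∀ (ξ : Space d) (x : Unit ⊕ Fin d → ℂ) (t : ℝ), 0 ≤ t →
      mainEnergy κ α ξ (semigroupSymbol μ ν κ α t ξ *ᵥ x) ≤
        3 * Real.exp (-(2 * c * t * ‖ξ‖ ^ 2)) * mainEnergy κ α ξ x := by
  -- `δ` is small enough for the energy to be comparable with its principal part and for the
  -- viscosity to absorb the terms produced by differentiating the cross term.
  obtain ⟨δ, hδ0, hδ1, hδ2, hδ3⟩ : ∃ δ > 0, δ ≤ 1 / 2 ∧ δ ≤ κ / 2 ∧
      δ * (2 + (2 * μ + ν) ^ 2 / κ) ≤ μ := by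
    refine ⟨min (1 / 2) (min (κ / 2) (μ / (2 + (2 * μ + ν) ^ 2 / κ))), by positivity,
      min_le_left _ _, (min_le_right _ _).trans (min_le_left _ _), ?_⟩
    rw [← le_div_iff₀ (by positivity)]
    exact (min_le_right _ _).trans (min_le_right _ _)
  set m := min μ δ with hm
  have hm0 : 0 < m := by positivity
  have hcmp : ∀ (ξ : Space d) (x : Unit ⊕ Fin d → ℂ),
      mainEnergy κ α ξ x / 2 ≤ energy δ κ α ξ x ∧
        energy δ κ α ξ x ≤ 3 / 2 * mainEnergy κ α ξ x := by
    intro ξ x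
    have h1 := abs_crossTerm_le hκ 1 zero_le_one ξ x
    have hU : 0 ≤ ∑ j, ‖x (Sum.inr j)‖ ^ 2 := Finset.sum_nonneg fun _ _ => by positivity
    have hA : 0 ≤ α * ‖x (Sum.inl ())‖ ^ 2 := by positivity
    have hB : 0 ≤ κ * ‖ξ‖ ^ 2 * ‖x (Sum.inl ())‖ ^ 2 := by positivity
    have h2 : δ * (κ * ‖ξ‖ ^ 2 * ‖x (Sum.inl ())‖ ^ 2 + 1 ^ 2 / κ * ∑ j, ‖x (Sum.inr j)‖ ^ 2) ≤
        mainEnergy κ α ξ x / 2 := by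
      have e1 : δ * (κ * ‖ξ‖ ^ 2 * ‖x (Sum.inl ())‖ ^ 2) ≤
          1 / 2 * (κ * ‖ξ‖ ^ 2 * ‖x (Sum.inl ())‖ ^ 2) := by gcongr
      have e2 : δ * (1 ^ 2 / κ) ≤ 1 / 2 := by
        rw [one_pow, mul_one_div, div_le_iff₀ hκ]; linarith
      have e3 := mul_le_mul_of_nonneg_right e2 hU
      unfold mainEnergy
      nlinarith
    have h3 := (mul_le_mul_of_nonneg_left h1 hδ0.le).trans h2
    have h4 := neg_abs_le (inner ℝ (x (Sum.inl ())) (Complex.I * divSum ξ (fun k => x (Sum.inr k))))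
    have h5 := le_abs_self (inner ℝ (x (Sum.inl ())) (Complex.I * divSum ξ (fun k => x (Sum.inr k))))
    unfold energy
    constructor <;> nlinarith
  refine ⟨m / 3, by positivity, fun ξ x t ht => ?_⟩
  set E : ℝ → ℝ := fun s => energy δ κ α ξ (semigroupSymbol μ ν κ α s ξ *ᵥ x) with hE
  have hexp : ∀ s : ℝ, HasDerivAt (fun s => Real.exp (2 * (m / 3) * s * ‖ξ‖ ^ 2))
      (Real.exp (2 * (m / 3) * s * ‖ξ‖ ^ 2) * (2 * (m / 3) * ‖ξ‖ ^ 2)) s := by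
    intro s
    have := (((hasDerivAt_id s).const_mul (2 * (m / 3))).mul_const (‖ξ‖ ^ 2)).exp
    simpa using this
  have hanti : Antitone fun s => Real.exp (2 * (m / 3) * s * ‖ξ‖ ^ 2) * E s := by
    refine antitone_of_hasDerivAt_nonpos
      (fun s => (hexp s).mul (hasDerivAt_energy μ ν κ α δ s ξ x)) fun s => ?_
    set y := semigroupSymbol μ ν κ α s ξ *ᵥ x with hy
    have hb := (hcmp ξ y).2
    have h1 := abs_crossTerm_le hκ (|2 * μ + ν|) (abs_nonneg _) ξ y
    have h2 := norm_divSum_sq_le ξ (fun k => y (Sum.inr k))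
    have hEy : E s = energy δ κ α ξ y := rfl
    simp only [hEy]
    unfold mainEnergy at hb
    generalize energy δ κ α ξ y = e at *
    have hW0 : 0 ≤ ‖divSum ξ (fun k => y (Sum.inr k))‖ ^ 2 := by positivity
    generalize ‖divSum ξ (fun k => y (Sum.inr k))‖ ^ 2 = W at *
    have hP := le_abs_self ((2 * μ + ν) *
      inner ℝ (y (Sum.inl ())) (Complex.I * divSum ξ fun k => y (Sum.inr k)))
    rw [abs_mul] at hP
    generalize inner ℝ (y (Sum.inl ())) (Complex.I * divSum ξ fun k => y (Sum.inr k)) = P at *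
    have hU0 : 0 ≤ ∑ j, ‖y (Sum.inr j)‖ ^ 2 := Finset.sum_nonneg fun _ _ => by positivity
    generalize ∑ j, ‖y (Sum.inr j)‖ ^ 2 = U at *
    have hA0 : 0 ≤ ‖y (Sum.inl ())‖ ^ 2 := by positivity
    generalize ‖y (Sum.inl ())‖ ^ 2 = A at *
    have hs0 : 0 ≤ ‖ξ‖ ^ 2 := by positivity
    generalize ‖ξ‖ ^ 2 = r at *
    rw [sq_abs] at h1
    have hmμ : m ≤ μ := min_le_left _ _
    have hmδ : m ≤ δ := min_le_right _ _
    have hα' : 0 ≤ α + κ * r := by positivity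
    -- With `r = |ξ|²`, `U = |u|²`, `A = |a|²`, the derivative of the energy is at most
    -- `-r (μ U + δ (α + κ r) A) ≤ -m r (U + (α + κ r) A)`.
    have k1 : 2 * δ * ((2 * μ + ν) * P) ≤ δ * (κ * r * A + (2 * μ + ν) ^ 2 / κ * U) := by
      nlinarith
    have k2 : -2 * μ * U + 2 * δ * U + δ * (κ * r * A + (2 * μ + ν) ^ 2 / κ * U)
        - 2 * δ * (α + κ * r) * A ≤ -(μ * U + δ * (α + κ * r) * A) := by
      have := mul_le_mul_of_nonneg_right hδ3 hU0
      have : 0 ≤ δ * (α * A) := by positivity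
      nlinarith
    have k3 : m * (U + (α + κ * r) * A) ≤ μ * U + δ * (α + κ * r) * A := by
      have e1 := mul_le_mul_of_nonneg_right hmμ hU0
      have e2 := mul_le_mul_of_nonneg_right hmδ (mul_nonneg hα' hA0)
      nlinarith
    have k4 : 2 * (m / 3) * e ≤ m * (U + (α + κ * r) * A) := by nlinarith
    have k5 : 2 * δ * W ≤ 2 * δ * (r * U) := by gcongr
    have k6 : 0 ≤ 2 * (μ + ν) * W := by positivity
    have k7 : 2 * (m / 3) * r * e + (-2 * μ * r * U - 2 * (μ + ν) * W + 2 * δ * W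
        - 2 * δ * (α + κ * r) * r * A + 2 * δ * (2 * μ + ν) * r * P) ≤ 0 := by
      have := mul_le_mul_of_nonneg_left (k4.trans (k3.trans (by linarith [k2]) :
        _ ≤ -(-2 * μ * U + 2 * δ * U + δ * (κ * r * A + (2 * μ + ν) ^ 2 / κ * U)
        - 2 * δ * (α + κ * r) * A))) hs0
      have := mul_le_mul_of_nonneg_left k1 hs0
      nlinarith
    have := mul_nonpos_of_nonneg_of_nonpos (Real.exp_pos (2 * (m / 3) * s * r)).le k7
    refine le_of_eq_of_le ?_ this
    ring
  have h0 := hanti ht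
  simp only [hE, mul_zero, zero_mul, Real.exp_zero, one_mul, semigroupSymbol_zero,
    Matrix.one_mulVec] at h0
  have h1 := (hcmp ξ (semigroupSymbol μ ν κ α t ξ *ᵥ x)).1
  have h2 := (hcmp ξ x).2
  rw [Real.exp_neg]
  have he := Real.exp_pos (2 * (m / 3) * t * ‖ξ‖ ^ 2)
  rw [mul_assoc, mul_left_comm, ← div_eq_inv_mul, le_div_iff₀ he]
  nlinarith

/-- The linear semigroup decays like the heat semigroup in the weighted norm of states. -/
lemma exists_stateNorm_semigroup_le {μ ν κ α : ℝ} (hμ : 0 < μ) (hμν : 0 < μ + ν) (hκ : 0 < κ)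
    (hα : 0 < α) :
    ∃ c > 0, ∃ C > 0, ∀ (ξ : Space d) (x : Unit ⊕ Fin d → ℂ) (t : ℝ), 0 ≤ t →
      stateNorm ξ (semigroupSymbol μ ν κ α t ξ *ᵥ x) ≤
        C * Real.exp (-(c * t * ‖ξ‖ ^ 2)) * stateNorm ξ x := by
  obtain ⟨c, hc, hdec⟩ := exists_energy_decay (d := d) hμ hμν hκ hα
  set C₁ : ℝ := 1 + 2 / min α κ with hC₁
  set C₂ : ℝ := d + max α κ with hC₂
  have hmin : 0 < min α κ := lt_min hα hκ
  have hC₁0 : 0 < C₁ := by positivity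
  have hC₂0 : 0 < C₂ := by positivity
  have hlow : ∀ (ξ : Space d) (x : Unit ⊕ Fin d → ℂ),
      stateNorm ξ x ≤ √(C₁ * mainEnergy κ α ξ x) := by
    intro ξ x
    have hU : 0 ≤ ∑ j, ‖x (Sum.inr j)‖ ^ 2 := Finset.sum_nonneg fun _ _ => by positivity
    have hA : 0 ≤ (α + κ * ‖ξ‖ ^ 2) * ‖x (Sum.inl ())‖ ^ 2 := by positivity
    have hQ := mainEnergy_nonneg hκ hα ξ x
    have hd2 : 0 ≤ 2 / min α κ := by positivity
    rw [stateNorm_le_iff (Real.sqrt_nonneg _)]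
    refine ⟨Real.le_sqrt_of_sq_le ?_, fun j => Real.le_sqrt_of_sq_le ?_⟩
    · have h1 : (1 + ‖ξ‖) ^ 2 ≤ 2 / min α κ * (α + κ * ‖ξ‖ ^ 2) := by
        rw [div_mul_eq_mul_div, le_div_iff₀ hmin]
        nlinarith [min_le_left α κ, min_le_right α κ, sq_nonneg (1 - ‖ξ‖), sq_nonneg ‖ξ‖,
          mul_le_mul_of_nonneg_right (min_le_right α κ) (sq_nonneg ‖ξ‖),
          mul_nonneg hmin.le (sq_nonneg (1 - ‖ξ‖))]
      have h2 := mul_le_mul_of_nonneg_right h1 (sq_nonneg ‖x (Sum.inl ())‖)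
      unfold mainEnergy at hQ ⊢
      rw [hC₁]
      nlinarith
    · have h1 : ‖x (Sum.inr j)‖ ^ 2 ≤ ∑ j, ‖x (Sum.inr j)‖ ^ 2 :=
        Finset.single_le_sum (f := fun j => ‖x (Sum.inr j)‖ ^ 2) (fun _ _ => by positivity)
          (Finset.mem_univ j)
      rw [hC₁]
      unfold mainEnergy at hQ ⊢
      nlinarith [mul_nonneg hd2 hQ]
  have hup : ∀ (ξ : Space d) (x : Unit ⊕ Fin d → ℂ),
      mainEnergy κ α ξ x ≤ C₂ * stateNorm ξ x ^ 2 := by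
    intro ξ x
    obtain ⟨h1, h2⟩ := (stateNorm_le_iff (stateNorm_nonneg ξ x)).1 le_rfl
    have h3 : ∑ j, ‖x (Sum.inr j)‖ ^ 2 ≤ d * stateNorm ξ x ^ 2 := by
      refine (Finset.sum_le_card_nsmul _ _ (stateNorm ξ x ^ 2) fun j _ => ?_).trans ?_
      · exact pow_le_pow_left₀ (norm_nonneg _) (h2 j) 2
      · simp
    have h4 : ((1 + ‖ξ‖) * ‖x (Sum.inl ())‖) ^ 2 ≤ stateNorm ξ x ^ 2 :=
      pow_le_pow_left₀ (by positivity) h1 2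
    have h5 : α + κ * ‖ξ‖ ^ 2 ≤ max α κ * (1 + ‖ξ‖) ^ 2 := by
      have e1 := le_max_left α κ
      have e2 := mul_le_mul_of_nonneg_right (le_max_right α κ) (sq_nonneg ‖ξ‖)
      have e3 : 0 ≤ max α κ * ‖ξ‖ := by positivity
      nlinarith
    have h6 := mul_le_mul_of_nonneg_right h5 (sq_nonneg ‖x (Sum.inl ())‖)
    have h7 := mul_le_mul_of_nonneg_left h4 (le_max_of_le_left hα.le : 0 ≤ max α κ)
    unfold mainEnergy
    rw [hC₂]
    nlinarith
  refine ⟨c, hc, √(C₁ * (3 * C₂)), by positivity, fun ξ x t ht => ?_⟩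
  refine (hlow ξ _).trans (Real.sqrt_le_iff.2 ⟨by have := stateNorm_nonneg ξ x; positivity, ?_⟩)
  have hsq : (√(C₁ * (3 * C₂)) * Real.exp (-(c * t * ‖ξ‖ ^ 2)) * stateNorm ξ x) ^ 2 =
      C₁ * (3 * Real.exp (-(2 * c * t * ‖ξ‖ ^ 2)) * (C₂ * stateNorm ξ x ^ 2)) := by
    rw [mul_pow, mul_pow, Real.sq_sqrt (by positivity), ← Real.exp_nat_mul]
    have : ((2 : ℕ) : ℝ) * -(c * t * ‖ξ‖ ^ 2) = -(2 * c * t * ‖ξ‖ ^ 2) := by push_cast; ring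
    rw [this]
    ring
  rw [hsq]
  refine mul_le_mul_of_nonneg_left ((hdec ξ x t ht).trans ?_) hC₁0.le
  exact mul_le_mul_of_nonneg_left (hup ξ x) (by positivity)

lemma exp_neg_le_rpow_neg {β : ℝ} (hβ : 0 ≤ β) :
    ∃ K > 0, ∀ y : ℝ, 0 < y → Real.exp (-y) ≤ K * y ^ (-β) := by
  rcases hβ.eq_or_lt with rfl | hβ
  · refine ⟨1, one_pos, fun y hy => ?_⟩
    simp [hy.le]
  · refine ⟨β ^ β, by positivity, fun y hy => ?_⟩
    have h1 : (y / β) ^ β ≤ Real.exp y := by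
      have h2 : y / β ≤ Real.exp (y / β) := by linarith [Real.add_one_le_exp (y / β)]
      calc (y / β) ^ β ≤ Real.exp (y / β) ^ β := Real.rpow_le_rpow (by positivity) h2 hβ.le
        _ = Real.exp y := by rw [← Real.exp_mul, div_mul_cancel₀ _ hβ.ne']
    rw [Real.div_rpow hy.le hβ.le, div_le_iff₀ (by positivity)] at h1
    rw [Real.exp_neg, Real.rpow_neg hy.le, ← div_eq_mul_inv, inv_le_iff_one_le_mul₀ (by positivity),
      div_mul_eq_mul_div, one_le_div (by positivity), mul_comm]
    exact h1

lemma exists_stateNorm_semigroup_le_rpow {μ ν κ α β : ℝ} (hμ : 0 < μ) (hμν : 0 < μ + ν)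
    (hκ : 0 < κ) (hα : 0 < α) (hβ : 0 ≤ β) :
    ∃ C > 0, ∀ (ξ : Space d) (x : Unit ⊕ Fin d → ℂ) (t : ℝ), 0 < t → ξ ≠ 0 →
      stateNorm ξ (semigroupSymbol μ ν κ α t ξ *ᵥ x) ≤
        C * (t ^ (-β) * ‖ξ‖ ^ (-(2 * β))) * stateNorm ξ x := by
  obtain ⟨c, hc, C, hC, h⟩ := exists_stateNorm_semigroup_le (d := d) hμ hμν hκ hα
  obtain ⟨K, hK, hexp⟩ := exp_neg_le_rpow_neg hβ
  refine ⟨C * (K * c ^ (-β)), by positivity, fun ξ x t ht hξ => (h ξ x t ht.le).trans ?_⟩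
  have hξ' : 0 < ‖ξ‖ := norm_pos_iff.2 hξ
  refine mul_le_mul_of_nonneg_right ?_ (stateNorm_nonneg _ _)
  rw [mul_assoc C]
  refine mul_le_mul_of_nonneg_left ((hexp (c * t * ‖ξ‖ ^ 2) (by positivity)).trans (le_of_eq ?_))
    hC.le
  rw [Real.mul_rpow (by positivity) (by positivity), Real.mul_rpow hc.le ht.le,
    ← Real.rpow_natCast ‖ξ‖ 2, ← Real.rpow_mul hξ'.le]
  push_cast
  ring_nf

lemma norm_divSum_le (ξ : Space d) (u : Fin d → ℂ) {M : ℝ} (hu : ∀ j, ‖u j‖ ≤ M) :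
    ‖divSum ξ u‖ ≤ d * (‖ξ‖ * M) := by
  refine (norm_sum_le _ _).trans ((Finset.sum_le_card_nsmul _ _ (‖ξ‖ * M) fun k _ => ?_).trans ?_)
  · rw [norm_mul, Complex.norm_real]
    exact mul_le_mul (PiLp.norm_apply_le ξ k) (hu k) (norm_nonneg _) (norm_nonneg _)
  · simp

lemma exists_stateNorm_linSymbol_le {μ ν κ α : ℝ} (hμ : 0 < μ) (hμν : 0 < μ + ν) (hκ : 0 < κ)
    (hα : 0 < α) :
    ∃ K > 0, ∀ (ξ : Space d) (x : Unit ⊕ Fin d → ℂ),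
      stateNorm ξ (linSymbol μ ν κ α ξ *ᵥ x) ≤ K * (‖ξ‖ + ‖ξ‖ ^ 2) * stateNorm ξ x := by
  refine ⟨d + (α + κ) + μ + (μ + ν) * d, by positivity, fun ξ x => ?_⟩
  have hN := stateNorm_nonneg ξ x
  obtain ⟨h1, h2⟩ := (stateNorm_le_iff hN).1 le_rfl
  have hw := norm_divSum_le ξ (fun k => x (Sum.inr k)) h2
  set n := stateNorm ξ x
  set r := ‖ξ‖ with hr
  have hr0 : 0 ≤ r := norm_nonneg ξ
  have p1 : 0 ≤ (r + r ^ 2) * n := by positivity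
  have p2 : 0 ≤ (α + κ) * ((r + r ^ 2) * n) := by positivity
  have p3 : 0 ≤ μ * ((r + r ^ 2) * n) := by positivity
  have p4 : 0 ≤ (μ + ν) * d * ((r + r ^ 2) * n) := by positivity
  have p5 : 0 ≤ d * ((r + r ^ 2) * n) := by positivity
  have p6 : 0 ≤ r * n := by positivity
  rw [stateNorm_le_iff (by positivity), linSymbol_mulVec_inl]
  refine ⟨?_, fun j => ?_⟩
  · rw [norm_mul, Complex.norm_I, one_mul]
    calc (1 + r) * ‖divSum ξ fun k => x (Sum.inr k)‖ ≤ (1 + r) * (d * (r * n)) := by gcongr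
      _ = d * ((r + r ^ 2) * n) := by ring
      _ ≤ _ := by linarith
  · rw [linSymbol_mulVec_inr]
    have hj : ‖(ξ j : ℂ)‖ ≤ r := by
      rw [Complex.norm_real]; exact PiLp.norm_apply_le ξ j
    refine (norm_add₃_le).trans ?_
    simp only [norm_mul, Complex.norm_I, one_mul, Complex.norm_real]
    rw [Real.norm_of_nonneg (by positivity : 0 ≤ α + κ * r ^ 2),
      Real.norm_of_nonneg hμ.le, Real.norm_of_nonneg (sq_nonneg ‖ξ‖),
      Real.norm_of_nonneg hμν.le, ← hr]
    rw [Complex.norm_real] at hj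
    have e1 : (α + κ * r ^ 2) * ‖ξ j‖ * ‖x (Sum.inl ())‖ ≤ (α + κ) * ((r + r ^ 2) * n) := by
      have q1 : α + κ * r ^ 2 ≤ (α + κ) * (1 + r) ^ 2 := by
        nlinarith [mul_nonneg hα.le hr0, mul_nonneg hκ.le hr0, mul_nonneg hα.le (sq_nonneg r)]
      calc (α + κ * r ^ 2) * ‖ξ j‖ * ‖x (Sum.inl ())‖
          ≤ (α + κ) * (1 + r) ^ 2 * r * ‖x (Sum.inl ())‖ := by gcongr
        _ = (α + κ) * ((r + r ^ 2) * ((1 + r) * ‖x (Sum.inl ())‖)) := by ring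
        _ ≤ _ := by gcongr
    have e2 : μ * r ^ 2 * ‖x (Sum.inr j)‖ ≤ μ * ((r + r ^ 2) * n) := by
      have q := h2 j
      calc μ * r ^ 2 * ‖x (Sum.inr j)‖ ≤ μ * r ^ 2 * n := by gcongr
        _ ≤ _ := by nlinarith [mul_nonneg hμ.le p6]
    have e3 : (μ + ν) * ‖ξ j‖ * ‖divSum ξ fun k => x (Sum.inr k)‖ ≤
        (μ + ν) * d * ((r + r ^ 2) * n) := by
      calc _ ≤ (μ + ν) * r * (d * (r * n)) := by gcongr
        _ ≤ _ := by nlinarith [mul_nonneg (mul_nonneg hμν.le (Nat.cast_nonneg d : (0:ℝ) ≤ d)) p6]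
    linarith

/-- Hölder continuity in time of the linear semigroup: `ε` powers of the time increment cost
`|ξ|^ε + |ξ|^{2ε}`, which is then paid for by the parabolic decay. -/
lemma exists_stateNorm_semigroup_sub_le {μ ν κ α β ε : ℝ} (hμ : 0 < μ) (hμν : 0 < μ + ν)
    (hκ : 0 < κ) (hα : 0 < α) (hβ : 0 ≤ β) (hε : 0 < ε) (hε1 : ε ≤ 1) :
    ∃ C > 0, ∀ (ξ : Space d) (x : Unit ⊕ Fin d → ℂ) (t h : ℝ), 0 < t → 0 ≤ h → ξ ≠ 0 →
      stateNorm ξ (semigroupSymbol μ ν κ α (t + h) ξ *ᵥ x - semigroupSymbol μ ν κ α t ξ *ᵥ x) ≤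
        C * h ^ ε * ((t ^ (-(β + ε)) + t ^ (-(β + ε / 2))) * ‖ξ‖ ^ (-(2 * β))) *
          stateNorm ξ x := by
  obtain ⟨C₀, hC₀, hS₀⟩ := exists_stateNorm_semigroup_le_rpow (d := d) hμ hμν hκ hα le_rfl
  obtain ⟨C₁, hC₁, hS₁⟩ := exists_stateNorm_semigroup_le_rpow (d := d) hμ hμν hκ hα
    (by positivity : 0 ≤ β + ε / 2)
  obtain ⟨C₂, hC₂, hS₂⟩ := exists_stateNorm_semigroup_le_rpow (d := d) hμ hμν hκ hα
    (by positivity : 0 ≤ β + ε)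
  obtain ⟨K, hK, hA⟩ := exists_stateNorm_linSymbol_le (d := d) hμ hμν hκ hα
  have hS : ∀ (ξ : Space d) (x : Unit ⊕ Fin d → ℂ) (t : ℝ), 0 ≤ t → ξ ≠ 0 →
      stateNorm ξ (semigroupSymbol μ ν κ α t ξ *ᵥ x) ≤ (C₀ + 1) * stateNorm ξ x := by
    intro ξ x t ht hξ
    have hN := stateNorm_nonneg ξ x
    rcases ht.eq_or_lt with rfl | ht
    · rw [semigroupSymbol_zero, Matrix.one_mulVec]
      nlinarith
    · have := hS₀ ξ x t ht hξ
      simp only [neg_zero, mul_zero, Real.rpow_zero, mul_one] at this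
      linarith
  set L := (C₀ + 2) * (K + 1) with hL
  have hL0 : 0 < L := by positivity
  refine ⟨L * (C₁ + C₂), by positivity, fun ξ x t h ht hh hξ => ?_⟩
  have hr : 0 < ‖ξ‖ := norm_pos_iff.2 hξ
  set y := semigroupSymbol μ ν κ α t ξ *ᵥ x with hy
  have hNy := stateNorm_nonneg ξ y
  have hNx := stateNorm_nonneg ξ x
  rw [add_comm t h, semigroupSymbol_add_mulVec, ← hy]
  set q := h * (‖ξ‖ + ‖ξ‖ ^ 2) with hq
  have hq0 : 0 ≤ q := by positivity
  have i1 : stateNorm ξ (semigroupSymbol μ ν κ α h ξ *ᵥ y - y) ≤ L * stateNorm ξ y := by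
    refine (stateNorm_sub_le _ _ _).trans ?_
    have := hS ξ y h hh hξ
    have : C₀ + 2 ≤ L := by rw [hL]; nlinarith
    nlinarith
  have i2 : stateNorm ξ (semigroupSymbol μ ν κ α h ξ *ᵥ y - y) ≤ L * q * stateNorm ξ y := by
    have hder : ∀ s : ℝ, HasDerivAt (fun s => stateScale ξ (semigroupSymbol μ ν κ α s ξ *ᵥ y))
        (stateScale ξ (-(linSymbol μ ν κ α ξ *ᵥ (semigroupSymbol μ ν κ α s ξ *ᵥ y)))) s := by
      intro s
      have h1 := hasDerivAt_semigroupSymbol_mulVec μ ν κ α s ξ y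
      exact ((stateScale ξ).restrictScalars ℝ).hasFDerivAt.comp_hasDerivAt s h1
    have := norm_image_sub_le_of_norm_deriv_le_segment' (a := 0) (b := h)
      (C := K * (‖ξ‖ + ‖ξ‖ ^ 2) * ((C₀ + 1) * stateNorm ξ y))
      (fun s _ => (hder s).hasDerivWithinAt) (fun s hs => ?_) h ⟨hh, le_rfl⟩
    · rw [semigroupSymbol_zero, Matrix.one_mulVec, ← map_sub] at this
      refine this.trans ?_
      have e : K * (C₀ + 1) ≤ L := by rw [hL]; nlinarith
      calc _ = K * (C₀ + 1) * (q * stateNorm ξ y) := by rw [hq]; ring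
        _ ≤ L * (q * stateNorm ξ y) := by gcongr
        _ = _ := by ring
    · rw [map_neg, norm_neg]
      refine (hA ξ _).trans ?_
      have := hS ξ y s hs.1 hξ
      gcongr
  have i3 : stateNorm ξ (semigroupSymbol μ ν κ α h ξ *ᵥ y - y) ≤ L * q ^ ε * stateNorm ξ y := by
    rcases le_total q 1 with h1 | h1
    · refine i2.trans ?_
      rcases hq0.eq_or_lt with h0 | h0
      · rw [← h0, Real.zero_rpow hε.ne']
      · have : q ≤ q ^ ε := by
          simpa using Real.rpow_le_rpow_of_exponent_ge h0 h1 hε1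
        gcongr
    · refine i1.trans ?_
      have : 1 ≤ q ^ ε := Real.one_le_rpow h1 hε.le
      have : L * 1 ≤ L * q ^ ε := by gcongr
      nlinarith
  have i4 : q ^ ε ≤ h ^ ε * (‖ξ‖ ^ ε + ‖ξ‖ ^ (2 * ε)) := by
    rw [hq, Real.mul_rpow hh (by positivity)]
    have e := Real.rpow_add_le_add_rpow hr.le (sq_nonneg ‖ξ‖) hε.le hε1
    rw [← Real.rpow_natCast ‖ξ‖ 2, ← Real.rpow_mul hr.le] at e
    push_cast at e
    gcongr
    simpa using e
  have j1 : ‖ξ‖ ^ ε * stateNorm ξ y ≤ C₁ * (t ^ (-(β + ε / 2)) * ‖ξ‖ ^ (-(2 * β))) *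
      stateNorm ξ x := by
    have e := mul_le_mul_of_nonneg_left (hS₁ ξ x t ht hξ) (by positivity : 0 ≤ ‖ξ‖ ^ ε)
    refine e.trans (le_of_eq ?_)
    have : ‖ξ‖ ^ (-(2 * β)) = ‖ξ‖ ^ ε * ‖ξ‖ ^ (-(2 * (β + ε / 2))) := by
      rw [← Real.rpow_add hr]; ring_nf
    rw [this]; ring
  have j2 : ‖ξ‖ ^ (2 * ε) * stateNorm ξ y ≤ C₂ * (t ^ (-(β + ε)) * ‖ξ‖ ^ (-(2 * β))) *
      stateNorm ξ x := by
    have e := mul_le_mul_of_nonneg_left (hS₂ ξ x t ht hξ) (by positivity : 0 ≤ ‖ξ‖ ^ (2 * ε))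
    refine e.trans (le_of_eq ?_)
    have : ‖ξ‖ ^ (-(2 * β)) = ‖ξ‖ ^ (2 * ε) * ‖ξ‖ ^ (-(2 * (β + ε))) := by
      rw [← Real.rpow_add hr]; ring_nf
    rw [this]; ring
  have hhε : 0 ≤ h ^ ε := Real.rpow_nonneg hh ε
  calc _ ≤ L * q ^ ε * stateNorm ξ y := i3
    _ ≤ L * (h ^ ε * (‖ξ‖ ^ ε + ‖ξ‖ ^ (2 * ε))) * stateNorm ξ y := by gcongr
    _ = L * h ^ ε * (‖ξ‖ ^ ε * stateNorm ξ y + ‖ξ‖ ^ (2 * ε) * stateNorm ξ y) := by ring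
    _ ≤ L * h ^ ε * (C₁ * (t ^ (-(β + ε / 2)) * ‖ξ‖ ^ (-(2 * β))) * stateNorm ξ x +
          C₂ * (t ^ (-(β + ε)) * ‖ξ‖ ^ (-(2 * β))) * stateNorm ξ x) := by gcongr
    _ ≤ L * h ^ ε * ((C₁ + C₂) * (t ^ (-(β + ε / 2)) * ‖ξ‖ ^ (-(2 * β))) * stateNorm ξ x +
          (C₁ + C₂) * (t ^ (-(β + ε)) * ‖ξ‖ ^ (-(2 * β))) * stateNorm ξ x) := by
        gcongr <;> linarith
    _ = _ := by ring

/-! ### Convolutions of homogeneous weights -/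

/-- The majorant `|η|^{-α} max(|η|, ρ)^{-β}` of `|η|^{-α} |ξ - η|^{-β}` on the half space
`|η| ≤ |ξ - η|`, when `ρ = |ξ|/2`. -/
def halfKernel (α β ρ : ℝ) (η : Space d) : ℝ := ‖η‖ ^ (-α) * (max ‖η‖ ρ) ^ (-β)

lemma halfKernel_nonneg (α β : ℝ) {ρ : ℝ} (η : Space d) :
    0 ≤ halfKernel α β ρ η :=
  mul_nonneg (Real.rpow_nonneg (norm_nonneg _) _)
    (Real.rpow_nonneg ((norm_nonneg η).trans (le_max_left _ _)) _)

lemma integrable_halfKernel_half (hd : 0 < d) {α β : ℝ} (hα : α < d) (hβ : 0 ≤ β)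
    (hαβ : d < α + β) : Integrable (halfKernel α β (1 / 2) : Space d → ℝ) volume := by
  have := nontrivial_space hd
  have hcd : (((d - 1 : ℕ) : ℝ)) = (d : ℝ) - 1 := by
    rw [Nat.cast_sub hd, Nat.cast_one]
  refine (integrable_fun_norm_addHaar (E := Space d) (μ := volume)
    (f := fun y : ℝ => y ^ (-α) * (max y (1 / 2)) ^ (-β))).2 ?_
  simp only [finrank_euclideanSpace, Fintype.card_fin, smul_eq_mul]
  rw [← Set.Ioc_union_Ioi_eq_Ioi (zero_le_one : (0 : ℝ) ≤ 1)]
  refine IntegrableOn.union ?_ ?_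
  · have h1 : IntegrableOn (fun y : ℝ => (1 / 2 : ℝ) ^ (-β) * y ^ ((d : ℝ) - 1 - α))
        (Set.Ioc 0 1) volume :=
      (intervalIntegral.intervalIntegrable_rpow' (a := 0) (b := 1) (by linarith)).1.const_mul _
    refine h1.mono' (by fun_prop) ?_
    refine (ae_restrict_iff' measurableSet_Ioc).2 (Eventually.of_forall fun y hy => ?_)
    have hy0 : 0 < y := hy.1
    rw [Real.norm_of_nonneg (by positivity), ← Real.rpow_natCast, hcd, ← mul_assoc,
      ← Real.rpow_add hy0, mul_comm]
    have : (max y (1 / 2)) ^ (-β) ≤ (1 / 2 : ℝ) ^ (-β) :=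
      Real.rpow_le_rpow_of_nonpos (by norm_num) (le_max_right _ _) (by linarith)
    rw [← sub_eq_add_neg]
    gcongr
  · have h1 : IntegrableOn (fun y : ℝ => y ^ ((d : ℝ) - 1 - α - β)) (Set.Ioi 1) volume :=
      integrableOn_Ioi_rpow_of_lt (by linarith) one_pos
    refine h1.congr_fun (fun y hy => ?_) measurableSet_Ioi
    have hy1 : (1 : ℝ) < y := hy
    have hy0 : 0 < y := by linarith
    simp only
    rw [max_eq_left (by linarith), ← Real.rpow_natCast, hcd, ← mul_assoc, ← Real.rpow_add hy0,
      ← Real.rpow_add hy0]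
    congr 1

lemma halfKernel_smul {α β ρ : ℝ} (hρ : 0 < ρ) (η : Space d) :
    halfKernel α β (ρ / 2) (ρ • η) = ρ ^ (-α - β) * halfKernel α β (1 / 2) η := by
  have h1 : max (ρ * ‖η‖) (ρ / 2) = ρ * max ‖η‖ (1 / 2) := by
    rw [mul_max_of_nonneg _ _ hρ.le, mul_one_div]
  rw [halfKernel, halfKernel, norm_smul, Real.norm_of_nonneg hρ.le, h1,
    Real.mul_rpow hρ.le (norm_nonneg _), Real.mul_rpow hρ.le (by positivity), sub_eq_add_neg,
    Real.rpow_add hρ]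
  ring

lemma integrable_halfKernel (hd : 0 < d) {α β ρ : ℝ} (hα : α < d) (hβ : 0 ≤ β)
    (hαβ : d < α + β) (hρ : 0 < ρ) :
    Integrable (halfKernel α β (ρ / 2) : Space d → ℝ) volume := by
  rw [← integrable_comp_smul_iff volume _ hρ.ne']
  simp only [halfKernel_smul hρ]
  exact (integrable_halfKernel_half hd hα hβ hαβ).const_mul _

lemma integral_halfKernel {α β ρ : ℝ} (hρ : 0 < ρ) :
    ∫ η : Space d, halfKernel α β (ρ / 2) η =
      ρ ^ ((d : ℝ) - α - β) * ∫ η : Space d, halfKernel α β (1 / 2) η := by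
  have h := Measure.integral_comp_smul_of_nonneg (volume : Measure (Space d))
    (halfKernel α β (ρ / 2)) ρ (hR := hρ.le)
  simp only [halfKernel_smul hρ, finrank_euclideanSpace, Fintype.card_fin, smul_eq_mul,
    integral_const_mul] at h
  have hd0 : (ρ ^ d : ℝ) ≠ 0 := by positivity
  rw [eq_inv_mul_iff_mul_eq₀ hd0, ← mul_assoc, ← Real.rpow_natCast, ← Real.rpow_add hρ] at h
  rw [← h]
  congr 2
  ring

/-- Of the two factors, the one whose argument is longer is comparable with `max(|η|, |ξ|/2)`,
respectively `max(|ξ - η|, |ξ|/2)`. -/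
lemma rpow_mul_rpow_le_halfKernel {α β : ℝ} (hα : 0 ≤ α) (hβ : 0 ≤ β) {ξ : Space d} (hξ : ξ ≠ 0)
    (η : Space d) : ‖η‖ ^ (-α) * ‖ξ - η‖ ^ (-β) ≤
      halfKernel α β (‖ξ‖ / 2) η + halfKernel β α (‖ξ‖ / 2) (ξ - η) := by
  have hr : 0 < ‖ξ‖ := norm_pos_iff.2 hξ
  have htri : ‖ξ‖ ≤ ‖η‖ + ‖ξ - η‖ := by simpa using norm_add_le η (ξ - η)
  rcases le_total ‖η‖ ‖ξ - η‖ with h | h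
  · refine le_add_of_le_of_nonneg ?_ (halfKernel_nonneg _ _ _)
    refine mul_le_mul_of_nonneg_left ?_ (by positivity)
    exact Real.rpow_le_rpow_of_nonpos (by positivity) (max_le h (by linarith)) (by linarith)
  · refine le_add_of_nonneg_of_le (halfKernel_nonneg _ _ _) ?_
    rw [mul_comm, halfKernel]
    refine mul_le_mul_of_nonneg_left ?_ (by positivity)
    exact Real.rpow_le_rpow_of_nonpos (by positivity) (max_le h (by linarith)) (by linarith)

/-- `h` and `h'` are bounded by `M |ξ|⁻ʳ`, and their difference is bounded by `D |ξ|⁻ʳ`. -/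
structure DecayPair (M D r : ℝ) (h h' : Space d → ℂ) : Prop where
  meas : AEStronglyMeasurable h volume
  meas' : AEStronglyMeasurable h' volume
  bound : ∀ᵐ η, ‖h η‖ ≤ M * ‖η‖ ^ (-r)
  bound' : ∀ᵐ η, ‖h' η‖ ≤ M * ‖η‖ ^ (-r)
  diff : ∀ᵐ η, ‖h η - h' η‖ ≤ D * ‖η‖ ^ (-r)

lemma ae_sub_left {P : Space d → Prop} (h : ∀ᵐ η, P η) (ξ : Space d) : ∀ᵐ η, P (ξ - η) :=
  (Measure.measurePreserving_sub_left volume ξ).quasiMeasurePreserving.ae h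

lemma convolutionExistsAt_of_decayPair (hd : 0 < d) {α β : ℝ} (hα0 : 0 ≤ α) (hα : α < d)
    (hβ0 : 0 ≤ β) (hβ : β < d) (hαβ : d < α + β) {M D M' D' : ℝ} {h h' k k' : Space d → ℂ}
    (H : DecayPair M D α h h') (K : DecayPair M' D' β k k') (hM : 0 ≤ M) (hM' : 0 ≤ M')
    {ξ : Space d} (hξ : ξ ≠ 0) :
    ConvolutionExistsAt h k ξ (ContinuousLinearMap.mul ℂ ℂ) volume := by
  have hr : 0 < ‖ξ‖ := norm_pos_iff.2 hξ
  have hkm : AEStronglyMeasurable (fun η => k (ξ - η)) volume :=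
    K.meas.comp_quasiMeasurePreserving (Measure.measurePreserving_sub_left volume ξ).quasiMeasurePreserving
  have hG := ((integrable_halfKernel hd hα hβ0 hαβ hr).add
    ((integrable_halfKernel hd hβ hα0 (by linarith) hr).comp_sub_left ξ)).const_mul (M * M')
  refine hG.mono' (H.meas.mul hkm) ?_
  filter_upwards [H.bound, ae_sub_left K.bound ξ] with η h1 h2
  rw [ContinuousLinearMap.mul_apply', norm_mul]
  calc ‖h η‖ * ‖k (ξ - η)‖ ≤ (M * ‖η‖ ^ (-α)) * (M' * ‖ξ - η‖ ^ (-β)) := by gcongr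
    _ = M * M' * (‖η‖ ^ (-α) * ‖ξ - η‖ ^ (-β)) := by ring
    _ ≤ _ := by
      have := rpow_mul_rpow_le_halfKernel hα0 hβ0 hξ η
      simp only [Pi.add_apply]
      gcongr

/-- The product of a function `O(|ξ|^{-α})` with a function `O(|ξ|^{-β})` is `O(|ξ|^{d-α-β})` on
the Fourier side, with a Lipschitz bound. The estimate holds at every frequency `ξ ≠ 0`, although
the assumptions hold almost everywhere only. -/
lemma exists_prodHat_sub_le (hd : 0 < d) {α β : ℝ} (hα0 : 0 ≤ α) (hα : α < d)
    (hβ0 : 0 ≤ β) (hβ : β < d) (hαβ : d < α + β) :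
    ∃ C > 0, ∀ (M D : ℝ) (h h' k k' : Space d → ℂ), 0 ≤ M → 0 ≤ D → DecayPair M D α h h' →
      DecayPair M D β k k' → ∀ ξ : Space d, ξ ≠ 0 →
        ‖prodHat h k ξ - prodHat h' k' ξ‖ ≤ C * (M * D) * ‖ξ‖ ^ ((d : ℝ) - α - β) := by
  set J : ℝ := (∫ η : Space d, halfKernel α β (1 / 2) η) + ∫ η : Space d, halfKernel β α (1 / 2) η
    with hJ
  have hJ0 : 0 ≤ J := add_nonneg (integral_nonneg fun _ => halfKernel_nonneg _ _ _)
    (integral_nonneg fun _ => halfKernel_nonneg _ _ _)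
  refine ⟨(2 * Real.pi)⁻¹ ^ d * (2 * (J + 1)), by positivity,
    fun M D h h' k k' hM hD H K ξ hξ => ?_⟩
  have hr : 0 < ‖ξ‖ := norm_pos_iff.2 hξ
  have swap : ∀ {M D r : ℝ} {h h' : Space d → ℂ}, DecayPair M D r h h' → DecayPair M D r h' h :=
    fun H => ⟨H.meas', H.meas, H.bound', H.bound, by simpa only [norm_sub_rev] using H.diff⟩
  have e1 := convolutionExistsAt_of_decayPair hd hα0 hα hβ0 hβ hαβ H K hM hM hξ
  have e2 := convolutionExistsAt_of_decayPair hd hα0 hα hβ0 hβ hαβ (swap H) (swap K) hM hM hξ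
  rw [prodHat, prodHat, ← mul_sub, norm_mul, norm_pow, norm_inv, Complex.norm_real,
    Real.norm_of_nonneg (by positivity), mul_assoc, mul_assoc]
  refine mul_le_mul_of_nonneg_left ?_ (by positivity)
  rw [convolution, convolution, ← integral_sub e1 e2]
  have g1 := integrable_halfKernel (d := d) hd hα hβ0 hαβ hr
  have g2 := (integrable_halfKernel (d := d) hd hβ hα0 (by linarith) hr).comp_sub_left ξ
  refine (norm_integral_le_of_norm_le ((g1.add g2).const_mul (2 * (M * D))) ?_).trans ?_
  · filter_upwards [H.bound', H.diff, ae_sub_left K.bound ξ, ae_sub_left K.diff ξ]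
      with η h1 h2 h3 h4
    simp only [ContinuousLinearMap.mul_apply']
    have : h η * k (ξ - η) - h' η * k' (ξ - η) =
        (h η - h' η) * k (ξ - η) + h' η * (k (ξ - η) - k' (ξ - η)) := by ring
    rw [this]
    refine (norm_add_le _ _).trans ?_
    rw [norm_mul, norm_mul]
    calc _ ≤ (D * ‖η‖ ^ (-α)) * (M * ‖ξ - η‖ ^ (-β)) +
          (M * ‖η‖ ^ (-α)) * (D * ‖ξ - η‖ ^ (-β)) := by gcongr
      _ = 2 * (M * D) * (‖η‖ ^ (-α) * ‖ξ - η‖ ^ (-β)) := by ring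
      _ ≤ _ := by
        have := rpow_mul_rpow_le_halfKernel hα0 hβ0 hξ η
        simp only [Pi.add_apply]
        gcongr
  · rw [integral_const_mul]
    have : ∫ η, ((halfKernel α β (‖ξ‖ / 2) + fun η => halfKernel β α (‖ξ‖ / 2) (ξ - η)) :
        Space d → ℝ) η = ‖ξ‖ ^ ((d : ℝ) - α - β) * J := by
      simp only [Pi.add_apply]
      rw [integral_add g1 g2, integral_sub_left_eq_self (halfKernel β α (‖ξ‖ / 2)) volume ξ,
        integral_halfKernel hr, integral_halfKernel hr, hJ, mul_add]
      congr 3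
      ring
    rw [this]
    have hp : 0 ≤ ‖ξ‖ ^ ((d : ℝ) - α - β) := by positivity
    have hMD : 0 ≤ M * D := by positivity
    nlinarith [mul_nonneg hMD hp]

/-! ### The nonlinear terms -/

/-- The Fourier transform of the nonlinear term `(f, g₁ + g₂ + g₃)`, as a function of the Fourier
transform `x` of the state. -/
def nonlinState (μ ν κ : ℝ) (x : Space d → Unit ⊕ Fin d → ℂ) (ξ : Space d) : Unit ⊕ Fin d → ℂ :=
  Sum.elim (fun _ => fHat (fun k η => x η (Sum.inr k)) (fun η => x η (Sum.inl ())) ξ)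
    (fun j => g₁Hat (fun k η => x η (Sum.inr k)) j ξ +
      g₂Hat μ ν (fun k η => x η (Sum.inr k)) (fun η => x η (Sum.inl ())) j ξ +
      g₃Hat κ (fun η => x η (Sum.inl ())) j ξ)

lemma nonlinHat_eq (μ ν κ : ℝ) (a : Distr d) (u : Fin d → Distr d) :
    nonlinHat μ ν κ a u = nonlinState μ ν κ (stateHat a u) := rfl

/-- The states `x` and `y` are bounded by `M |ξ|⁻ʳ` in the weighted norm, and their difference is
bounded by `D |ξ|⁻ʳ`. -/
structure StatePair (M D r : ℝ) (x y : Space d → Unit ⊕ Fin d → ℂ) : Prop where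
  meas : AEStronglyMeasurable x volume
  meas' : AEStronglyMeasurable y volume
  bound : ∀ᵐ η, stateNorm η (x η) ≤ M * ‖η‖ ^ (-r)
  bound' : ∀ᵐ η, stateNorm η (y η) ≤ M * ‖η‖ ^ (-r)
  diff : ∀ᵐ η, stateNorm η (x η - y η) ≤ D * ‖η‖ ^ (-r)

lemma aestronglyMeasurable_apply {x : Space d → Unit ⊕ Fin d → ℂ}
    (hx : AEStronglyMeasurable x volume) (i : Unit ⊕ Fin d) :
    AEStronglyMeasurable (fun η => x η i) volume :=
  (continuous_apply i).comp_aestronglyMeasurable hx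

lemma StatePair.velocity {M D r : ℝ} {x y : Space d → Unit ⊕ Fin d → ℂ} (H : StatePair M D r x y)
    (k : Fin d) :
    DecayPair M D r (fun η => x η (Sum.inr k)) (fun η => y η (Sum.inr k)) where
  meas := aestronglyMeasurable_apply H.meas _
  meas' := aestronglyMeasurable_apply H.meas' _
  bound := H.bound.mono fun _ h =>
    (((stateNorm_le_iff (stateNorm_nonneg _ _)).1 le_rfl).2 k).trans h
  bound' := H.bound'.mono fun _ h =>
    (((stateNorm_le_iff (stateNorm_nonneg _ _)).1 le_rfl).2 k).trans h
  diff := H.diff.mono fun _ h =>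
    (((stateNorm_le_iff (stateNorm_nonneg _ _)).1 le_rfl).2 k).trans h

lemma norm_inl_le_stateNorm (ξ : Space d) (x : Unit ⊕ Fin d → ℂ) :
    ‖x (Sum.inl ())‖ ≤ stateNorm ξ x := (norm_le_pi_norm x _).trans (norm_le_stateNorm ξ x)

lemma mul_norm_inl_le_stateNorm (ξ : Space d) (x : Unit ⊕ Fin d → ℂ) :
    ‖ξ‖ * ‖x (Sum.inl ())‖ ≤ stateNorm ξ x := by
  have := ((stateNorm_le_iff (stateNorm_nonneg ξ x)).1 le_rfl).1
  nlinarith [norm_nonneg (x (Sum.inl ()))]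

lemma StatePair.density {M D r : ℝ} {x y : Space d → Unit ⊕ Fin d → ℂ}
    (H : StatePair M D r x y) :
    DecayPair M D r (fun η => x η (Sum.inl ())) (fun η => y η (Sum.inl ())) where
  meas := aestronglyMeasurable_apply H.meas _
  meas' := aestronglyMeasurable_apply H.meas' _
  bound := H.bound.mono fun _ h => (norm_inl_le_stateNorm _ _).trans h
  bound' := H.bound'.mono fun _ h => (norm_inl_le_stateNorm _ _).trans h
  diff := H.diff.mono fun η h => (norm_inl_le_stateNorm η (x η - y η)).trans h

lemma norm_dHat_le (k : Fin d) (h : Space d → ℂ) (ξ : Space d) :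
    ‖dHat k h ξ‖ ≤ ‖ξ‖ * ‖h ξ‖ := by
  rw [dHat, norm_mul, norm_mul, Complex.norm_I, one_mul, Complex.norm_real]
  exact mul_le_mul_of_nonneg_right (PiLp.norm_apply_le ξ k) (norm_nonneg _)

lemma dHat_sub (k : Fin d) (h h' : Space d → ℂ) (ξ : Space d) :
    dHat k h ξ - dHat k h' ξ = dHat k (fun η => h η - h' η) ξ := by
  simp only [dHat]; ring

lemma aestronglyMeasurable_dHat (k : Fin d) {h : Space d → ℂ} (hh : AEStronglyMeasurable h volume) :
    AEStronglyMeasurable (dHat k h) volume := by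
  have : Continuous fun ξ : Space d => Complex.I * (ξ k : ℂ) := by fun_prop
  exact this.aestronglyMeasurable.mul hh

/-- For the density, the weighted norm of states already contains one derivative. -/
lemma StatePair.density_deriv {M D r : ℝ} {x y : Space d → Unit ⊕ Fin d → ℂ}
    (H : StatePair M D r x y) (k : Fin d) :
    DecayPair M D r (dHat k fun η => x η (Sum.inl ())) (dHat k fun η => y η (Sum.inl ())) where
  meas := aestronglyMeasurable_dHat k (aestronglyMeasurable_apply H.meas _)
  meas' := aestronglyMeasurable_dHat k (aestronglyMeasurable_apply H.meas' _)
  bound := H.bound.mono fun _ h =>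
    (norm_dHat_le _ _ _).trans ((mul_norm_inl_le_stateNorm _ _).trans h)
  bound' := H.bound'.mono fun _ h =>
    (norm_dHat_le _ _ _).trans ((mul_norm_inl_le_stateNorm _ _).trans h)
  diff := H.diff.mono fun η h => by
    rw [dHat_sub]
    exact (norm_dHat_le _ _ _).trans ((mul_norm_inl_le_stateNorm η (x η - y η)).trans h)

lemma DecayPair.deriv (hd : 0 < d) {M D r : ℝ} {h h' : Space d → ℂ} (H : DecayPair M D r h h')
    (k : Fin d) : DecayPair M D (r - 1) (dHat k h) (dHat k h') := by
  have key : ∀ {c : ℝ} {f : Space d → ℂ} {ξ : Space d}, ξ ≠ 0 → ‖f ξ‖ ≤ c * ‖ξ‖ ^ (-r) →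
      ‖dHat k f ξ‖ ≤ c * ‖ξ‖ ^ (-(r - 1)) := by
    intro c f ξ hξ hf
    have hr : 0 < ‖ξ‖ := norm_pos_iff.2 hξ
    refine (norm_dHat_le _ _ _).trans ((mul_le_mul_of_nonneg_left hf hr.le).trans (le_of_eq ?_))
    rw [neg_sub, sub_eq_add_neg, Real.rpow_add hr, Real.rpow_one]
    ring
  refine ⟨aestronglyMeasurable_dHat k H.meas, aestronglyMeasurable_dHat k H.meas', ?_, ?_, ?_⟩
  · filter_upwards [H.bound, ae_ne_zero hd] with ξ h1 h2 using key h2 h1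
  · filter_upwards [H.bound', ae_ne_zero hd] with ξ h1 h2 using key h2 h1
  · filter_upwards [H.diff, ae_ne_zero hd] with ξ h1 h2
    rw [dHat_sub]
    exact key (f := fun η => h η - h' η) h2 h1

/-- The nonlinear term is locally Lipschitz from the weight `|ξ|^{-θ}` to the weight
`|ξ|^{d+1-2θ}`. Each product is estimated with one undifferentiated and one differentiated factor,
`|ξ|^{-θ} ⋆ |ξ|^{1-θ}`, where `2θ - 1 > d` is needed for convergence at infinity; only when an
additional factor `|ξ|` is present, `|ξ|^{-θ} ⋆ |ξ|^{-θ}` is used instead. -/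
lemma exists_nonlinState_sub_le (hd : 0 < d) (μ ν κ : ℝ) {θ : ℝ} (hθd : θ < d)
    (hθ : (d : ℝ) + 1 < 2 * θ) :
    ∃ C > 0, ∀ (M D : ℝ) (x y : Space d → Unit ⊕ Fin d → ℂ), 0 ≤ M → 0 ≤ D →
      StatePair M D θ x y → ∀ ξ : Space d, ξ ≠ 0 →
        stateNorm ξ (nonlinState μ ν κ x ξ - nonlinState μ ν κ y ξ) ≤
          C * (M * D) * ‖ξ‖ ^ ((d : ℝ) + 1 - 2 * θ) := by
  obtain ⟨C₁, hC₁, h₁⟩ := exists_prodHat_sub_le hd (by linarith : 0 ≤ θ) hθd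
    (by linarith : 0 ≤ θ - 1) (by linarith) (by linarith)
  obtain ⟨C₂, hC₂, h₂⟩ := exists_prodHat_sub_le hd (by linarith : 0 ≤ θ) hθd
    (by linarith : 0 ≤ θ) hθd (by linarith)
  set C := C₁ + C₂ with hC
  refine ⟨C * (d * (2 + |μ| + |μ + ν| + |κ / 2|) + 1), by positivity,
    fun M D x y hM hD H ξ hξ => ?_⟩
  have hr : 0 < ‖ξ‖ := norm_pos_iff.2 hξ
  set B := C * (M * D) * ‖ξ‖ ^ ((d : ℝ) + 1 - 2 * θ) with hB
  have hp : 0 ≤ M * D * ‖ξ‖ ^ ((d : ℝ) + 1 - 2 * θ) := by positivity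
  have hB0 : 0 ≤ B := by positivity
  have P₁ : ∀ {h h' k k' : Space d → ℂ}, DecayPair M D θ h h' → DecayPair M D (θ - 1) k k' →
      ‖prodHat h k ξ - prodHat h' k' ξ‖ ≤ B := by
    intro h h' k k' hh hk
    refine (h₁ M D h h' k k' hM hD hh hk ξ hξ).trans ?_
    rw [show (d : ℝ) - θ - (θ - 1) = (d : ℝ) + 1 - 2 * θ by ring, hB, hC]
    nlinarith
  have P₂ : ∀ {h h' k k' : Space d → ℂ}, DecayPair M D θ h h' → DecayPair M D θ k k' →
      ‖ξ‖ * ‖prodHat h k ξ - prodHat h' k' ξ‖ ≤ B := by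
    intro h h' k k' hh hk
    refine (mul_le_mul_of_nonneg_left (h₂ M D h h' k k' hM hD hh hk ξ hξ) hr.le).trans ?_
    have : ‖ξ‖ ^ ((d : ℝ) + 1 - 2 * θ) = ‖ξ‖ * ‖ξ‖ ^ ((d : ℝ) - θ - θ) := by
      nth_rewrite 2 [← Real.rpow_one ‖ξ‖]
      rw [← Real.rpow_add hr]
      ring_nf
    rw [hB, hC, this]
    rw [this] at hp
    nlinarith
  have sum_bound : ∀ {f g : Fin d → ℂ} {c : ℝ}, (∀ k, ‖f k - g k‖ ≤ c) →
      ‖∑ k, f k - ∑ k, g k‖ ≤ d * c := by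
    intro f g c hfg
    rw [← Finset.sum_sub_distrib]
    refine (norm_sum_le _ _).trans ((Finset.sum_le_card_nsmul _ _ c fun k _ => hfg k).trans ?_)
    simp
  have tot : C * (d * (2 + |μ| + |μ + ν| + |κ / 2|) + 1) * (M * D) * ‖ξ‖ ^ ((d : ℝ) + 1 - 2 * θ) =
      d * (2 + |μ| + |μ + ν| + |κ / 2|) * B + B := by rw [hB]; ring
  have b0 : 0 ≤ (d : ℝ) * B := by positivity
  have b1 : 0 ≤ |μ| * (d * B) := by positivity
  have b2 : 0 ≤ |μ + ν| * (d * B) := by positivity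
  have b3 : 0 ≤ |κ / 2| * (d * B) := by positivity
  rw [tot, stateNorm_le_iff (by positivity)]
  refine ⟨?_, fun j => ?_⟩
  · simp only [nonlinState, Pi.sub_apply, Sum.elim_inl, fHat]
    rw [neg_sub_neg, norm_sub_rev]
    have e1 := sum_bound fun k => P₁ (H.velocity k) (H.density.deriv hd k)
    have e2 : ‖ξ‖ * ‖(∑ k, prodHat (fun η => x η (Sum.inr k)) (dHat k fun η => x η (Sum.inl ())) ξ) -
        ∑ k, prodHat (fun η => y η (Sum.inr k)) (dHat k fun η => y η (Sum.inl ())) ξ‖ ≤ d * B := by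
      have := sum_bound fun k => (le_div_iff₀' hr).2 (P₂ (H.velocity k) (H.density_deriv k))
      rw [mul_div_assoc', le_div_iff₀' hr] at this
      exact this
    nlinarith
  · simp only [nonlinState, Pi.sub_apply, Sum.elim_inr]
    have e1 : ‖g₁Hat (fun k η => x η (Sum.inr k)) j ξ - g₁Hat (fun k η => y η (Sum.inr k)) j ξ‖ ≤
        d * B := by
      rw [g₁Hat, g₁Hat, neg_sub_neg, norm_sub_rev]
      exact sum_bound fun k => P₁ (H.velocity k) ((H.velocity j).deriv hd k)
    have e2 : ‖g₂Hat μ ν (fun k η => x η (Sum.inr k)) (fun η => x η (Sum.inl ())) j ξ -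
        g₂Hat μ ν (fun k η => y η (Sum.inr k)) (fun η => y η (Sum.inl ())) j ξ‖ ≤
        |μ| * (d * B) + |μ + ν| * (d * B) := by
      rw [g₂Hat, g₂Hat, add_sub_add_comm, ← mul_sub, ← mul_sub]
      refine (norm_add_le _ _).trans ?_
      rw [norm_mul, norm_mul, Complex.norm_real, Complex.norm_real, Real.norm_eq_abs,
        Real.norm_eq_abs]
      refine add_le_add (mul_le_mul_of_nonneg_left ?_ (abs_nonneg _))
        (mul_le_mul_of_nonneg_left ?_ (abs_nonneg _))
      · exact sum_bound fun k => P₁ (H.density_deriv k) ((H.velocity j).deriv hd k)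
      · exact sum_bound fun k => P₁ (H.density_deriv k) ((H.velocity k).deriv hd j)
    have e3 : ‖g₃Hat κ (fun η => x η (Sum.inl ())) j ξ - g₃Hat κ (fun η => y η (Sum.inl ())) j ξ‖ ≤
        |κ / 2| * (d * B) := by
      rw [g₃Hat, g₃Hat, ← mul_sub, norm_mul, Complex.norm_real, Real.norm_eq_abs, dHat_sub]
      refine mul_le_mul_of_nonneg_left ((norm_dHat_le _ _ _).trans ?_) (abs_nonneg _)
      have := sum_bound fun k =>
        (le_div_iff₀' hr).2 (P₂ (H.density_deriv k) (H.density_deriv k))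
      rw [mul_div_assoc', le_div_iff₀' hr] at this
      exact this
    rw [add_sub_add_comm, add_sub_add_comm]
    refine (norm_add₃_le).trans ((add_le_add_three e1 e2 e3).trans ?_)
    nlinarith

lemma nonlinWellDefined_of_stateNorm_le (hd : 0 < d) {θ M : ℝ} (hθd : θ < d)
    (hθ : (d : ℝ) + 1 < 2 * θ) (hM : 0 ≤ M) {a : Distr d} {u : Fin d → Distr d}
    (ha : HasFourierFunction a) (hu : ∀ j, HasFourierFunction (u j))
    (hb : ∀ᵐ ξ, stateNorm ξ (stateHat a u ξ) ≤ M * ‖ξ‖ ^ (-θ)) : NonlinWellDefined a u := by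
  have hm := aestronglyMeasurable_stateHat ha hu
  have H : StatePair M 0 θ (stateHat a u) (stateHat a u) :=
    ⟨hm, hm, hb, hb, Eventually.of_forall fun ξ => by simp [stateNorm_zero]⟩
  have P₁ : ∀ {h k : Space d → ℂ}, DecayPair M 0 θ h h → DecayPair M 0 (θ - 1) k k →
      ProdConverges h k := fun hh hk => (ae_ne_zero hd).mono fun ξ hξ =>
    convolutionExistsAt_of_decayPair hd (by linarith) hθd (by linarith) (by linarith) (by linarith)
      hh hk hM hM hξ
  have P₂ : ∀ {h k : Space d → ℂ}, DecayPair M 0 θ h h → DecayPair M 0 θ k k →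
      ProdConverges h k := fun hh hk => (ae_ne_zero hd).mono fun ξ hξ =>
    convolutionExistsAt_of_decayPair hd (by linarith) hθd (by linarith) hθd (by linarith)
      hh hk hM hM hξ
  exact fun j k => ⟨P₂ (H.velocity k) (H.density_deriv k),
    P₁ (H.velocity k) ((H.velocity j).deriv hd k), P₁ (H.density_deriv k) ((H.velocity j).deriv hd k),
    P₁ (H.density_deriv k) ((H.velocity k).deriv hd j), P₂ (H.density_deriv k) (H.density_deriv k)⟩

lemma nonlinState_zero (μ ν κ : ℝ) (ξ : Space d) :
    nonlinState μ ν κ (fun _ => (0 : Unit ⊕ Fin d → ℂ)) ξ = 0 := by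
  have h0 : ∀ k : Fin d, dHat k (fun _ : Space d => (0 : ℂ)) = fun _ => 0 := by
    intro k; funext η; simp [dHat]
  have hp : ∀ h : Space d → ℂ, prodHat (fun _ => (0 : ℂ)) h = fun _ => 0 := by
    intro h; funext η; simp [prodHat, convolution]
  funext i
  rcases i with i | j
  · simp [nonlinState, fHat, hp]
  · simp [nonlinState, g₁Hat, g₂Hat, g₃Hat, hp, h0]

/-! ### Time integrals -/

/-- A weakly singular beta integral: the kernel is split at `s = t/2`. -/
lemma exists_integral_rpow_mul_rpow_le {b γ : ℝ} (hb0 : 0 ≤ b) (hb : b < 1) (hγ0 : 0 ≤ γ)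
    (hγ : γ < 1) :
    ∃ K > 0, ∀ t : ℝ, 0 < t →
      IntervalIntegrable (fun s => (t - s) ^ (-b) * s ^ (-γ)) volume 0 t ∧
        ∫ s in (0 : ℝ)..t, (t - s) ^ (-b) * s ^ (-γ) ≤ K * t ^ (1 - b - γ) := by
  have h1b : 0 < 1 - b := by linarith
  have h1γ : 0 < 1 - γ := by linarith
  refine ⟨(1 / 2) ^ (-b) / (1 - γ) + (1 / 2) ^ (-γ) / (1 - b), by positivity, fun t ht => ?_⟩
  have i1 : IntervalIntegrable (fun s : ℝ => s ^ (-γ)) volume 0 t :=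
    intervalIntegral.intervalIntegrable_rpow' (by linarith)
  have i2 : IntervalIntegrable (fun s : ℝ => (t - s) ^ (-b)) volume 0 t := by
    have h0 : IntervalIntegrable (fun s : ℝ => s ^ (-b)) volume 0 t :=
      intervalIntegral.intervalIntegrable_rpow' (by linarith)
    simpa using (h0.comp_sub_left t).symm
  have i3 := (i1.const_mul ((t / 2) ^ (-b))).add (i2.const_mul ((t / 2) ^ (-γ)))
  have hle : ∀ s ∈ Set.Ioc 0 t, (t - s) ^ (-b) * s ^ (-γ) ≤
      (t / 2) ^ (-b) * s ^ (-γ) + (t / 2) ^ (-γ) * (t - s) ^ (-b) := by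
    intro s hs
    have hs0 : 0 < s := hs.1
    have hts : 0 ≤ t - s := sub_nonneg.2 hs.2
    rcases le_total s (t / 2) with h | h
    · refine le_add_of_le_of_nonneg ?_ (by positivity)
      gcongr 1
      exact Real.rpow_le_rpow_of_nonpos (by positivity) (by linarith) (by linarith)
    · refine le_add_of_nonneg_of_le (by positivity) ?_
      rw [mul_comm]
      gcongr 1
      exact Real.rpow_le_rpow_of_nonpos (by positivity) (by linarith) (by linarith)
  have i4 : IntervalIntegrable (fun s => (t - s) ^ (-b) * s ^ (-γ)) volume 0 t := by
    rw [intervalIntegrable_iff_integrableOn_Ioc_of_le ht.le] at i3 ⊢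
    refine i3.mono' (by fun_prop) ((ae_restrict_iff' measurableSet_Ioc).2
      (Eventually.of_forall fun s hs => ?_))
    have hs0 : 0 < s := hs.1
    have hts : 0 ≤ t - s := sub_nonneg.2 hs.2
    rw [Real.norm_of_nonneg (by positivity)]
    exact hle s hs
  refine ⟨i4, ?_⟩
  have hmono := intervalIntegral.integral_mono_on_of_le_Ioo ht.le i4 i3
    fun s hs => hle s ⟨hs.1, hs.2.le⟩
  refine hmono.trans (le_of_eq ?_)
  rw [intervalIntegral.integral_add (i1.const_mul _) (i2.const_mul _),
    intervalIntegral.integral_const_mul, intervalIntegral.integral_const_mul,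
    intervalIntegral.integral_comp_sub_left (fun s : ℝ => s ^ (-b)) t, sub_self, sub_zero,
    integral_rpow (Or.inl (by linarith)), integral_rpow (Or.inl (by linarith)),
    Real.zero_rpow (by linarith), Real.zero_rpow (by linarith), sub_zero, sub_zero,
    div_eq_mul_one_div t 2, Real.mul_rpow ht.le (by norm_num), Real.mul_rpow ht.le (by norm_num)]
  have e1 : t ^ (1 - b - γ) = t ^ (-b) * t ^ (-γ + 1) := by
    rw [← Real.rpow_add ht]; ring_nf
  have e2 : t ^ (1 - b - γ) = t ^ (-γ) * t ^ (-b + 1) := by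
    rw [← Real.rpow_add ht]; ring_nf
  rw [add_mul]
  nth_rewrite 1 [e1]
  rw [e2]
  rw [show -γ + 1 = 1 - γ by ring, show -b + 1 = 1 - b by ring]
  ring

lemma stateNorm_intervalIntegral_le {ξ : Space d} {F : ℝ → Unit ⊕ Fin d → ℂ} {G : ℝ → ℝ}
    {s t : ℝ} (hst : s ≤ t) (hG : IntervalIntegrable G volume s t)
    (h : ∀ τ ∈ Set.Ioo s t, stateNorm ξ (F τ) ≤ G τ) :
    stateNorm ξ (∫ τ in s..t, F τ) ≤ ∫ τ in s..t, G τ := by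
  rw [intervalIntegral.integral_of_le hst, intervalIntegral.integral_of_le hst]
  refine stateNorm_integral_le ((intervalIntegrable_iff_integrableOn_Ioc_of_le hst).1 hG) ?_
  rw [← restrict_Ioo_eq_restrict_Ioc]
  exact (ae_restrict_iff' measurableSet_Ioo).2 (Eventually.of_forall h)

/-- The Duhamel integral of a forcing term of size `s^{-γ}`. -/
lemma exists_duhamel_le {μ ν κ α b γ : ℝ} (hμ : 0 < μ) (hμν : 0 < μ + ν) (hκ : 0 < κ) (hα : 0 < α)
    (hb0 : 0 ≤ b) (hb : b < 1) (hγ0 : 0 ≤ γ) (hγ : γ < 1) :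
    ∃ C > 0, ∀ (ξ : Space d) (F : ℝ → Unit ⊕ Fin d → ℂ) (A t : ℝ), ξ ≠ 0 → 0 ≤ A → 0 < t →
      (∀ s > 0, stateNorm ξ (F s) ≤ A * s ^ (-γ)) →
        stateNorm ξ (∫ s in (0 : ℝ)..t, semigroupSymbol μ ν κ α (t - s) ξ *ᵥ F s) ≤
          C * A * t ^ (1 - b - γ) * ‖ξ‖ ^ (-(2 * b)) := by
  obtain ⟨C, hC, hS⟩ := exists_stateNorm_semigroup_le_rpow (d := d) hμ hμν hκ hα hb0
  obtain ⟨K, hK, hI⟩ := exists_integral_rpow_mul_rpow_le hb0 hb hγ0 hγ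
  refine ⟨C * K, by positivity, fun ξ F A t hξ hA ht hF => ?_⟩
  obtain ⟨hi, hle⟩ := hI t ht
  refine (stateNorm_intervalIntegral_le ht.le (hi.const_mul (C * A * ‖ξ‖ ^ (-(2 * b))))
    fun s hs => ?_).trans ?_
  · refine (hS ξ (F s) (t - s) (sub_pos.2 hs.2) hξ).trans ?_
    have hts : 0 ≤ t - s := (sub_pos.2 hs.2).le
    have := hF s hs.1
    calc _ ≤ C * ((t - s) ^ (-b) * ‖ξ‖ ^ (-(2 * b))) * (A * s ^ (-γ)) := by gcongr
      _ = _ := by ring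
  · rw [intervalIntegral.integral_const_mul]
    calc _ ≤ C * A * ‖ξ‖ ^ (-(2 * b)) * (K * t ^ (1 - b - γ)) := by gcongr
      _ = _ := by ring

lemma stronglyMeasurable_semigroupSymbol_mulVec (μ ν κ α : ℝ) {X : Type*} [MeasurableSpace X]
    {f : X → ℝ} {g : X → Space d} {F : X → Unit ⊕ Fin d → ℂ} (hf : Measurable f)
    (hg : Measurable g) (hF : StronglyMeasurable F) :
    StronglyMeasurable fun x => semigroupSymbol μ ν κ α (f x) (g x) *ᵥ F x := by
  refine Measurable.stronglyMeasurable (measurable_pi_lambda _ fun i => ?_)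
  simp only [Matrix.mulVec, dotProduct]
  refine Finset.measurable_sum _ fun j _ => Measurable.mul ?_ (measurable_pi_iff.1 hF.measurable j)
  exact ((continuous_semigroupSymbol μ ν κ α).matrix_elem i j).measurable.comp (hf.prodMk hg)

lemma intervalIntegrable_duhamel {μ ν κ α b γ : ℝ} (hμ : 0 < μ) (hμν : 0 < μ + ν) (hκ : 0 < κ)
    (hα : 0 < α) (hb0 : 0 ≤ b) (hb : b < 1) (hγ0 : 0 ≤ γ) (hγ : γ < 1) {ξ : Space d}
    {F : ℝ → Unit ⊕ Fin d → ℂ} {A t : ℝ} (hξ : ξ ≠ 0) (hA : 0 ≤ A) (ht : 0 < t)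
    (hm : StronglyMeasurable F) (hF : ∀ s > 0, stateNorm ξ (F s) ≤ A * s ^ (-γ)) :
    IntervalIntegrable (fun s => semigroupSymbol μ ν κ α (t - s) ξ *ᵥ F s) volume 0 t := by
  obtain ⟨C, hC, hS⟩ := exists_stateNorm_semigroup_le_rpow (d := d) hμ hμν hκ hα hb0
  obtain ⟨K, hK, hI⟩ := exists_integral_rpow_mul_rpow_le hb0 hb hγ0 hγ
  have hi := (hI t ht).1.const_mul (C * A * ‖ξ‖ ^ (-(2 * b)))
  have hmeas : StronglyMeasurable fun s => semigroupSymbol μ ν κ α (t - s) ξ *ᵥ F s :=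
    stronglyMeasurable_semigroupSymbol_mulVec _ _ _ _ (by fun_prop) measurable_const hm
  rw [intervalIntegrable_iff_integrableOn_Ioo_of_le ht.le] at hi ⊢
  refine hi.mono' hmeas.aestronglyMeasurable
    ((ae_restrict_iff' measurableSet_Ioo).2 (Eventually.of_forall fun s hs => ?_))
  refine (norm_le_stateNorm ξ _).trans ((hS ξ (F s) (t - s) (sub_pos.2 hs.2) hξ).trans ?_)
  have hts : 0 ≤ t - s := (sub_pos.2 hs.2).le
  have := hF s hs.1
  calc _ ≤ C * ((t - s) ^ (-b) * ‖ξ‖ ^ (-(2 * b))) * (A * s ^ (-γ)) := by gcongr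
    _ = _ := by ring

/-- The Duhamel integral is Hölder continuous in time, locally uniformly in `t > 0` and uniformly
in the frequency with respect to the natural weight. -/
lemma exists_duhamel_sub_le {μ ν κ α b γ ε : ℝ} (hμ : 0 < μ) (hμν : 0 < μ + ν) (hκ : 0 < κ)
    (hα : 0 < α) (hb0 : 0 ≤ b) (hγ0 : 0 ≤ γ) (hγ : γ < 1) (hε : 0 < ε) (hbε : b + ε < 1) :
    ∃ C > 0, ∀ (ξ : Space d) (F : ℝ → Unit ⊕ Fin d → ℂ) (A t h : ℝ), ξ ≠ 0 → 0 ≤ A → 0 < t →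
      0 ≤ h → StronglyMeasurable F → (∀ s > 0, stateNorm ξ (F s) ≤ A * s ^ (-γ)) →
        stateNorm ξ ((∫ s in (0 : ℝ)..(t + h), semigroupSymbol μ ν κ α (t + h - s) ξ *ᵥ F s) -
            ∫ s in (0 : ℝ)..t, semigroupSymbol μ ν κ α (t - s) ξ *ᵥ F s) ≤
          C * A * (h ^ ε * (t ^ (1 - (b + ε) - γ) + t ^ (1 - (b + ε / 2) - γ)) +
            t ^ (-γ) * h ^ (1 - b)) * ‖ξ‖ ^ (-(2 * b)) := by
  have hb : b < 1 := by linarith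
  obtain ⟨C₀, hC₀, hS⟩ := exists_stateNorm_semigroup_le_rpow (d := d) hμ hμν hκ hα hb0
  obtain ⟨C₁, hC₁, hD⟩ := exists_stateNorm_semigroup_sub_le (d := d) hμ hμν hκ hα hb0 hε
    (by linarith)
  obtain ⟨K₁, hK₁, hI₁⟩ := exists_integral_rpow_mul_rpow_le (by linarith : 0 ≤ b + ε) hbε hγ0 hγ
  obtain ⟨K₂, hK₂, hI₂⟩ := exists_integral_rpow_mul_rpow_le (by linarith : 0 ≤ b + ε / 2)
    (by linarith) hγ0 hγ
  have h1b : 0 < 1 - b := by linarith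
  refine ⟨C₁ * (K₁ + K₂) + C₀ / (1 - b), by positivity, fun ξ F A t h hξ hA ht hh hm hF => ?_⟩
  have j1 := intervalIntegrable_duhamel hμ hμν hκ hα hb0 hb hγ0 hγ hξ hA ht hm hF
  have j2 := intervalIntegrable_duhamel hμ hμν hκ hα hb0 hb hγ0 hγ hξ hA
    (by linarith : 0 < t + h) hm hF
  have hsub : t ∈ Set.uIcc 0 (t + h) := by
    rw [Set.uIcc_of_le (by linarith)]; exact ⟨ht.le, by linarith⟩
  have j3 := j2.mono_set (Set.uIcc_subset_uIcc_left hsub)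
  have j4 := j2.mono_set (Set.uIcc_subset_uIcc_right hsub)
  rw [← intervalIntegral.integral_add_adjacent_intervals j3 j4, add_sub_right_comm,
    ← intervalIntegral.integral_sub j3 j1]
  refine (stateNorm_add_le _ _ _).trans ?_
  obtain ⟨hi₁, hle₁⟩ := hI₁ t ht
  obtain ⟨hi₂, hle₂⟩ := hI₂ t ht
  have hhε : 0 ≤ h ^ ε := Real.rpow_nonneg hh _
  set w := ‖ξ‖ ^ (-(2 * b)) with hw
  have hw0 : 0 ≤ w := by positivity
  have b1 : stateNorm ξ (∫ s in (0 : ℝ)..t, (semigroupSymbol μ ν κ α (t + h - s) ξ *ᵥ F s -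
      semigroupSymbol μ ν κ α (t - s) ξ *ᵥ F s)) ≤
      C₁ * h ^ ε * w * A * (K₁ * t ^ (1 - (b + ε) - γ) + K₂ * t ^ (1 - (b + ε / 2) - γ)) := by
    refine (stateNorm_intervalIntegral_le ht.le
      ((hi₁.add hi₂).const_mul (C₁ * h ^ ε * w * A)) fun s hs => ?_).trans ?_
    · have hts : 0 ≤ t - s := (sub_pos.2 hs.2).le
      have e := hD ξ (F s) (t - s) h (sub_pos.2 hs.2) hh hξ
      rw [sub_add_eq_add_sub] at e
      have := hF s hs.1
      calc _ ≤ C₁ * h ^ ε * (((t - s) ^ (-(b + ε)) + (t - s) ^ (-(b + ε / 2))) * w) *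
            (A * s ^ (-γ)) := e.trans (by gcongr)
        _ = _ := by ring
    · rw [intervalIntegral.integral_const_mul]
      rw [intervalIntegral.integral_add hi₁ hi₂]
      gcongr
  have i2 : IntervalIntegrable (fun s : ℝ => (t + h - s) ^ (-b)) volume t (t + h) := by
    have h0 : IntervalIntegrable (fun s : ℝ => s ^ (-b)) volume 0 h :=
      intervalIntegral.intervalIntegrable_rpow' (by linarith)
    simpa using (h0.comp_sub_left (t + h)).symm
  have b2 : stateNorm ξ (∫ s in t..(t + h), semigroupSymbol μ ν κ α (t + h - s) ξ *ᵥ F s) ≤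
      C₀ * w * A * t ^ (-γ) * (h ^ (1 - b) / (1 - b)) := by
    refine (stateNorm_intervalIntegral_le (by linarith)
      (i2.const_mul (C₀ * w * A * t ^ (-γ))) fun s hs => ?_).trans (le_of_eq ?_)
    · have hs0 : 0 < s := ht.trans hs.1
      have hts : 0 ≤ t + h - s := (sub_pos.2 hs.2).le
      have e := hS ξ (F s) (t + h - s) (sub_pos.2 hs.2) hξ
      have := hF s hs0
      have : s ^ (-γ) ≤ t ^ (-γ) := Real.rpow_le_rpow_of_nonpos ht hs.1.le (by linarith)
      calc _ ≤ C₀ * ((t + h - s) ^ (-b) * w) * (A * s ^ (-γ)) := e.trans (by gcongr)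
        _ ≤ C₀ * ((t + h - s) ^ (-b) * w) * (A * t ^ (-γ)) := by gcongr
        _ = _ := by ring
    · rw [intervalIntegral.integral_const_mul,
        intervalIntegral.integral_comp_sub_left (fun s : ℝ => s ^ (-b)) (t + h), sub_self,
        add_sub_cancel_left, integral_rpow (Or.inl (by linarith)), Real.zero_rpow (by linarith),
        sub_zero, show -b + 1 = 1 - b by ring]
  refine (add_le_add b1 b2).trans ?_
  set p₁ := t ^ (1 - (b + ε) - γ)
  set p₂ := t ^ (1 - (b + ε / 2) - γ)
  have hp₁ : 0 ≤ p₁ := by positivity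
  have hp₂ : 0 ≤ p₂ := by positivity
  have hp₃ : 0 ≤ t ^ (-γ) * h ^ (1 - b) := mul_nonneg (by positivity) (Real.rpow_nonneg hh _)
  have hAw : 0 ≤ A * w := by positivity
  calc _ = A * w * (C₁ * (h ^ ε * (K₁ * p₁ + K₂ * p₂)) +
        C₀ / (1 - b) * (t ^ (-γ) * h ^ (1 - b))) := by ring
    _ ≤ A * w * ((C₁ * (K₁ + K₂) + C₀ / (1 - b)) * (h ^ ε * (p₁ + p₂)) +
        (C₁ * (K₁ + K₂) + C₀ / (1 - b)) * (t ^ (-γ) * h ^ (1 - b))) := by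
      have q0 : 0 ≤ C₀ / (1 - b) := by positivity
      have q1 : 0 ≤ C₁ * (K₁ + K₂) := by positivity
      have q2 : 0 ≤ h ^ ε * (p₁ + p₂) := by positivity
      have q3 : h ^ ε * (K₁ * p₁ + K₂ * p₂) ≤ (K₁ + K₂) * (h ^ ε * (p₁ + p₂)) := by
        have : K₁ * p₁ + K₂ * p₂ ≤ (K₁ + K₂) * (p₁ + p₂) := by
          nlinarith [mul_nonneg hK₁.le hp₂, mul_nonneg hK₂.le hp₁]
        nlinarith [mul_le_mul_of_nonneg_left this hhε]
      have q4 := mul_le_mul_of_nonneg_left q3 hC₁.le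
      refine mul_le_mul_of_nonneg_left ?_ hAw
      nlinarith [mul_nonneg q0 q2, mul_nonneg q1 hp₃]
    _ = _ := by ring

/-! ### The Picard iteration -/

/-- The decay exponent `θ = d - 1 + 2/p` of the solution in the frequency. -/
def decayExp (d : ℕ) (p : ℝ) : ℝ := (d : ℝ) - 1 + 2 / p

/-- The Duhamel integral of the nonlinear term along the trajectory `Φ`. -/
def duhamel (μ ν κ α : ℝ) (Φ : ℝ → Space d → Unit ⊕ Fin d → ℂ) (t : ℝ) (ξ : Space d) :
    Unit ⊕ Fin d → ℂ :=
  ∫ s in (0 : ℝ)..t, semigroupSymbol μ ν κ α (t - s) ξ *ᵥ nonlinState μ ν κ (Φ s) ξ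

/-- The integrand of `duhamel` is integrable in time. -/
def DuhamelConverges (μ ν κ α : ℝ) (Φ : ℝ → Space d → Unit ⊕ Fin d → ℂ) (t : ℝ) (ξ : Space d) :
    Prop :=
  IntervalIntegrable (fun s => semigroupSymbol μ ν κ α (t - s) ξ *ᵥ nonlinState μ ν κ (Φ s) ξ)
    volume 0 t

/-- The Duhamel map is Lipschitz with constant `K M` on trajectories bounded by `M` in the weight
`t^{-1/p} |ξ|^{-θ}`. The time integrals are assumed to converge, so that no measurability in time
of the trajectories is required. -/
def DuhamelLipschitz (μ ν κ α p K : ℝ) (d : ℕ) : Prop :=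
  ∀ (M D : ℝ) (Φ Ψ : ℝ → Space d → Unit ⊕ Fin d → ℂ), 0 ≤ M → 0 ≤ D →
    (∀ s > 0, StatePair (M * s ^ (-(1 / p))) (D * s ^ (-(1 / p))) (decayExp d p) (Φ s) (Ψ s)) →
    ∀ (t : ℝ) (ξ : Space d), 0 < t → ξ ≠ 0 →
      DuhamelConverges μ ν κ α Φ t ξ → DuhamelConverges μ ν κ α Ψ t ξ →
      stateNorm ξ (duhamel μ ν κ α Φ t ξ - duhamel μ ν κ α Ψ t ξ) ≤
        K * M * D * t ^ (-(1 / p)) * ‖ξ‖ ^ (-decayExp d p)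

lemma decayExp_lt {p : ℝ} (hp : 2 < p) : decayExp d p < d := by
  have : 2 / p < 1 := (div_lt_one (by linarith)).2 hp
  unfold decayExp; linarith

lemma lt_two_mul_decayExp {p : ℝ} (hdp : 0 < (d : ℝ) - 3 + 4 / p) :
    (d : ℝ) + 1 < 2 * decayExp d p := by
  have : 4 / p = 2 * (2 / p) := by ring
  unfold decayExp; linarith

lemma rpow_neg_inv_mul_self {p s : ℝ} (hs : 0 < s) :
    s ^ (-(1 / p)) * s ^ (-(1 / p)) = s ^ (-(2 / p)) := by
  rw [← Real.rpow_add hs]; ring_nf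

/-- The bound on the nonlinear term along two trajectories. -/
lemma exists_nonlinState_trajectory_sub_le (hd : 0 < d) (μ ν κ : ℝ) {p : ℝ} (hp : 2 < p)
    (hdp : 0 < (d : ℝ) - 3 + 4 / p) :
    ∃ C > 0, ∀ (M D s : ℝ) (x y : Space d → Unit ⊕ Fin d → ℂ), 0 ≤ M → 0 ≤ D → 0 < s →
      StatePair (M * s ^ (-(1 / p))) (D * s ^ (-(1 / p))) (decayExp d p) x y →
      ∀ ξ : Space d, ξ ≠ 0 → stateNorm ξ (nonlinState μ ν κ x ξ - nonlinState μ ν κ y ξ) ≤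
        C * (M * D) * ‖ξ‖ ^ ((d : ℝ) + 1 - 2 * decayExp d p) * s ^ (-(2 / p)) := by
  obtain ⟨C, hC, h⟩ := exists_nonlinState_sub_le hd μ ν κ (decayExp_lt hp)
    (lt_two_mul_decayExp hdp)
  refine ⟨C, hC, fun M D s x y hM hD hs H ξ hξ => ?_⟩
  refine (h _ _ x y (by positivity) (by positivity) H ξ hξ).trans (le_of_eq ?_)
  rw [← rpow_neg_inv_mul_self hs]
  ring

lemma rpow_frequency_weight {p : ℝ} {ξ : Space d} (hξ : ξ ≠ 0) :
    ‖ξ‖ ^ ((d : ℝ) + 1 - 2 * decayExp d p) * ‖ξ‖ ^ (-(2 * (1 - 1 / p))) =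
      ‖ξ‖ ^ (-decayExp d p) := by
  rw [← Real.rpow_add (norm_pos_iff.2 hξ)]
  unfold decayExp
  ring_nf

lemma exists_duhamelLipschitz (hd : 0 < d) {μ ν κ α p : ℝ} (hμ : 0 < μ) (hμν : 0 < μ + ν)
    (hκ : 0 < κ) (hα : 0 < α) (hp : 2 < p) (hdp : 0 < (d : ℝ) - 3 + 4 / p) :
    ∃ K > 0, DuhamelLipschitz μ ν κ α p K d := by
  have hp1 : 1 / p < 1 := (div_lt_one (by linarith)).2 (by linarith)
  have hp2 : 2 / p < 1 := (div_lt_one (by linarith)).2 hp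
  have hp0 : 0 < 1 / p := by positivity
  obtain ⟨C, hC, hN⟩ := exists_nonlinState_trajectory_sub_le hd μ ν κ hp hdp
  obtain ⟨C', hC', hD⟩ := exists_duhamel_le (d := d) (b := 1 - 1 / p) (γ := 2 / p) hμ hμν hκ hα
    (by linarith) (by linarith) (by positivity) hp2
  refine ⟨C' * C, by positivity, fun M D Φ Ψ hM hD0 H t ξ ht hξ c1 c2 => ?_⟩
  unfold duhamel
  rw [← intervalIntegral.integral_sub c1 c2]
  simp only [← Matrix.mulVec_sub]
  refine (hD ξ (fun s => nonlinState μ ν κ (Φ s) ξ - nonlinState μ ν κ (Ψ s) ξ) _ t hξ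
    (by positivity) ht fun s hs => hN M D s _ _ hM hD0 hs (H s hs) ξ hξ).trans (le_of_eq ?_)
  rw [← rpow_frequency_weight hξ, show 1 - (1 - 1 / p) - 2 / p = -(1 / p) by ring]
  ring

/-! ### Measurability of the iterates -/

lemma stronglyMeasurable_prodHat {h k : ℝ → Space d → ℂ}
    (hh : StronglyMeasurable (Function.uncurry h)) (hk : StronglyMeasurable (Function.uncurry k)) :
    StronglyMeasurable fun q : ℝ × Space d => prodHat (h q.1) (k q.1) q.2 := by
  have h1 : StronglyMeasurable fun z : (ℝ × Space d) × Space d => h z.1.1 z.2 * k z.1.1 (z.1.2 - z.2) :=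
    (hh.comp_measurable (by fun_prop : Measurable fun z : (ℝ × Space d) × Space d =>
      (z.1.1, z.2))).mul (hk.comp_measurable (by fun_prop :
        Measurable fun z : (ℝ × Space d) × Space d => (z.1.1, z.1.2 - z.2)))
  exact (h1.integral_prod_right' (ν := (volume : Measure (Space d)))).const_mul _

lemma stronglyMeasurable_dHat {h : ℝ → Space d → ℂ} (hh : StronglyMeasurable (Function.uncurry h))
    (k : Fin d) : StronglyMeasurable (Function.uncurry fun s => dHat k (h s)) := by
  have : Continuous fun q : ℝ × Space d => Complex.I * (q.2 k : ℂ) := by fun_prop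
  exact this.stronglyMeasurable.mul hh

lemma stronglyMeasurable_nonlinState (μ ν κ : ℝ) {Φ : ℝ → Space d → Unit ⊕ Fin d → ℂ}
    (hΦ : StronglyMeasurable (Function.uncurry Φ)) :
    StronglyMeasurable fun q : ℝ × Space d => nonlinState μ ν κ (Φ q.1) q.2 := by
  have hc : ∀ i, StronglyMeasurable (Function.uncurry fun s η => Φ s η i) := fun i =>
    (continuous_apply i).comp_stronglyMeasurable hΦ
  have hdc : ∀ i k, StronglyMeasurable (Function.uncurry fun s => dHat k fun η => Φ s η i) :=
    fun i k => stronglyMeasurable_dHat (hc i) k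
  refine Measurable.stronglyMeasurable (measurable_pi_lambda _ ?_)
  rintro (i | j)
  · exact (Finset.measurable_sum _ fun k _ =>
      (stronglyMeasurable_prodHat (hc (Sum.inr k)) (hdc (Sum.inl ()) k)).measurable).neg
  · refine Measurable.add (Measurable.add ?_ (Measurable.add ?_ ?_)) ?_
    · exact (Finset.measurable_sum _ fun k _ =>
        (stronglyMeasurable_prodHat (hc (Sum.inr k)) (hdc (Sum.inr j) k)).measurable).neg
    · exact (Finset.measurable_sum _ fun k _ => (stronglyMeasurable_prodHat (hdc (Sum.inl ()) k)
        (hdc (Sum.inr j) k)).measurable).const_mul _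
    · exact (Finset.measurable_sum _ fun k _ => (stronglyMeasurable_prodHat (hdc (Sum.inl ()) k)
        (hdc (Sum.inr k) j)).measurable).const_mul _
    · have h1 : StronglyMeasurable (Function.uncurry fun (s : ℝ) (η : Space d) =>
          ∑ k, prodHat (dHat k fun η => Φ s η (Sum.inl ())) (dHat k fun η => Φ s η (Sum.inl ())) η) :=
        (Finset.measurable_sum _ fun k _ => (stronglyMeasurable_prodHat (hdc (Sum.inl ()) k)
          (hdc (Sum.inl ()) k)).measurable).stronglyMeasurable
      exact (stronglyMeasurable_dHat h1 j).measurable.const_mul _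

lemma stronglyMeasurable_setIntegral_Ioc {X E : Type*} [MeasurableSpace X] [NormedAddCommGroup E]
    [NormedSpace ℝ E] {G : X × ℝ → E} (hG : StronglyMeasurable G) {f g : X → ℝ} (hf : Measurable f)
    (hg : Measurable g) : StronglyMeasurable fun q : X => ∫ s in Set.Ioc (f q) (g q), G (q, s) := by
  have hS : MeasurableSet {z : X × ℝ | f z.1 < z.2 ∧ z.2 ≤ g z.1} :=
    (measurableSet_lt (hf.comp measurable_fst) measurable_snd).inter
      (measurableSet_le measurable_snd (hg.comp measurable_fst))
  have h1 := (hG.indicator hS).integral_prod_right' (ν := (volume : Measure ℝ))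
  have h2 : (fun q : X => ∫ s in Set.Ioc (f q) (g q), G (q, s)) = fun q =>
      ∫ s, Set.indicator {z : X × ℝ | f z.1 < z.2 ∧ z.2 ≤ g z.1} G (q, s) := by
    funext q
    rw [← integral_indicator measurableSet_Ioc]
    refine integral_congr_ae (Eventually.of_forall fun s => ?_)
    simp only [Set.indicator, Set.mem_Ioc, Set.mem_ofPred_eq]
    congr
  rw [h2]
  exact h1

lemma stronglyMeasurable_duhamel (μ ν κ α : ℝ) {Φ : ℝ → Space d → Unit ⊕ Fin d → ℂ}
    (hΦ : StronglyMeasurable (Function.uncurry Φ)) :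
    StronglyMeasurable (Function.uncurry (duhamel μ ν κ α Φ)) := by
  have hN : StronglyMeasurable fun z : (ℝ × Space d) × ℝ => nonlinState μ ν κ (Φ z.2) z.1.2 := by
    have h := (stronglyMeasurable_nonlinState μ ν κ hΦ).comp_measurable
      (by fun_prop : Measurable fun z : (ℝ × Space d) × ℝ => (z.2, z.1.2))
    exact h
  have hG : StronglyMeasurable fun z : (ℝ × Space d) × ℝ =>
      semigroupSymbol μ ν κ α (z.1.1 - z.2) z.1.2 *ᵥ nonlinState μ ν κ (Φ z.2) z.1.2 :=
    stronglyMeasurable_semigroupSymbol_mulVec μ ν κ α (X := (ℝ × Space d) × ℝ)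
      (f := fun z => z.1.1 - z.2) (g := fun z => z.1.2) (by fun_prop) (by fun_prop) hN
  have h1 := stronglyMeasurable_setIntegral_Ioc hG measurable_const measurable_fst (f := fun _ => 0)
  have h2 := stronglyMeasurable_setIntegral_Ioc hG measurable_fst measurable_const (g := fun _ => 0)
  exact h1.sub h2

/-- A trajectory bounded in the weight `t^{-1/p} |ξ|^{-θ}`, compared with the zero trajectory. -/
lemma statePair_zero {M r : ℝ} {x : Space d → Unit ⊕ Fin d → ℂ} (hM : 0 ≤ M)
    (hx : AEStronglyMeasurable x volume) (hb : ∀ᵐ ξ, stateNorm ξ (x ξ) ≤ M * ‖ξ‖ ^ (-r)) :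
    StatePair M M r x (fun _ => 0) where
  meas := hx
  meas' := aestronglyMeasurable_const
  bound := hb
  bound' := Eventually.of_forall fun ξ => by rw [stateNorm_zero]; positivity
  diff := by simpa using hb

lemma exists_nonlinState_trajectory_le (hd : 0 < d) (μ ν κ : ℝ) {p : ℝ} (hp : 2 < p)
    (hdp : 0 < (d : ℝ) - 3 + 4 / p) :
    ∃ C > 0, ∀ (M s : ℝ) (x : Space d → Unit ⊕ Fin d → ℂ), 0 ≤ M → 0 < s →
      AEStronglyMeasurable x volume →
      (∀ᵐ ξ, stateNorm ξ (x ξ) ≤ M * s ^ (-(1 / p)) * ‖ξ‖ ^ (-decayExp d p)) →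
      ∀ ξ : Space d, ξ ≠ 0 → stateNorm ξ (nonlinState μ ν κ x ξ) ≤
        C * (M * M) * ‖ξ‖ ^ ((d : ℝ) + 1 - 2 * decayExp d p) * s ^ (-(2 / p)) := by
  obtain ⟨C, hC, h⟩ := exists_nonlinState_trajectory_sub_le hd μ ν κ hp hdp
  refine ⟨C, hC, fun M s x hM hs hx hb ξ hξ => ?_⟩
  have := h M M s x (fun _ => 0) hM hM hs (statePair_zero (by positivity) hx hb) ξ hξ
  rwa [nonlinState_zero, sub_zero] at this

lemma stronglyMeasurable_section {Φ : ℝ → Space d → Unit ⊕ Fin d → ℂ}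
    (hΦ : StronglyMeasurable (Function.uncurry Φ)) (s : ℝ) : StronglyMeasurable (Φ s) :=
  hΦ.comp_measurable measurable_prodMk_left

lemma duhamelConverges_of_bound (hd : 0 < d) {μ ν κ α p : ℝ} (hμ : 0 < μ) (hμν : 0 < μ + ν)
    (hκ : 0 < κ) (hα : 0 < α) (hp : 2 < p) (hdp : 0 < (d : ℝ) - 3 + 4 / p) {M : ℝ} (hM : 0 ≤ M)
    {Φ : ℝ → Space d → Unit ⊕ Fin d → ℂ} (hΦ : StronglyMeasurable (Function.uncurry Φ))
    (hb : ∀ s > 0, ∀ᵐ ξ, stateNorm ξ (Φ s ξ) ≤ M * s ^ (-(1 / p)) * ‖ξ‖ ^ (-decayExp d p))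
    {t : ℝ} {ξ : Space d} (ht : 0 < t) (hξ : ξ ≠ 0) : DuhamelConverges μ ν κ α Φ t ξ := by
  have hp1 : 1 / p < 1 := (div_lt_one (by linarith)).2 (by linarith)
  have hp2 : 2 / p < 1 := (div_lt_one (by linarith)).2 hp
  have hp0 : 0 < 1 / p := by positivity
  obtain ⟨C, hC, hN⟩ := exists_nonlinState_trajectory_le hd μ ν κ hp hdp
  have hF : StronglyMeasurable fun s => nonlinState μ ν κ (Φ s) ξ := by
    have h := (stronglyMeasurable_nonlinState μ ν κ hΦ).comp_measurable
      (by fun_prop : Measurable fun s : ℝ => (s, ξ))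
    exact h
  have hFb : ∀ s > 0, stateNorm ξ (nonlinState μ ν κ (Φ s) ξ) ≤
      C * (M * M) * ‖ξ‖ ^ ((d : ℝ) + 1 - 2 * decayExp d p) * s ^ (-(2 / p)) := fun s hs =>
    hN M s (Φ s) hM hs (stronglyMeasurable_section hΦ s).aestronglyMeasurable (hb s hs) ξ hξ
  unfold DuhamelConverges
  exact intervalIntegrable_duhamel (b := 1 - 1 / p) (γ := 2 / p) hμ hμν hκ hα (by linarith)
    (by linarith) (by positivity) hp2 hξ (by positivity) ht hF hFb

/-! ### Existence and uniqueness of the fixed point -/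

/-- The Picard iterates for the initial state `x₀`, starting from zero. -/
def picard (μ ν κ α : ℝ) (x₀ : Space d → Unit ⊕ Fin d → ℂ) :
    ℕ → ℝ → Space d → Unit ⊕ Fin d → ℂ
  | 0 => fun _ _ => 0
  | n + 1 => fun t ξ =>
      semigroupSymbol μ ν κ α t ξ *ᵥ x₀ ξ + duhamel μ ν κ α (picard μ ν κ α x₀ n) t ξ

lemma duhamel_zero (μ ν κ α t : ℝ) (ξ : Space d) :
    duhamel μ ν κ α (fun _ _ => 0) t ξ = 0 := by
  simp [duhamel, nonlinState_zero]

lemma stronglyMeasurable_picard (μ ν κ α : ℝ) {x₀ : Space d → Unit ⊕ Fin d → ℂ}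
    (hx₀ : StronglyMeasurable x₀) (n : ℕ) :
    StronglyMeasurable (Function.uncurry (picard μ ν κ α x₀ n)) := by
  induction n with
  | zero => exact stronglyMeasurable_const
  | succ n ih =>
    exact (stronglyMeasurable_semigroupSymbol_mulVec μ ν κ α measurable_fst measurable_snd
      (hx₀.comp_measurable measurable_snd)).add (stronglyMeasurable_duhamel μ ν κ α ih)

/-- If the free evolution of `x₀` is small, the Picard iterates converge to a solution of the
Duhamel equation. All estimates hold at every `t > 0` and `ξ ≠ 0`. -/
lemma exists_duhamel_fixedPoint (hd : 0 < d) {μ ν κ α p K M : ℝ} (hμ : 0 < μ) (hμν : 0 < μ + ν)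
    (hκ : 0 < κ) (hα : 0 < α) (hp : 2 < p) (hdp : 0 < (d : ℝ) - 3 + 4 / p)
    (hK : DuhamelLipschitz μ ν κ α p K d) (hM : 0 ≤ M) (hKM : K * M ≤ 1 / 2)
    {x₀ : Space d → Unit ⊕ Fin d → ℂ} (hx₀ : StronglyMeasurable x₀)
    (hlin : ∀ (t : ℝ) (ξ : Space d), 0 < t → ξ ≠ 0 →
      stateNorm ξ (semigroupSymbol μ ν κ α t ξ *ᵥ x₀ ξ) ≤
        M / 2 * (t ^ (-(1 / p)) * ‖ξ‖ ^ (-decayExp d p))) :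
    ∃ Φ : ℝ → Space d → Unit ⊕ Fin d → ℂ, StronglyMeasurable (Function.uncurry Φ) ∧
      ∀ (t : ℝ) (ξ : Space d), 0 < t → ξ ≠ 0 →
        stateNorm ξ (Φ t ξ) ≤ M * (t ^ (-(1 / p)) * ‖ξ‖ ^ (-decayExp d p)) ∧
        DuhamelConverges μ ν κ α Φ t ξ ∧
        Φ t ξ = semigroupSymbol μ ν κ α t ξ *ᵥ x₀ ξ + duhamel μ ν κ α Φ t ξ := by
  set P := picard μ ν κ α x₀ with hP
  have hPm := stronglyMeasurable_picard μ ν κ α hx₀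
  set w : ℝ → Space d → ℝ := fun t ξ => t ^ (-(1 / p)) * ‖ξ‖ ^ (-decayExp d p) with hw
  have hw0 : ∀ {t : ℝ} {ξ : Space d}, 0 < t → 0 ≤ w t ξ := fun ht =>
    mul_nonneg (Real.rpow_nonneg ht.le _) (Real.rpow_nonneg (norm_nonneg _) _)
  -- Trajectories bounded everywhere yield the almost everywhere hypotheses of the estimates.
  have hconv : ∀ {Φ : ℝ → Space d → Unit ⊕ Fin d → ℂ},
      StronglyMeasurable (Function.uncurry Φ) →
      (∀ (t : ℝ) (ξ : Space d), 0 < t → ξ ≠ 0 → stateNorm ξ (Φ t ξ) ≤ M * w t ξ) →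
      ∀ (t : ℝ) (ξ : Space d), 0 < t → ξ ≠ 0 → DuhamelConverges μ ν κ α Φ t ξ := by
    intro Φ hΦ hb t ξ ht hξ
    refine duhamelConverges_of_bound hd hμ hμν hκ hα hp hdp hM hΦ (fun s hs => ?_) ht hξ
    filter_upwards [ae_ne_zero hd] with η hη
    rw [mul_assoc]
    exact hb s η hs hη
  have hlip : ∀ {Φ Ψ : ℝ → Space d → Unit ⊕ Fin d → ℂ} {D : ℝ}, 0 ≤ D →
      StronglyMeasurable (Function.uncurry Φ) → StronglyMeasurable (Function.uncurry Ψ) →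
      (∀ (t : ℝ) (ξ : Space d), 0 < t → ξ ≠ 0 → stateNorm ξ (Φ t ξ) ≤ M * w t ξ) →
      (∀ (t : ℝ) (ξ : Space d), 0 < t → ξ ≠ 0 → stateNorm ξ (Ψ t ξ) ≤ M * w t ξ) →
      (∀ (t : ℝ) (ξ : Space d), 0 < t → ξ ≠ 0 → stateNorm ξ (Φ t ξ - Ψ t ξ) ≤ D * w t ξ) →
      ∀ (t : ℝ) (ξ : Space d), 0 < t → ξ ≠ 0 →
        stateNorm ξ (duhamel μ ν κ α Φ t ξ - duhamel μ ν κ α Ψ t ξ) ≤ D / 2 * w t ξ := by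
    intro Φ Ψ D hD hΦ hΨ b1 b2 b3 t ξ ht hξ
    refine (hK M D Φ Ψ hM hD (fun s hs => ?_) t ξ ht hξ (hconv hΦ b1 t ξ ht hξ)
      (hconv hΨ b2 t ξ ht hξ)).trans ?_
    · refine ⟨(stronglyMeasurable_section hΦ s).aestronglyMeasurable,
        (stronglyMeasurable_section hΨ s).aestronglyMeasurable, ?_, ?_, ?_⟩ <;>
      filter_upwards [ae_ne_zero hd] with η hη <;> rw [mul_assoc]
      · exact b1 s η hs hη
      · exact b2 s η hs hη
      · exact b3 s η hs hη
    · have := mul_le_mul_of_nonneg_right hKM (mul_nonneg hD (hw0 (ξ := ξ) ht))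
      calc _ = K * M * (D * w t ξ) := by rw [hw]; ring
        _ ≤ 1 / 2 * (D * w t ξ) := this
        _ = _ := by ring
  have hzero : ∀ (t : ℝ) (ξ : Space d), 0 < t → ξ ≠ 0 →
      stateNorm ξ ((fun _ _ => 0 : ℝ → Space d → Unit ⊕ Fin d → ℂ) t ξ) ≤ M * w t ξ :=
    fun t ξ ht _ => by rw [stateNorm_zero]; exact mul_nonneg hM (hw0 ht)
  have hbound : ∀ (n : ℕ) (t : ℝ) (ξ : Space d), 0 < t → ξ ≠ 0 →
      stateNorm ξ (P n t ξ) ≤ M * w t ξ := by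
    intro n
    induction n with
    | zero => exact hzero
    | succ n ih =>
      intro t ξ ht hξ
      have h1 := hlip hM (hPm n) stronglyMeasurable_const ih hzero
        (fun t ξ ht hξ => by simpa using ih t ξ ht hξ) t ξ ht hξ
      rw [duhamel_zero, sub_zero] at h1
      refine (stateNorm_add_le _ _ _).trans ((add_le_add (hlin t ξ ht hξ) h1).trans (le_of_eq ?_))
      rw [hw]; ring
  have hdiff : ∀ (n : ℕ) (t : ℝ) (ξ : Space d), 0 < t → ξ ≠ 0 →
      stateNorm ξ (P n t ξ - P (n + 1) t ξ) ≤ M * (1 / 2) ^ n * w t ξ := by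
    intro n
    induction n with
    | zero =>
      intro t ξ ht hξ
      have : P 0 t ξ = 0 := rfl
      rw [stateNorm_sub_comm, this, sub_zero, pow_zero, mul_one]
      exact hbound 1 t ξ ht hξ
    | succ n ih =>
      intro t ξ ht hξ
      have h1 := hlip (by positivity) (hPm n) (hPm (n + 1)) (hbound n) (hbound (n + 1)) ih t ξ ht hξ
      have h2 : P (n + 1) t ξ - P (n + 1 + 1) t ξ =
          duhamel μ ν κ α (P n) t ξ - duhamel μ ν κ α (P (n + 1)) t ξ :=
        add_sub_add_left_eq_sub _ _ _
      rw [h2]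
      refine h1.trans (le_of_eq ?_)
      ring
  have hlim : ∀ (t : ℝ) (ξ : Space d), 0 < t → ξ ≠ 0 →
      ∃ y, Tendsto (fun n => P n t ξ) atTop (𝓝 y) := by
    intro t ξ ht hξ
    refine cauchySeq_tendsto_of_complete (cauchySeq_of_le_geometric (1 / 2) (M * w t ξ)
      (by norm_num) fun n => ?_)
    rw [dist_eq_norm]
    refine (norm_le_stateNorm ξ _).trans ((hdiff n t ξ ht hξ).trans (le_of_eq ?_))
    ring
  classical
  choose! L hL using hlim
  -- Nothing is known about the iterates for `t ≤ 0` or `ξ = 0`; the limit is set to zero there,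
  -- which keeps it jointly measurable.
  set Φ : ℝ → Space d → Unit ⊕ Fin d → ℂ := fun t ξ => if 0 < t ∧ ξ ≠ 0 then L t ξ else 0 with hΦ
  have hΦt : ∀ (t : ℝ) (ξ : Space d), 0 < t → ξ ≠ 0 →
      Tendsto (fun n => P n t ξ) atTop (𝓝 (Φ t ξ)) := by
    intro t ξ ht hξ
    simp only [hΦ, ht, hξ, ne_eq, not_false_eq_true, and_self, if_true]
    exact hL t ξ ht hξ
  have hΦm : StronglyMeasurable (Function.uncurry Φ) := by
    have hS : MeasurableSet {q : ℝ × Space d | 0 < q.1 ∧ q.2 ≠ 0} :=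
      (measurableSet_lt measurable_const measurable_fst).inter
        (measurable_snd (measurableSet_singleton 0)).compl
    refine stronglyMeasurable_of_tendsto atTop (fun n => (hPm n).indicator hS)
      (tendsto_pi_nhds.2 fun q => ?_)
    by_cases hq : 0 < q.1 ∧ q.2 ≠ 0
    · simp only [Set.indicator, Set.mem_ofPred_eq, hq, and_self, if_true, ne_eq, not_false_eq_true]
      exact hΦt q.1 q.2 hq.1 hq.2
    · simp only [Set.indicator, Set.mem_ofPred_eq, hq, if_false, Function.uncurry, hΦ]
      exact tendsto_const_nhds
  have hscale : ∀ (t : ℝ) (ξ : Space d), 0 < t → ξ ≠ 0 →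
      Tendsto (fun n => stateScale ξ (P n t ξ)) atTop (𝓝 (stateScale ξ (Φ t ξ))) :=
    fun t ξ ht hξ => ((stateScale ξ).continuous.tendsto _).comp (hΦt t ξ ht hξ)
  have hΦb : ∀ (t : ℝ) (ξ : Space d), 0 < t → ξ ≠ 0 → stateNorm ξ (Φ t ξ) ≤ M * w t ξ :=
    fun t ξ ht hξ => le_of_tendsto (hscale t ξ ht hξ).norm
      (Eventually.of_forall fun n => hbound n t ξ ht hξ)
  have hrate : ∀ (n : ℕ) (t : ℝ) (ξ : Space d), 0 < t → ξ ≠ 0 →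
      stateNorm ξ (P n t ξ - Φ t ξ) ≤ 2 * M * (1 / 2) ^ n * w t ξ := by
    intro n t ξ ht hξ
    have := dist_le_of_le_geometric_of_tendsto (1 / 2) (M * w t ξ) (by norm_num) (fun n => by
      rw [dist_eq_norm, ← map_sub]
      exact (hdiff n t ξ ht hξ).trans (le_of_eq (by ring))) (hscale t ξ ht hξ) n
    rw [dist_eq_norm, ← map_sub] at this
    exact this.trans (le_of_eq (by ring))
  refine ⟨Φ, hΦm, fun t ξ ht hξ => ⟨hΦb t ξ ht hξ, hconv hΦm hΦb t ξ ht hξ, ?_⟩⟩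
  have hsmall : ∀ n : ℕ, stateNorm ξ (Φ t ξ -
      (semigroupSymbol μ ν κ α t ξ *ᵥ x₀ ξ + duhamel μ ν κ α Φ t ξ)) ≤
      2 * M * w t ξ * (1 / 2) ^ n := by
    intro n
    refine (stateNorm_sub_le_sub_add_sub ξ _ (P (n + 1) t ξ) _).trans ?_
    have h1 := hrate (n + 1) t ξ ht hξ
    have h2 := hlip (by positivity) (hPm n) hΦm (hbound n) hΦb (hrate n) t ξ ht hξ
    rw [stateNorm_sub_comm]
    have h3 : P (n + 1) t ξ - (semigroupSymbol μ ν κ α t ξ *ᵥ x₀ ξ + duhamel μ ν κ α Φ t ξ) =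
        duhamel μ ν κ α (P n) t ξ - duhamel μ ν κ α Φ t ξ := add_sub_add_left_eq_sub _ _ _
    rw [h3]
    refine (add_le_add h1 h2).trans (le_of_eq ?_)
    ring
  have hlim0 : Tendsto (fun n : ℕ => 2 * M * w t ξ * (1 / 2) ^ n) atTop (𝓝 0) := by
    simpa using (tendsto_pow_atTop_nhds_zero_of_lt_one (by norm_num : (0 : ℝ) ≤ 1 / 2)
      (by norm_num)).const_mul (2 * M * w t ξ)
  have h0 := ge_of_tendsto' hlim0 hsmall
  exact sub_eq_zero.1 (norm_le_zero_iff.1 ((norm_le_stateNorm ξ _).trans h0))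

/-- Two solutions of the Duhamel equation in the ball of radius `M` coincide: their difference is
halved arbitrarily often. -/
lemma ae_eq_of_duhamel_fixedPoint (hd : 0 < d) {μ ν κ α p K M : ℝ}
    (hK : DuhamelLipschitz μ ν κ α p K d) (hM : 0 ≤ M) (hKM : K * M ≤ 1 / 2)
    {x₀ : Space d → Unit ⊕ Fin d → ℂ} {Φ Ψ : ℝ → Space d → Unit ⊕ Fin d → ℂ}
    (hΦm : ∀ s > 0, AEStronglyMeasurable (Φ s) volume)
    (hΨm : ∀ s > 0, AEStronglyMeasurable (Ψ s) volume)
    (hΦb : ∀ s > 0, ∀ᵐ ξ, stateNorm ξ (Φ s ξ) ≤ M * s ^ (-(1 / p)) * ‖ξ‖ ^ (-decayExp d p))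
    (hΨb : ∀ s > 0, ∀ᵐ ξ, stateNorm ξ (Ψ s ξ) ≤ M * s ^ (-(1 / p)) * ‖ξ‖ ^ (-decayExp d p))
    (hΦ : ∀ t > 0, ∀ᵐ ξ, DuhamelConverges μ ν κ α Φ t ξ ∧
      Φ t ξ = semigroupSymbol μ ν κ α t ξ *ᵥ x₀ ξ + duhamel μ ν κ α Φ t ξ)
    (hΨ : ∀ t > 0, ∀ᵐ ξ, DuhamelConverges μ ν κ α Ψ t ξ ∧
      Ψ t ξ = semigroupSymbol μ ν κ α t ξ *ᵥ x₀ ξ + duhamel μ ν κ α Ψ t ξ) {t : ℝ} (ht : 0 < t) :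
    ∀ᵐ ξ, Φ t ξ = Ψ t ξ := by
  have key : ∀ n : ℕ, ∀ s > 0, ∀ᵐ ξ, stateNorm ξ (Φ s ξ - Ψ s ξ) ≤
      2 * M * (1 / 2) ^ n * s ^ (-(1 / p)) * ‖ξ‖ ^ (-decayExp d p) := by
    intro n
    induction n with
    | zero =>
      intro s hs
      filter_upwards [hΦb s hs, hΨb s hs] with ξ h1 h2
      refine (stateNorm_sub_le _ _ _).trans ((add_le_add h1 h2).trans (le_of_eq ?_))
      ring
    | succ n ih =>
      intro s hs
      filter_upwards [hΦ s hs, hΨ s hs, ae_ne_zero hd] with ξ h1 h2 hξ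
      rw [h1.2, h2.2, add_sub_add_left_eq_sub]
      refine (hK M (2 * M * (1 / 2) ^ n) Φ Ψ hM (by positivity) (fun τ hτ =>
        ⟨hΦm τ hτ, hΨm τ hτ, hΦb τ hτ, hΨb τ hτ, ih τ hτ⟩) s ξ hs hξ h1.1 h2.1).trans ?_
      have hn : 0 ≤ 2 * M * (1 / 2) ^ n * s ^ (-(1 / p)) * ‖ξ‖ ^ (-decayExp d p) := by positivity
      calc _ = K * M * (2 * M * (1 / 2) ^ n * s ^ (-(1 / p)) * ‖ξ‖ ^ (-decayExp d p)) := by ring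
        _ ≤ 1 / 2 * (2 * M * (1 / 2) ^ n * s ^ (-(1 / p)) * ‖ξ‖ ^ (-decayExp d p)) := by gcongr
        _ = _ := by ring
  filter_upwards [ae_all_iff.2 fun n => key n t ht] with ξ hξ
  have hlim0 : Tendsto (fun n : ℕ => 2 * M * (1 / 2) ^ n * t ^ (-(1 / p)) * ‖ξ‖ ^ (-decayExp d p))
      atTop (𝓝 0) := by
    simpa using (((tendsto_pow_atTop_nhds_zero_of_lt_one (by norm_num : (0 : ℝ) ≤ 1 / 2)
      (by norm_num)).const_mul (2 * M)).mul_const (t ^ (-(1 / p)))).mul_const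
        (‖ξ‖ ^ (-decayExp d p))
  have h0 := ge_of_tendsto' hlim0 hξ
  exact sub_eq_zero.1 (norm_le_zero_iff.1 ((norm_le_stateNorm ξ _).trans h0))

/-! ### Continuity in time -/

/-- A solution of the Duhamel equation has a modulus of continuity in time, uniformly in the
frequency with respect to the weight `|ξ|^{-θ}` and locally uniformly in `t > 0`. -/
lemma exists_modulus_of_fixedPoint (hd : 0 < d) {μ ν κ α p M M₀ : ℝ} (hμ : 0 < μ) (hμν : 0 < μ + ν)
    (hκ : 0 < κ) (hα : 0 < α) (hp : 2 < p) (hdp : 0 < (d : ℝ) - 3 + 4 / p) (hM : 0 ≤ M)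
    (hM₀ : 0 ≤ M₀) {x₀ : Space d → Unit ⊕ Fin d → ℂ}
    (hx₀ : ∀ ξ, stateNorm ξ (x₀ ξ) ≤ M₀ * ‖ξ‖ ^ (-((d : ℝ) - 1)))
    {Φ : ℝ → Space d → Unit ⊕ Fin d → ℂ} (hΦm : StronglyMeasurable (Function.uncurry Φ))
    (hΦ : ∀ (t : ℝ) (ξ : Space d), 0 < t → ξ ≠ 0 →
      stateNorm ξ (Φ t ξ) ≤ M * (t ^ (-(1 / p)) * ‖ξ‖ ^ (-decayExp d p)) ∧
        Φ t ξ = semigroupSymbol μ ν κ α t ξ *ᵥ x₀ ξ + duhamel μ ν κ α Φ t ξ) :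
    ∃ ω : ℝ → ℝ → ℝ, (∀ t > 0, ∀ h ≥ 0, 0 ≤ ω t h) ∧
      (∀ t > 0, Tendsto (fun s => ω (min s t) |s - t|) (𝓝 t) (𝓝 0)) ∧
      ∀ t > 0, ∀ h ≥ 0, ∀ ξ : Space d, ξ ≠ 0 →
        stateNorm ξ (Φ (t + h) ξ - Φ t ξ) ≤ ω t h * ‖ξ‖ ^ (-decayExp d p) := by
  have hp1 : 1 / p < 1 / 2 := one_div_lt_one_div_of_lt (by norm_num) hp
  have hp2 : 2 / p < 1 := (div_lt_one (by linarith)).2 hp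
  have hp0 : 0 < 1 / p := by positivity
  set ε := 1 / p / 2 with hε
  have hε0 : 0 < ε := by positivity
  obtain ⟨C₁, hC₁, hL⟩ := exists_stateNorm_semigroup_sub_le (d := d) (β := 1 / p) hμ hμν hκ hα
    hp0.le hε0 (by linarith)
  obtain ⟨C₂, hC₂, hN⟩ := exists_nonlinState_trajectory_le hd μ ν κ hp hdp
  obtain ⟨C₃, hC₃, hD⟩ := exists_duhamel_sub_le (d := d) (b := 1 - 1 / p) (γ := 2 / p) hμ hμν hκ hα
    (by linarith) (by positivity) hp2 hε0 (by linarith)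
  refine ⟨fun t h => C₁ * M₀ * (h ^ ε * (t ^ (-(1 / p + ε)) + t ^ (-(1 / p + ε / 2)))) +
    C₃ * (C₂ * (M * M)) * (h ^ ε * (t ^ (1 - (1 - 1 / p + ε) - 2 / p) +
      t ^ (1 - (1 - 1 / p + ε / 2) - 2 / p)) + t ^ (-(2 / p)) * h ^ (1 - (1 - 1 / p))),
    fun t ht h hh => ?_, fun t ht => ?_, fun t ht h hh ξ hξ => ?_⟩
  · have := Real.rpow_nonneg hh ε
    have := Real.rpow_nonneg hh (1 - (1 - 1 / p))
    positivity
  · have hmin : ∀ e : ℝ, ContinuousAt (fun s : ℝ => (min s t) ^ e) t := fun e =>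
      (by fun_prop : ContinuousAt (fun s : ℝ => min s t) t).rpow_const
        (Or.inl (by simpa using ht.ne'))
    have habs : ∀ e : ℝ, 0 < e → Tendsto (fun s : ℝ => |s - t| ^ e) (𝓝 t) (𝓝 0) := by
      intro e he
      have h1 : ContinuousAt (fun s : ℝ => |s - t| ^ e) t :=
        (by fun_prop : ContinuousAt (fun s : ℝ => |s - t|) t).rpow_const (Or.inr he.le)
      simpa [ContinuousAt, Real.zero_rpow he.ne'] using h1
    have t1 := ((habs ε hε0).mul ((hmin (-(1 / p + ε))).tendsto.add
      (hmin (-(1 / p + ε / 2))).tendsto)).const_mul (C₁ * M₀)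
    have t2 := (((habs ε hε0).mul ((hmin (1 - (1 - 1 / p + ε) - 2 / p)).tendsto.add
      (hmin (1 - (1 - 1 / p + ε / 2) - 2 / p)).tendsto)).add
      ((hmin (-(2 / p))).tendsto.mul (habs (1 - (1 - 1 / p)) (by linarith)))).const_mul
        (C₃ * (C₂ * (M * M)))
    simpa using t1.add t2
  · rw [(hΦ (t + h) ξ (by linarith) hξ).2, (hΦ t ξ ht hξ).2, add_sub_add_comm]
    refine (stateNorm_add_le _ _ _).trans ?_
    have hF : StronglyMeasurable fun s => nonlinState μ ν κ (Φ s) ξ := by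
      have h := (stronglyMeasurable_nonlinState μ ν κ hΦm).comp_measurable
        (by fun_prop : Measurable fun s : ℝ => (s, ξ))
      exact h
    have hFb : ∀ s > 0, stateNorm ξ (nonlinState μ ν κ (Φ s) ξ) ≤
        C₂ * (M * M) * ‖ξ‖ ^ ((d : ℝ) + 1 - 2 * decayExp d p) * s ^ (-(2 / p)) := by
      intro s hs
      refine hN M s (Φ s) hM hs (stronglyMeasurable_section hΦm s).aestronglyMeasurable ?_ ξ hξ
      filter_upwards [ae_ne_zero hd] with η hη
      rw [mul_assoc]
      exact (hΦ s η hs hη).1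
    have e1 := hD ξ _ _ t h hξ (by positivity) ht hh hF hFb
    have e2 := hL ξ (x₀ ξ) t h ht hh hξ
    have hhε := Real.rpow_nonneg hh ε
    have hw : ‖ξ‖ ^ (-(2 * (1 / p))) * ‖ξ‖ ^ (-((d : ℝ) - 1)) = ‖ξ‖ ^ (-decayExp d p) := by
      rw [← Real.rpow_add (norm_pos_iff.2 hξ)]
      unfold decayExp
      ring_nf
    have e3 := e2.trans (mul_le_mul_of_nonneg_left (hx₀ ξ) (by positivity))
    refine (add_le_add e3 e1).trans (le_of_eq ?_)
    linear_combination
      C₁ * M₀ * (h ^ ε * (t ^ (-(1 / p + ε)) + t ^ (-(1 / p + ε / 2)))) * hw +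
      C₃ * (C₂ * (M * M)) * (h ^ ε * (t ^ (1 - (1 - 1 / p + ε) - 2 / p) +
        t ^ (1 - (1 - 1 / p + ε / 2) - 2 / p)) + t ^ (-(2 / p)) * h ^ (1 - (1 - 1 / p))) *
          rpow_frequency_weight (p := p) hξ

/-! ### Passage between trajectories of functions and of distributions -/

lemma prodHat_congr_ae {h h' k k' : Space d → ℂ} (hh : h =ᵐ[volume] h') (hk : k =ᵐ[volume] k') :
    prodHat h k = prodHat h' k' := by
  funext ξ
  unfold prodHat convolution
  congr 1
  refine integral_congr_ae ?_
  filter_upwards [hh, ae_sub_left hk ξ] with η h1 h2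
  rw [h1, h2]

/-- The nonlinear term is defined pointwise although its argument is defined almost everywhere. -/
lemma nonlinState_congr_ae (μ ν κ : ℝ) {x y : Space d → Unit ⊕ Fin d → ℂ} (h : x =ᵐ[volume] y) :
    nonlinState μ ν κ x = nonlinState μ ν κ y := by
  have hc : ∀ i, (fun η => x η i) =ᵐ[volume] fun η => y η i := fun i =>
    h.mono fun η hη => congrFun hη i
  have hdc : ∀ k i, (dHat k fun η => x η i) =ᵐ[volume] dHat k fun η => y η i := fun k i =>
    (hc i).mono fun η hη => by simp only [dHat, hη]
  have h1 := fun i j k => prodHat_congr_ae (hc i) (hdc k j)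
  have h2 := fun i j k l => prodHat_congr_ae (hdc k i) (hdc l j)
  funext ξ i
  rcases i with i | j <;> simp only [nonlinState, Sum.elim_inl, Sum.elim_inr, fHat, g₁Hat, g₂Hat,
    g₃Hat, h1, h2]

lemma exists_measurable_representative {x : Space d → Unit ⊕ Fin d → ℂ}
    (hx : AEStronglyMeasurable x volume) {M r : ℝ} (hM : 0 ≤ M)
    (hb : ∀ᵐ ξ, stateNorm ξ (x ξ) ≤ M * ‖ξ‖ ^ (-r)) :
    ∃ y : Space d → Unit ⊕ Fin d → ℂ, StronglyMeasurable y ∧ x =ᵐ[volume] y ∧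
      ∀ ξ, stateNorm ξ (y ξ) ≤ M * ‖ξ‖ ^ (-r) := by
  have hm := hx.stronglyMeasurable_mk
  set S : Set (Space d) := {ξ | stateNorm ξ (hx.mk x ξ) ≤ M * ‖ξ‖ ^ (-r)} with hS
  have hNm : Measurable fun ξ => stateNorm ξ (hx.mk x ξ) := by
    have h := continuous_stateNorm.measurable.comp (measurable_id.prodMk hm.measurable)
    exact h
  have hSm : MeasurableSet S := measurableSet_le hNm (by fun_prop)
  refine ⟨S.indicator (hx.mk x), hm.indicator hSm, ?_, fun ξ => ?_⟩
  · filter_upwards [hx.ae_eq_mk, hb] with ξ h1 h2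
    rw [Set.indicator_of_mem (by rw [hS, Set.mem_ofPred_eq, ← h1]; exact h2), h1]
  · by_cases hξ : ξ ∈ S
    · rw [Set.indicator_of_mem hξ]
      exact hξ
    · rw [Set.indicator_of_notMem hξ, stateNorm_zero]
      positivity

lemma exists_distr_of_stateNorm_le (hd : 0 < d) {x : Space d → Unit ⊕ Fin d → ℂ}
    (hx : AEStronglyMeasurable x volume) {M r : ℝ} (hr0 : 0 ≤ r) (hr : r < d)
    (hb : ∀ᵐ ξ, stateNorm ξ (x ξ) ≤ M * ‖ξ‖ ^ (-r)) :
    ∃ (a : Distr d) (u : Fin d → Distr d), HasFourierFunction a ∧ (∀ j, HasFourierFunction (u j)) ∧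
      stateHat a u =ᵐ[volume] x := by
  have h : ∀ i, ∃ g : Distr d, IsFourierFunction g fun ξ => x ξ i := fun i =>
    exists_isFourierFunction hd hr0 hr (aestronglyMeasurable_apply hx i)
      (hb.mono fun ξ hξ => ((norm_le_pi_norm _ i).trans (norm_le_stateNorm ξ _)).trans hξ)
  choose g hg using h
  refine ⟨g (Sum.inl ()), fun j => g (Sum.inr j), ⟨_, hg _⟩, fun j => ⟨_, hg _⟩, ?_⟩
  have h2 : ∀ᵐ ξ, ∀ i, hat (g i) ξ = x ξ i := ae_all_iff.2 fun i => (hg i).hat_ae_eq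
  filter_upwards [h2] with ξ hξ
  funext i
  rcases i with i | j
  · exact hξ (Sum.inl ())
  · exact hξ (Sum.inr j)

lemma katoNorm_le {p r M : ℝ} {g : ℝ → ι → Distr d}
    (h : ∀ t > 0, pmNorm (r + 2 / p) (g t) ≤ ENNReal.ofReal (M * t ^ (-(1 / p)))) :
    katoNorm p r g ≤ ENNReal.ofReal M := by
  refine iSup_le fun ⟨t, ht⟩ => ?_
  have ht' : (0 : ℝ) < t := ht
  refine (mul_le_mul_right (h t ht) _).trans (le_of_eq ?_)
  rw [← ENNReal.ofReal_mul (by positivity), mul_left_comm, ← Real.rpow_add ht']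
  simp

lemma pmNorm_le_of_katoNorm_le {p r M : ℝ} {g : ℝ → ι → Distr d}
    (h : katoNorm p r g ≤ ENNReal.ofReal M) {t : ℝ} (ht : 0 < t) :
    pmNorm (r + 2 / p) (g t) ≤ ENNReal.ofReal (M * t ^ (-(1 / p))) := by
  have h1 : ENNReal.ofReal (t ^ (1 / p)) * pmNorm (r + 2 / p) (g t) ≤ ENNReal.ofReal M :=
    (le_iSup (fun t : Set.Ioi (0 : ℝ) => ENNReal.ofReal ((t : ℝ) ^ (1 / p)) *
      pmNorm (r + 2 / p) (g t)) ⟨t, ht⟩).trans h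
  have h2 := mul_le_mul_right h1 (ENNReal.ofReal (t ^ (-(1 / p))))
  rwa [← mul_assoc, ← ENNReal.ofReal_mul (by positivity), ← Real.rpow_add ht, neg_add_cancel,
    Real.rpow_zero, ENNReal.ofReal_one, one_mul, ← ENNReal.ofReal_mul (by positivity),
    mul_comm (t ^ (-(1 / p)))] at h2

lemma decayExp_add_one (p : ℝ) : decayExp d p + 1 = (d : ℝ) + 2 / p := by
  unfold decayExp; ring

lemma MemX.hasFourierFunction {p : ℝ} {a : ℝ → Distr d} {u : ℝ → Fin d → Distr d}
    (h : MemX p a u) {t : ℝ} (ht : 0 < t) :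
    HasFourierFunction (a t) ∧ ∀ j, HasFourierFunction (u t j) :=
  ⟨(h.1.1 t ht).1 (), (h.2.2.1 t ht).1⟩

/-- The bound of `X_∞` in terms of the weighted norm of states. -/
lemma stateNorm_le_of_xNorm_le (hd : 0 < d) {p R : ℝ} (hR : 0 ≤ R) {a : ℝ → Distr d}
    {u : ℝ → Fin d → Distr d} (h : xNorm p a u ≤ ENNReal.ofReal R) {t : ℝ} (ht : 0 < t) :
    ∀ᵐ ξ, stateNorm ξ (stateHat (a t) (u t) ξ) ≤
      2 * R * t ^ (-(1 / p)) * ‖ξ‖ ^ (-decayExp d p) := by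
  have h1 := pmNorm_le_of_katoNorm_le (((le_max_left _ _).trans le_self_add).trans h) ht
  have h2 := pmNorm_le_of_katoNorm_le (((le_max_right _ _).trans le_self_add).trans h) ht
  have h3 := pmNorm_le_of_katoNorm_le (le_add_self.trans h) ht
  rw [← decayExp_add_one] at h2
  have := stateNorm_le_of_pmNorm_le (r := decayExp d p) hd (by positivity) h1 h2 h3
  simpa only [mul_assoc] using this

lemma memX_and_xNorm_le (hd : 0 < d) {p M : ℝ} (hM : 0 ≤ M) {a : ℝ → Distr d}
    {u : ℝ → Fin d → Distr d} (hF : ∀ t > 0, HasFourierFunction (a t) ∧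
      ∀ j, HasFourierFunction (u t j))
    (hb : ∀ t > 0, ∀ᵐ ξ, stateNorm ξ (stateHat (a t) (u t) ξ) ≤
      M * t ^ (-(1 / p)) * ‖ξ‖ ^ (-decayExp d p))
    {ω : ℝ → ℝ → ℝ} (hω0 : ∀ t > 0, ∀ h ≥ 0, 0 ≤ ω t h)
    (hω : ∀ t > 0, Tendsto (fun s => ω (min s t) |s - t|) (𝓝 t) (𝓝 0))
    (hcont : ∀ t > 0, ∀ h ≥ 0, ∀ᵐ ξ, stateNorm ξ (stateHat (a (t + h)) (u (t + h)) ξ -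
      stateHat (a t) (u t) ξ) ≤ ω t h * ‖ξ‖ ^ (-decayExp d p)) :
    MemX p a u ∧ xNorm p a u ≤ ENNReal.ofReal ((1 + d) * M) := by
  have hpm : ∀ t > 0, pmNorm (decayExp d p) (scalar (a t)) ≤ ENNReal.ofReal (M * t ^ (-(1 / p))) ∧
      pmNorm (decayExp d p + 1) (scalar (a t)) ≤ ENNReal.ofReal (M * t ^ (-(1 / p))) ∧
      pmNorm (decayExp d p) (u t) ≤ ENNReal.ofReal (d * (M * t ^ (-(1 / p)))) := fun t ht =>
    pmNorm_le_of_stateNorm_le hd (by positivity) (hb t ht)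
  simp only [decayExp_add_one] at hpm
  have k1 : katoNorm p ((d : ℝ) - 1) (fun t => scalar (a t)) ≤ ENNReal.ofReal M :=
    katoNorm_le fun t ht => (hpm t ht).1
  have k2 : katoNorm p (d : ℝ) (fun t => scalar (a t)) ≤ ENNReal.ofReal M :=
    katoNorm_le fun t ht => (hpm t ht).2.1
  have k3 : katoNorm p ((d : ℝ) - 1) u ≤ ENNReal.ofReal (d * M) :=
    katoNorm_le fun t ht => (hpm t ht).2.2.trans (le_of_eq (by rw [mul_assoc]))
  have hdiff : ∀ t > 0, ∀ s > 0, ∀ᵐ ξ, stateNorm ξ (stateHat (a s - a t) (u s - u t) ξ) ≤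
      ω (min s t) |s - t| * ‖ξ‖ ^ (-decayExp d p) := by
    intro t ht s hs
    have hsub := stateHat_sub_ae_eq (hF s hs).1 (hF t ht).1 (hF s hs).2 (hF t ht).2
    rcases le_total t s with h | h
    · have := hcont t ht (s - t) (sub_nonneg.2 h)
      rw [add_sub_cancel] at this
      filter_upwards [this, hsub] with ξ h1 h2
      rwa [h2, min_eq_right h, abs_of_nonneg (sub_nonneg.2 h)]
    · have := hcont s hs (t - s) (sub_nonneg.2 h)
      rw [add_sub_cancel] at this
      filter_upwards [this, hsub] with ξ h1 h2
      rwa [h2, min_eq_left h, abs_sub_comm, abs_of_nonneg (sub_nonneg.2 h), stateNorm_sub_comm]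
  have hdpm : ∀ t > 0, ∀ s > 0,
      pmNorm (decayExp d p) (scalar (a s - a t)) ≤ ENNReal.ofReal (ω (min s t) |s - t|) ∧
      pmNorm (decayExp d p + 1) (scalar (a s - a t)) ≤ ENNReal.ofReal (ω (min s t) |s - t|) ∧
      pmNorm (decayExp d p) (u s - u t) ≤ ENNReal.ofReal (d * ω (min s t) |s - t|) :=
    fun t ht s hs => pmNorm_le_of_stateNorm_le hd (hω0 _ (lt_min hs ht) _ (abs_nonneg _))
      (hdiff t ht s hs)
  simp only [decayExp_add_one] at hdpm
  have hlim : ∀ c : ℝ, ∀ t > 0, Tendsto (fun s => ENNReal.ofReal (c * ω (min s t) |s - t|)) (𝓝 t)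
      (𝓝 0) := by
    intro c t ht
    simpa using ENNReal.tendsto_ofReal ((hω t ht).const_mul c)
  have hlim1 : ∀ t > 0, Tendsto (fun s => ENNReal.ofReal (ω (min s t) |s - t|)) (𝓝 t) (𝓝 0) :=
    fun t ht => by simpa using hlim 1 t ht
  refine ⟨⟨⟨fun t ht => ⟨fun _ => (hF t ht).1, ?_⟩, fun t ht => ?_, ?_⟩,
    ⟨fun t ht => ⟨fun _ => (hF t ht).1, ?_⟩, fun t ht => ?_, ?_⟩,
    ⟨fun t ht => ⟨(hF t ht).2, ?_⟩, fun t ht => ?_, ?_⟩⟩, ?_⟩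
  · exact (hpm t ht).1.trans_lt ENNReal.ofReal_lt_top
  · exact tendsto_of_tendsto_of_tendsto_of_le_of_le' tendsto_const_nhds (hlim1 t ht)
      (Eventually.of_forall fun _ => zero_le)
      ((eventually_gt_nhds ht).mono fun s hs => (hdpm t ht s hs).1)
  · exact k1.trans_lt ENNReal.ofReal_lt_top
  · exact (hpm t ht).2.1.trans_lt ENNReal.ofReal_lt_top
  · exact tendsto_of_tendsto_of_tendsto_of_le_of_le' tendsto_const_nhds (hlim1 t ht)
      (Eventually.of_forall fun _ => zero_le)
      ((eventually_gt_nhds ht).mono fun s hs => (hdpm t ht s hs).2.1)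
  · exact k2.trans_lt ENNReal.ofReal_lt_top
  · exact (hpm t ht).2.2.trans_lt ENNReal.ofReal_lt_top
  · exact tendsto_of_tendsto_of_tendsto_of_le_of_le' tendsto_const_nhds (hlim d t ht)
      (Eventually.of_forall fun _ => zero_le)
      ((eventually_gt_nhds ht).mono fun s hs => (hdpm t ht s hs).2.2)
  · exact k3.trans_lt ENNReal.ofReal_lt_top
  · refine (add_le_add (max_le k1 k2) k3).trans (le_of_eq ?_)
    rw [← ENNReal.ofReal_add hM (by positivity)]
    congr 1
    ring

/-- A mild solution, read off from its Fourier transform. -/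
lemma IsMildSolution.duhamel_eq {μ ν κ α : ℝ} {a₀ : Distr d} {u₀ : Fin d → Distr d}
    {a : ℝ → Distr d} {u : ℝ → Fin d → Distr d} (h : IsMildSolution μ ν κ α a₀ u₀ a u) :
    ∀ t > 0, ∀ᵐ ξ, DuhamelConverges μ ν κ α (fun s => stateHat (a s) (u s)) t ξ ∧
      stateHat (a t) (u t) ξ = semigroupSymbol μ ν κ α t ξ *ᵥ stateHat a₀ u₀ ξ +
        duhamel μ ν κ α (fun s => stateHat (a s) (u s)) t ξ := h.2

lemma isMildSolution_of_fixedPoint (hd : 0 < d) {μ ν κ α p M : ℝ} (hp : 2 < p)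
    (hdp : 0 < (d : ℝ) - 3 + 4 / p) (hM : 0 ≤ M) {a₀ : Distr d} {u₀ : Fin d → Distr d}
    {a : ℝ → Distr d} {u : ℝ → Fin d → Distr d} {x₀ : Space d → Unit ⊕ Fin d → ℂ}
    (hx₀ : stateHat a₀ u₀ =ᵐ[volume] x₀) {Φ : ℝ → Space d → Unit ⊕ Fin d → ℂ}
    (hF : ∀ t > 0, HasFourierFunction (a t) ∧ ∀ j, HasFourierFunction (u t j))
    (hΦ : ∀ t > 0, stateHat (a t) (u t) =ᵐ[volume] Φ t)
    (hb : ∀ t > 0, ∀ᵐ ξ, stateNorm ξ (stateHat (a t) (u t) ξ) ≤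
      M * t ^ (-(1 / p)) * ‖ξ‖ ^ (-decayExp d p))
    (hfix : ∀ (t : ℝ) (ξ : Space d), 0 < t → ξ ≠ 0 → DuhamelConverges μ ν κ α Φ t ξ ∧
      Φ t ξ = semigroupSymbol μ ν κ α t ξ *ᵥ x₀ ξ + duhamel μ ν κ α Φ t ξ) :
    IsMildSolution μ ν κ α a₀ u₀ a u := by
  refine ⟨fun s hs => nonlinWellDefined_of_stateNorm_le hd (decayExp_lt hp)
    (lt_two_mul_decayExp hdp) (by positivity) (hF s hs).1 (hF s hs).2 (hb s hs), fun t ht => ?_⟩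
  filter_upwards [hx₀, hΦ t ht, ae_ne_zero hd] with ξ h1 h2 hξ
  have hcong : Set.EqOn (fun s => semigroupSymbol μ ν κ α (t - s) ξ *ᵥ nonlinState μ ν κ (Φ s) ξ)
      (fun s => semigroupSymbol μ ν κ α (t - s) ξ *ᵥ nonlinHat μ ν κ (a s) (u s) ξ)
      (Set.uIoc 0 t) := by
    intro s hs
    rw [Set.uIoc_of_le ht.le] at hs
    simp only
    rw [nonlinHat_eq, nonlinState_congr_ae μ ν κ (hΦ s hs.1)]
  obtain ⟨h3, h4⟩ := hfix t ξ ht hξ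
  refine ⟨IntervalIntegrable.congr hcong h3, ?_⟩
  rw [h1, h2, h4, duhamel]
  congr 1
  exact intervalIntegral.integral_congr_ae (Eventually.of_forall hcong)

end QuantumNSK

end

theorem mainTheorem1 (d : ℕ) (hd : 2 ≤ d) (p : ℝ) (hp : 2 < p)
    (hdp : 0 < (d : ℝ) - 3 + 4 / p)
    (μ ν κ α : ℝ) (hμ : 0 < μ) (hμν : 0 < μ + ν) (hκ : 0 < κ) (hα : 0 < α) :
    ∃ ρ > (0 : ℝ), ∃ R > (0 : ℝ),
      ∀ (a₀ : QuantumNSK.Distr d) (u₀ : Fin d → QuantumNSK.Distr d),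
        QuantumNSK.MemPM ((d : ℝ) - 1) (QuantumNSK.scalar a₀) →
        QuantumNSK.MemPM (d : ℝ) (QuantumNSK.scalar a₀) →
        QuantumNSK.MemPM ((d : ℝ) - 1) u₀ →
        QuantumNSK.dataNorm ((d : ℝ) - 1) a₀ u₀ ≤ ENNReal.ofReal ρ →
        ∃ (a : ℝ → QuantumNSK.Distr d) (u : ℝ → Fin d → QuantumNSK.Distr d),
          (QuantumNSK.MemX p a u ∧ QuantumNSK.IsMildSolution μ ν κ α a₀ u₀ a u ∧
            QuantumNSK.xNorm p a u ≤ ENNReal.ofReal R) ∧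
          ∀ (b : ℝ → QuantumNSK.Distr d) (v : ℝ → Fin d → QuantumNSK.Distr d),
            QuantumNSK.MemX p b v → QuantumNSK.IsMildSolution μ ν κ α a₀ u₀ b v →
            QuantumNSK.xNorm p b v ≤ ENNReal.ofReal R →
            ∀ t > 0, b t = a t ∧ v t = u t := by
  open QuantumNSK in
  have hd0 : 0 < d := by omega
  obtain ⟨K, hK, hlip⟩ := exists_duhamelLipschitz hd0 hμ hμν hκ hα hp hdp
  obtain ⟨C, hC, hlin⟩ := exists_stateNorm_semigroup_le_rpow (d := d) (β := 1 / p) hμ hμν hκ hα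
    (by positivity)
  -- The solution is constructed in the ball of radius `M`; a pair in the ball of radius `R` of
  -- `X_∞` is bounded by `2 R` in the weighted norm of states.
  set R : ℝ := 1 / (4 * K) with hR
  have hR0 : 0 < R := by positivity
  have hKR : K * (2 * R) ≤ 1 / 2 := by
    rw [hR]; field_simp; norm_num
  set M : ℝ := R / (1 + d) with hM
  have hM0 : 0 < M := by positivity
  have hMR : M ≤ 2 * R := by
    have : M ≤ R := div_le_self hR0.le (by linarith [(Nat.cast_nonneg d : (0 : ℝ) ≤ d)])
    linarith
  have hKM : K * M ≤ 1 / 2 := (mul_le_mul_of_nonneg_left hMR hK.le).trans hKR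
  refine ⟨M / (4 * C), by positivity, R, hR0, fun a₀ u₀ ha₀ _ hu₀ hdata => ?_⟩
  set ρ : ℝ := M / (4 * C) with hρ
  have hρ0 : 0 < ρ := by positivity
  obtain ⟨x₀, hx₀m, hx₀e, hx₀b⟩ := exists_measurable_representative
    (aestronglyMeasurable_stateHat (ha₀.1 ()) hu₀.1) (by positivity)
    (stateNorm_le_of_dataNorm_le hd0 hρ0.le hdata)
  have hfree : ∀ (t : ℝ) (ξ : Space d), 0 < t → ξ ≠ 0 →
      stateNorm ξ (semigroupSymbol μ ν κ α t ξ *ᵥ x₀ ξ) ≤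
        M / 2 * (t ^ (-(1 / p)) * ‖ξ‖ ^ (-decayExp d p)) := by
    intro t ξ ht hξ
    refine (hlin ξ (x₀ ξ) t ht hξ).trans ((mul_le_mul_of_nonneg_left (hx₀b ξ)
      (by positivity)).trans (le_of_eq ?_))
    have hw : ‖ξ‖ ^ (-decayExp d p) = ‖ξ‖ ^ (-(2 * (1 / p))) * ‖ξ‖ ^ (-((d : ℝ) - 1)) := by
      rw [← Real.rpow_add (norm_pos_iff.2 hξ)]
      unfold decayExp
      ring_nf
    have hCρ : C * (2 * ρ) = M / 2 := by rw [hρ]; field_simp; norm_num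
    rw [hw, ← hCρ]
    ring
  obtain ⟨Φ, hΦm, hΦ⟩ := exists_duhamel_fixedPoint hd0 hμ hμν hκ hα hp hdp hlip hM0.le hKM hx₀m
    hfree
  obtain ⟨ω, hω0, hω, hωΦ⟩ := exists_modulus_of_fixedPoint hd0 hμ hμν hκ hα hp hdp hM0.le
    (by positivity) hx₀b hΦm fun t ξ ht hξ => ⟨(hΦ t ξ ht hξ).1, (hΦ t ξ ht hξ).2.2⟩
  have hΦb : ∀ t > 0, ∀ᵐ ξ, stateNorm ξ (Φ t ξ) ≤
      M * t ^ (-(1 / p)) * ‖ξ‖ ^ (-decayExp d p) := fun t ht =>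
    (ae_ne_zero hd0).mono fun ξ hξ => (hΦ t ξ ht hξ).1.trans (le_of_eq (mul_assoc _ _ _).symm)
  have hθ0 : 0 ≤ decayExp d p := by
    have := lt_two_mul_decayExp hdp
    linarith [(Nat.cast_nonneg d : (0 : ℝ) ≤ d)]
  have hex : ∀ t : ℝ, ∃ (a : Distr d) (u : Fin d → Distr d), 0 < t →
      HasFourierFunction a ∧ (∀ j, HasFourierFunction (u j)) ∧ stateHat a u =ᵐ[volume] Φ t := by
    intro t
    by_cases ht : 0 < t
    · obtain ⟨a, u, h⟩ := exists_distr_of_stateNorm_le hd0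
        (stronglyMeasurable_section hΦm t).aestronglyMeasurable hθ0 (decayExp_lt hp) (hΦb t ht)
      exact ⟨a, u, fun _ => h⟩
    · exact ⟨0, 0, fun h => absurd h ht⟩
  choose a u hau using hex
  have hF : ∀ t > 0, HasFourierFunction (a t) ∧ ∀ j, HasFourierFunction (u t j) := fun t ht =>
    ⟨(hau t ht).1, (hau t ht).2.1⟩
  have hae : ∀ t > 0, stateHat (a t) (u t) =ᵐ[volume] Φ t := fun t ht => (hau t ht).2.2
  have hb : ∀ t > 0, ∀ᵐ ξ, stateNorm ξ (stateHat (a t) (u t) ξ) ≤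
      M * t ^ (-(1 / p)) * ‖ξ‖ ^ (-decayExp d p) := by
    intro t ht
    filter_upwards [hae t ht, hΦb t ht] with ξ h1 h2
    rwa [h1]
  obtain ⟨hX, hXn⟩ := memX_and_xNorm_le hd0 hM0.le hF hb hω0 hω fun t ht h hh => by
    filter_upwards [hae t ht, hae (t + h) (by linarith), ae_ne_zero hd0] with ξ h1 h2 hξ
    rw [h1, h2]
    exact hωΦ t ht h hh ξ hξ
  have hRM : (1 + (d : ℝ)) * M = R := by rw [hM]; field_simp
  rw [hRM] at hXn
  have hmild : IsMildSolution μ ν κ α a₀ u₀ a u :=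
    isMildSolution_of_fixedPoint hd0 hp hdp hM0.le hx₀e hF hae hb
      fun t ξ ht hξ => (hΦ t ξ ht hξ).2
  refine ⟨a, u, ⟨hX, hmild, hXn⟩, fun b v hY hmild' hYn t ht => ?_⟩
  have hmeas : ∀ {a : ℝ → Distr d} {u : ℝ → Fin d → Distr d}, MemX p a u →
      ∀ s > 0, AEStronglyMeasurable (stateHat (a s) (u s)) volume := fun h s hs =>
    aestronglyMeasurable_stateHat (h.hasFourierFunction hs).1 (h.hasFourierFunction hs).2
  have heq := ae_eq_of_duhamel_fixedPoint hd0 hlip (by positivity : 0 ≤ 2 * R) hKR (hmeas hY)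
    (hmeas hX) (fun s hs => stateNorm_le_of_xNorm_le hd0 hR0.le hYn hs)
    (fun s hs => stateNorm_le_of_xNorm_le hd0 hR0.le hXn hs) hmild'.duhamel_eq hmild.duhamel_eq ht
  exact ⟨eq_of_hat_ae_eq (hY.hasFourierFunction ht).1 (hF t ht).1
      (heq.mono fun ξ hξ => congrFun hξ (Sum.inl ())),
    funext fun j => eq_of_hat_ae_eq ((hY.hasFourierFunction ht).2 j) ((hF t ht).2 j)
      (heq.mono fun ξ hξ => congrFun hξ (Sum.inr j))⟩
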